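/- Let $1\le r\le n$ be integers, let $X_1,\dots,X_{r+1}$ be i.i.d. random points in $\mathbb R^n$, and let $\mathcal V_{n,r}$ be the $r$-dimensional volume of the (possibly degenerate) simplex with vertices $X_1,\dots,X_{r+1}$. Notation for laws: $\chi^2_d$ is the chi-square law with $d$ degrees of freedom. For $a,b>0$, $\mathrm{Beta}(a,b)$ has density $\frac{\Gamma(a+b)}{\Gamma(a)\Gamma(b)}t^{a-1}(1-t)^{b-1}$ on $(0,1)$ and $\mathrm{Beta}'(a,b)$ has density $\frac{\Gamma(a+b)}{\Gamma(a)\Gamma(b)}t^{a-1}(1+t)^{-a-b}$ on $(0,\infty)$; moreover $\mathrm{Beta}(a,0)$ denotes the unit mass at $1$. We write $\chi^2_d$, $\beta_{a,b}$, $\beta'_{a,b}$ for random variables with the laws $\chi^2_d$, $\mathrm{Beta}(a,b)$, $\mathrm{Beta}'(a,b)$. The factors in each product below are independent, and $\stackrel{d}{=}$ denotes equality in law. (a) *Gaussian model.* If the $X_i$ are standard normal in $\mathbb R^n$, then $$(r!\,\mathcal V_{n,r})^2\stackrel{d}{=}(r+1)\prod_{j=1}^r\chi^2_{n-r+j}.$$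 (b) *Beta model.* Let $\nu>0$ with $n+\nu\ge 2$. If the $X_i$ have density $\pi^{-n/2}\frac{\Gamma((n+\nu)/2)}{\Gamma(\nu/2)}(1-|x|^2)^{(\nu-2)/2}$ on $\{|x|<1\}$, then $$\xi(1-\xi)^r(r!\,\mathcal V_{n,r})^2\stackrel{d}{=}(1-\eta)^r\prod_{j=1}^r\beta_{\frac{n-r+j}2,\frac{\nu+r-j}2},$$ where $\xi,\eta\sim\mathrm{Beta}\big(\frac{n+\nu}2,\frac{r(n+\nu-2)}2\big)$, $\xi$ is independent of $\mathcal V_{n,r}$, and $\eta$ is independent of the family of factors of the product. (c) *Beta prime model.* Let $\nu>0$. If the $X_i$ have density $\pi^{-n/2}\frac{\Gamma((n+\nu)/2)}{\Gamma(\nu/2)}(1+|x|^2)^{-(n+\nu)/2}$ on $\mathbb R^n$, then $$(1+\eta)^r(r!\,\mathcal V_{n,r})^2\stackrel{d}{=}\xi^{-1}(1+\xi)^{r+1}\prod_{j=1}^r\beta'_{\frac{n-r+j}2,\frac\nu2},$$ where $\xi,\eta\sim\mathrm{Beta}'\big(\frac\nu2,\frac{r\nu}2\big)$, $\eta$ is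 independent of $\mathcal V_{n,r}$, and $\xi$ is independent of the family of factors of the product. (d) *Spherical model.* Let $n\ge2$. If the $X_i$ are uniformly distributed on the unit sphere of $\mathbb R^n$, then $$\xi(1-\xi)^r(r!\,\mathcal V_{n,r})^2\stackrel{d}{=}(1-\eta)^r\prod_{j=1}^r\beta_{\frac{n-r+j}2,\frac{r-j}2},$$ where $\xi,\eta\sim\mathrm{Beta}\big(\frac n2,\frac{r(n-2)}2\big)$, $\xi$ is independent of $\mathcal V_{n,r}$, and $\eta$ is independent of the family of factors of the product. -/

import Mathlib

open MeasureTheory ProbabilityTheory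

noncomputable section

namespace RandomSimplex

/-- The `r`-dimensional volume of the (possibly degenerate) simplex with vertices
`x 0, …, x r` in `ℝⁿ`: the `r`-dimensional Hausdorff measure, normalised so that it is Lebesgue
measure on `r`-dimensional subspaces, of the convex hull of the vertices. -/
def simplexVolume {n r : ℕ} (x : Fin (r + 1) → EuclideanSpace ℝ (Fin n)) : ℝ :=
  (Measure.euclideanHausdorffMeasure r (convexHull ℝ (Set.range x))).toReal

/-! ### The four laws of the random points -/

/-- The standard normal distribution on `ℝⁿ`. -/
def gaussianModel (n : ℕ) : Measure (EuclideanSpace ℝ (Fin n)) :=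
  stdGaussian (EuclideanSpace ℝ (Fin n))

/-- The Beta distribution with parameter `ν` on the unit ball of `ℝⁿ`. -/
def betaModel (n : ℕ) (ν : ℝ) : Measure (EuclideanSpace ℝ (Fin n)) :=
  volume.withDensity fun x =>
    ENNReal.ofReal
      (if ‖x‖ < 1 then
        1 / Real.pi ^ ((n : ℝ) / 2) * (Real.Gamma ((n + ν) / 2) / Real.Gamma (ν / 2)) *
          (1 - ‖x‖ ^ 2) ^ ((ν - 2) / 2)
      else 0)

/-- The Beta prime distribution with parameter `ν` on `ℝⁿ`. -/
def betaPrimeModel (n : ℕ) (ν : ℝ) : Measure (EuclideanSpace ℝ (Fin n)) :=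
  volume.withDensity fun x =>
    ENNReal.ofReal
      (1 / Real.pi ^ ((n : ℝ) / 2) * (Real.Gamma ((n + ν) / 2) / Real.Gamma (ν / 2)) *
        (1 + ‖x‖ ^ 2) ^ (-(n + ν) / 2))

/-- The uniform distribution on the unit sphere of `ℝⁿ`, as a measure on `ℝⁿ`. -/
def sphericalModel (n : ℕ) : Measure (EuclideanSpace ℝ (Fin n)) :=
  let σ := (volume : Measure (EuclideanSpace ℝ (Fin n))).toSphere
  ((σ Set.univ)⁻¹ • σ).map Subtype.val

/-! ### The laws of the real random variables -/

/-- The chi-square distribution with `d` degrees of freedom. -/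
def chiSquareLaw (d : ℕ) : Measure ℝ := gammaMeasure ((d : ℝ) / 2) (1 / 2)

/-- The Beta distribution with parameters `a > 0` and `b ≥ 0`, where for `b = 0` it is the unit
mass at `1` (the weak limit for `b ↓ 0`). -/
def betaLaw (a b : ℝ) : Measure ℝ :=
  if b = 0 then Measure.dirac 1 else betaMeasure a b

/-- The Beta prime distribution with parameters `a, b > 0`. -/
def betaPrimeLaw (a b : ℝ) : Measure ℝ :=
  volume.withDensity fun t =>
    ENNReal.ofReal
      (if 0 < t then
        Real.Gamma (a + b) / (Real.Gamma a * Real.Gamma b) * t ^ (a - 1) * (1 + t) ^ (-a - b)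
      else 0)

end RandomSimplex

end

/-! By Gram's formula $(r!\,\mathcal V)^2$ is the determinant `edgeGramDet` of the inner products of
the edges at one vertex (`factorial_mul_simplexVolume_sq`), so all four models concern the law of
that determinant.

The core is the Gaussian simplex with rescaled vertices $c_i g_i$. Its $r$ edges are linear
combinations of $r+1$ independent Gaussian vectors, and their joint law depends only on the Gram
matrix of the coefficients. Hence the coefficient matrix may be replaced by a square one, and the
determinant splits into $(\prod c_i^2)(\sum c_i^{-2})$ times the Gram determinant of $r$ independent
Gaussian vectors. By rotation invariance and successive projection the latter is a product of
independent chi-squares (`map_det_gram_gaussian`, `map_edgeGramDet_smul_gaussian_eq_chiSquare`).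
Taking $c=1$ gives the Gaussian model.

A beta prime point is $g/\sqrt t$ with $t$ gamma distributed, so conditionally on the $t_i$ the core
result applies with $c_i=t_i^{-1/2}$. The Mellin transform of $(\prod t_i^{-1})\sum t_i$ is
explicit, since tilting by $\prod t_i^{-s}$ keeps the $t_i$ gamma. The variables $\xi,\eta$ supply
the gamma factors by which the two sides differ, and Mellin transforms near $0$ determine the laws
(`measure_ext_of_mellin`).

The beta and spherical models are both radial. For a radial law the $k$-th moment of the determinant
is a finite sum of products of radial moments, with coefficients that do not depend on the radial
law. The Gaussian formula, valid for all nonzero $c$, is a polynomial identity in $c$ that controls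
these coefficients. Applying a linear functional to it replaces Gaussian radial moments by those of
the other law (`sum_mul_prod_eq_of_eval_eq`). The resulting sum is a multinomial Chu–Vandermonde sum
(`integral_edgeGramDet_pow_radialLaw`). Everything is bounded, so integer moments suffice
(`measure_ext_of_moments`). The parameter $b$ is $(n+\nu)/2$ in the beta model and $n/2$ on the
sphere. -/

namespace RandomSimplex

open scoped ENNReal Topology Matrix

/-! ### Simplex volume as a Gram determinant -/

section Volume

open scoped Pointwise

/-- The squared volume of the parallelotope spanned by the edges of the simplex at its vertex
`x 0`. -/
noncomputable def edgeGramDet {n r : ℕ} (x : Fin (r + 1) → EuclideanSpace ℝ (Fin n)) : ℝ :=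
  (Matrix.gram ℝ fun i : Fin r => x i.succ - x 0).det

lemma measurableSet_corner (r : ℕ) (t : ℝ) :
    MeasurableSet {x : Fin r → ℝ | (∀ i, 0 ≤ x i) ∧ ∑ i, x i ≤ t} := by
  have h : {x : Fin r → ℝ | (∀ i, 0 ≤ x i) ∧ ∑ i, x i ≤ t} =
      (⋂ i, {x : Fin r → ℝ | 0 ≤ x i}) ∩ {x | ∑ i, x i ≤ t} := by
    ext x
    simp
  rw [h]
  exact (MeasurableSet.iInter fun i => measurableSet_le measurable_const
    (measurable_pi_apply i)).inter (measurableSet_le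
      (Finset.measurable_sum _ fun i _ => measurable_pi_apply i) measurable_const)

/-- Fubini in the first coordinate: the slice at height $s\in[0,t]$ is the corner of size $t-s$ one
dimension lower, and $\int_0^t (t-s)^r/r!\,ds=t^{r+1}/(r+1)!$. The general size $t$ is what makes
the induction close. -/
lemma volume_corner (r : ℕ) {t : ℝ} (ht : 0 ≤ t) :
    volume {x : Fin r → ℝ | (∀ i, 0 ≤ x i) ∧ ∑ i, x i ≤ t} =
      ENNReal.ofReal (t ^ r / r.factorial) := by
  induction r generalizing t with
  | zero => simp [ht, volume_pi]
  | succ r ih =>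
    have h := (volume_preserving_piFinSuccAbove (fun _ : Fin (r + 1) => ℝ) 0).symm
    rw [← h.measure_preimage (measurableSet_corner _ _).nullMeasurableSet, Measure.volume_eq_prod,
      Measure.prod_apply (h.measurable (measurableSet_corner _ _))]
    have key : ∀ s : ℝ, volume (Prod.mk s ⁻¹'
        ((MeasurableEquiv.piFinSuccAbove (fun _ : Fin (r + 1) => ℝ) 0).symm ⁻¹'
          {x : Fin (r + 1) → ℝ | (∀ i, 0 ≤ x i) ∧ ∑ i, x i ≤ t})) =
        (Set.Icc 0 t).indicator (fun s => ENNReal.ofReal ((t - s) ^ r / r.factorial)) s := by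
      intro s
      by_cases hs : s ∈ Set.Icc 0 t
      · rw [Set.indicator_of_mem hs, ← ih (sub_nonneg.2 hs.2)]
        congr 1
        ext x
        simp [MeasurableEquiv.piFinSuccAbove, Fin.forall_fin_succ, Fin.sum_univ_succ, hs.1,
          le_sub_iff_add_le']
      · rw [Set.indicator_of_notMem hs]
        convert measure_empty (μ := (volume : Measure (Fin r → ℝ)))
        ext x
        simp only [MeasurableEquiv.piFinSuccAbove, Fin.forall_fin_succ, Fin.sum_univ_succ,
          Set.mem_preimage, Set.mem_ofPred_eq, Set.mem_empty_iff_false, iff_false]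
        simp
        intro h0 h1
        have : 0 ≤ ∑ i, x i := Finset.sum_nonneg fun i _ => h1 i
        by_contra! h2
        exact hs ⟨h0, by linarith⟩
    simp_rw [key]
    rw [lintegral_indicator measurableSet_Icc, ← ofReal_integral_eq_lintegral_ofReal]
    · congr 1
      rw [integral_Icc_eq_integral_Ioc, ← intervalIntegral.integral_of_le ht,
        intervalIntegral.integral_div,
        intervalIntegral.integral_comp_sub_left (fun s => s ^ r) t]
      simp [Nat.factorial_succ, mul_comm]
      field_simp
    · exact (by fun_prop : Continuous fun s : ℝ => (t - s) ^ r / r.factorial).integrableOn_Icc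
    · filter_upwards [ae_restrict_mem measurableSet_Icc] with s hs
      have := sub_nonneg.2 hs.2
      positivity

lemma convexHull_corner (r : ℕ) :
    convexHull ℝ (Set.range (Fin.cons 0 fun i => EuclideanSpace.single i 1 :
      Fin (r + 1) → EuclideanSpace ℝ (Fin r))) =
      {x | (∀ i, 0 ≤ x i) ∧ ∑ i, x i ≤ 1} := by
  apply subset_antisymm
  · apply convexHull_min
    · rintro _ ⟨i, rfl⟩
      refine Fin.cases ?_ (fun j => ?_) i
      · simp
      · simp only [Fin.cons_succ, Set.mem_ofPred_eq]
        refine ⟨fun i => ?_, by simp⟩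
        by_cases h : i = j <;> simp [h]
    · intro x hx y hy a b ha hb hab
      refine ⟨fun i => ?_, ?_⟩
      · have := hx.1 i
        have := hy.1 i
        simp only [PiLp.add_apply, PiLp.smul_apply, smul_eq_mul]
        positivity
      · simp only [PiLp.add_apply, PiLp.smul_apply, smul_eq_mul, Finset.sum_add_distrib,
          ← Finset.mul_sum]
        nlinarith [hx.2, hy.2]
  · rintro x ⟨h0, h1⟩
    -- The coordinates of `x` are the weights of the basis vectors; the origin takes the remaining
    -- mass.
    refine mem_convexHull_of_exists_fintype (Fin.cons (1 - ∑ i, x i) fun i => x i)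
      (Fin.cons 0 fun i => EuclideanSpace.single i 1) (fun i => ?_) ?_
      (fun i => Set.mem_range_self i) ?_
    · refine Fin.cases ?_ (fun j => ?_) i
      · simpa using h1
      · simpa using h0 j
    · simp [Fin.sum_univ_succ]
    · ext j
      simp [Fin.sum_univ_succ, Pi.single_apply]

lemma volume_convexHull_corner (r : ℕ) :
    volume (convexHull ℝ (Set.range (Fin.cons 0 fun i => EuclideanSpace.single i 1 :
      Fin (r + 1) → EuclideanSpace ℝ (Fin r)))) = ENNReal.ofReal (1 / r.factorial) := by
  rw [convexHull_corner, ← (EuclideanSpace.volume_preserving_symm_measurableEquiv_toLp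
    (Fin r)).symm.measure_preimage_equiv]
  simpa using volume_corner r zero_le_one

/-- The squared volume of a simplex is a Gram determinant. -/
theorem factorial_mul_simplexVolume_sq {n r : ℕ} (x : Fin (r + 1) → EuclideanSpace ℝ (Fin n)) :
    (r.factorial * simplexVolume x) ^ 2 = edgeGramDet x := by
  let b := EuclideanSpace.basisFun (Fin r) ℝ
  let f : EuclideanSpace ℝ (Fin r) →ₗ[ℝ] EuclideanSpace ℝ (Fin n) :=
    b.toBasis.constr ℝ fun i => x i.succ - x 0
  have hf : ∀ i, f (EuclideanSpace.single i 1) = x i.succ - x 0 := by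
    intro i
    have := b.toBasis.constr_basis ℝ (fun i => x i.succ - x 0) i
    rwa [b.coe_toBasis, EuclideanSpace.basisFun_apply] at this
  -- The simplex is a translate of the linear image of the corner simplex, whose volume is $1/r!$.
  -- The map scales volume by `normDet`, whose square is the Gram determinant of the images of the
  -- basis vectors.
  have h1 : convexHull ℝ (Set.range x) = x 0 +ᵥ f '' convexHull ℝ (Set.range
      (Fin.cons 0 fun i => EuclideanSpace.single i 1 :
        Fin (r + 1) → EuclideanSpace ℝ (Fin r))) := by
    rw [f.image_convexHull, ← convexHull_vadd, ← Set.range_comp, ← Set.image_vadd,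
      ← Set.range_comp]
    congr 2
    ext1 i
    refine Fin.cases ?_ (fun j => ?_) i
    · simp
    · simp [hf]
  have h2 := f.euclideanHausdorffMeasure_image_eq_normDet_mul_volume (convexHull ℝ (Set.range
      (Fin.cons 0 fun i => EuclideanSpace.single i 1 :
        Fin (r + 1) → EuclideanSpace ℝ (Fin r))))
  rw [finrank_euclideanSpace_fin, volume_convexHull_corner] at h2
  rw [simplexVolume, h1, measure_vadd, h2, ENNReal.toReal_mul,
    ENNReal.toReal_ofReal f.normDet_nonneg, ENNReal.toReal_ofReal (by positivity), mul_pow,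
    mul_pow, show f.normDet ^ 2 = _ from f.normDet_sq_eq_det_gram b, edgeGramDet]
  have h3 : (fun i => f (b i)) = fun i => x i.succ - x 0 := by
    ext1 i
    simp [b, hf]
  simp only [h3]
  have : (r.factorial : ℝ) ≠ 0 := by positivity
  field_simp

end Volume

/-! ### Laws determined by their moments -/

/-- A law on the real line is determined by its moment generating function near zero. -/
theorem measure_ext_of_mgf_near_zero {μ ν : Measure ℝ} [IsProbabilityMeasure μ]
    [IsProbabilityMeasure ν] {ε : ℝ} (hε : 0 < ε)
    (hμ : ∀ t, |t| < ε → Integrable (fun x => Real.exp (t * x)) μ)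
    (hν : ∀ t, |t| < ε → Integrable (fun x => Real.exp (t * x)) ν)
    (h : ∀ t, |t| < ε → mgf id μ t = mgf id ν t) : μ = ν := by
  have hset : ∀ ρ : Measure ℝ, (∀ t, |t| < ε → Integrable (fun x => Real.exp (t * x)) ρ) →
      Set.Ioo (-ε) ε ⊆ interior (integrableExpSet id ρ) := fun ρ hρ =>
    interior_maximal (fun t ht => hρ t (abs_lt.2 ht)) isOpen_Ioo
  have hU : IsPreconnected {z : ℂ | z.re ∈ Set.Ioo (-ε) ε} :=
    ((convex_Ioo (-ε) ε).linear_preimage Complex.reLm).isPreconnected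
  have hA : ∀ ρ : Measure ℝ, (∀ t, |t| < ε → Integrable (fun x => Real.exp (t * x)) ρ) →
      AnalyticOnNhd ℂ (complexMGF id ρ) {z | z.re ∈ Set.Ioo (-ε) ε} := fun ρ hρ =>
    analyticOnNhd_complexMGF.mono fun z hz => hset ρ hρ hz
  have hmem : (0 : ℂ) ∈ {z : ℂ | z.re ∈ Set.Ioo (-ε) ε} := by simp [hε]
  -- Both complex moment generating functions are analytic on the strip
  -- $|\mathrm{Re}\,z|<\varepsilon$. Agreement on a real segment through $0$ propagates to the
  -- imaginary axis, where they are the characteristic functions.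
  have hfreq : ∃ᶠ z : ℂ in 𝓝[≠] 0, complexMGF id μ z = complexMGF id ν z := by
    have hr : ∃ᶠ x : ℝ in 𝓝[≠] 0, complexMGF id μ x = complexMGF id ν x := by
      apply Filter.Eventually.frequently
      apply eventually_nhdsWithin_of_eventually_nhds
      filter_upwards [Ioo_mem_nhds (neg_lt_zero.2 hε) hε] with t ht
      rw [complexMGF_ofReal, complexMGF_ofReal, h t (abs_lt.2 ht)]
    refine Filter.Tendsto.frequently (f := ((↑) : ℝ → ℂ)) ?_ hr
    apply tendsto_nhdsWithin_of_tendsto_nhds_of_eventually_within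
    · exact (Complex.continuous_ofReal.tendsto' 0 0 rfl).mono_left nhdsWithin_le_nhds
    · filter_upwards [self_mem_nhdsWithin] with t ht
      simpa using ht
  have heq := (hA μ hμ).eqOn_of_preconnected_of_frequently_eq (hA ν hν) hU hmem hfreq
  apply Measure.ext_of_charFun
  ext t
  rw [← complexMGF_id_mul_I, ← complexMGF_id_mul_I]
  exact heq (by simp [hε])

/-- A law on the positive half-line is determined by its moments of small real order. -/
theorem measure_ext_of_mellin {μ ν : Measure ℝ} [IsProbabilityMeasure μ]
    [IsProbabilityMeasure ν] {ε : ℝ} (hε : 0 < ε)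
    (hμ : ∀ s, |s| < ε → ∫⁻ x, ENNReal.ofReal x ^ s ∂μ ≠ ∞)
    (h : ∀ s, |s| < ε → ∫⁻ x, ENNReal.ofReal x ^ s ∂μ = ∫⁻ x, ENNReal.ofReal x ^ s ∂ν) :
    μ = ν := by
  have key : ∀ ρ : Measure ℝ, (∀ s, |s| < ε → ∫⁻ x, ENNReal.ofReal x ^ s ∂ρ ≠ ∞) →
      (∀ᵐ x ∂ρ, 0 < x) ∧ (∀ s, |s| < ε → Integrable (fun x => Real.exp (s * x))
        (ρ.map Real.log)) ∧
      (∀ s, |s| < ε → mgf id (ρ.map Real.log) s = (∫⁻ x, ENNReal.ofReal x ^ s ∂ρ).toReal) := by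
    intro ρ hρ
    -- In `ℝ≥0∞` a negative power of $0$ is $\infty$, so finiteness of one moment of negative order
    -- excludes nonpositive values. After that, passing to $\log x$ turns the moments into a moment
    -- generating function.
    have hpos : ∀ᵐ x ∂ρ, 0 < x := by
      have h2 : |(-(ε / 2))| < ε := by
        rw [abs_neg, abs_of_pos (by positivity)]
        linarith
      filter_upwards [ae_lt_top (by fun_prop) (hρ _ h2)] with x hx
      by_contra! h3
      rw [ENNReal.ofReal_of_nonpos h3, ENNReal.zero_rpow_of_neg (by linarith)] at hx
      exact lt_irrefl _ hx
    have heq : ∀ s, ∫⁻ x, ENNReal.ofReal (Real.exp (s * Real.log x)) ∂ρ =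
        ∫⁻ x, ENNReal.ofReal x ^ s ∂ρ := by
      intro s
      apply lintegral_congr_ae
      filter_upwards [hpos] with x hx
      rw [ENNReal.ofReal_rpow_of_pos hx, Real.rpow_def_of_pos hx, mul_comm]
    refine ⟨hpos, fun s hs => ?_, fun s hs => ?_⟩
    · rw [integrable_map_measure (by fun_prop) Real.measurable_log.aemeasurable]
      refine ⟨by fun_prop, ?_⟩
      change HasFiniteIntegral (fun x => Real.exp (s * Real.log x)) ρ
      rw [hasFiniteIntegral_iff_ofReal (Filter.Eventually.of_forall fun x => (Real.exp_pos _).le)]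
      rw [heq]
      exact (hρ s hs).lt_top
    · rw [mgf_id_map Real.measurable_log.aemeasurable, mgf,
        integral_eq_lintegral_of_nonneg_ae (Filter.Eventually.of_forall fun x => (Real.exp_pos _).le)
          (by fun_prop), heq]
  obtain ⟨hμ0, hμ1, hμ2⟩ := key μ hμ
  obtain ⟨hν0, hν1, hν2⟩ := key ν fun s hs => h s hs ▸ hμ s hs
  have : IsProbabilityMeasure (μ.map Real.log) :=
    Measure.isProbabilityMeasure_map Real.measurable_log.aemeasurable
  have : IsProbabilityMeasure (ν.map Real.log) :=
    Measure.isProbabilityMeasure_map Real.measurable_log.aemeasurable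
  have hlog := measure_ext_of_mgf_near_zero hε hμ1 hν1 fun s hs => by
    rw [hμ2 s hs, hν2 s hs, h s hs]
  have hexp : ∀ ρ : Measure ℝ, (∀ᵐ x ∂ρ, 0 < x) → (ρ.map Real.log).map Real.exp = ρ := by
    intro ρ hρ
    rw [Measure.map_map Real.measurable_exp Real.measurable_log]
    conv_rhs => rw [← Measure.map_id (μ := ρ)]
    apply Measure.map_congr
    filter_upwards [hρ] with x hx using Real.exp_log hx
  rw [← hexp μ hμ0, ← hexp ν hν0, hlog]

/-- A law on a bounded interval is determined by its integer moments. -/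
theorem measure_ext_of_moments {μ ν : Measure ℝ} [IsProbabilityMeasure μ]
    [IsProbabilityMeasure ν] {C : ℝ} (hμ : ∀ᵐ x ∂μ, |x| ≤ C) (hν : ∀ᵐ x ∂ν, |x| ≤ C)
    (h : ∀ k : ℕ, ∫ x, x ^ k ∂μ = ∫ x, x ^ k ∂ν) : μ = ν := by
  -- The exponential series of the characteristic function may be integrated term by term, being
  -- dominated by the series of $e^{|t||C|}$.
  have key : ∀ ρ : Measure ℝ, IsProbabilityMeasure ρ → (∀ᵐ x ∂ρ, |x| ≤ C) → ∀ t : ℝ,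
      HasSum (fun k : ℕ => ((t * Complex.I) ^ k / k.factorial) * ((∫ x, x ^ k ∂ρ : ℝ) : ℂ))
        (charFun ρ t) := by
    intro ρ _ hρ t
    rw [charFun_apply_real]
    have : ∀ k : ℕ, ((t * Complex.I) ^ k / k.factorial) * ((∫ x, x ^ k ∂ρ : ℝ) : ℂ) =
        ∫ x, ((t * Complex.I) ^ k / k.factorial) * ((x ^ k : ℝ) : ℂ) ∂ρ := by
      intro k
      rw [integral_const_mul, integral_complex_ofReal]
    simp_rw [this]
    apply hasSum_integral_of_dominated_convergence
      (fun k _ => (|t| * |C|) ^ k / k.factorial)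
    · intro k
      fun_prop
    · intro k
      filter_upwards [hρ] with x hx
      simp only [Complex.ofReal_pow, norm_mul, norm_div, norm_pow, Complex.norm_real,
        Real.norm_eq_abs, Complex.norm_I, one_pow, mul_one, Complex.norm_natCast, mul_pow]
      rw [div_mul_eq_mul_div]
      exact div_le_div_of_nonneg_right (mul_le_mul_of_nonneg_left (pow_le_pow_left₀ (abs_nonneg _)
        (hx.trans (le_abs_self C)) k) (by positivity)) (by positivity)
    · exact Filter.Eventually.of_forall fun _ => Real.summable_pow_div_factorial _
    · exact integrable_const _
    · refine Filter.Eventually.of_forall fun x => ?_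
      have := NormedSpace.expSeries_div_hasSum_exp (𝔸 := ℂ) ((t * Complex.I) * x)
      rw [← Complex.exp_eq_exp_ℂ] at this
      rw [show (t : ℂ) * x * Complex.I = t * Complex.I * x by ring]
      refine this.congr_fun fun k => ?_
      rw [Complex.ofReal_pow, mul_pow _ (x : ℂ)]
      ring
  apply Measure.ext_of_charFun
  ext t
  refine (key μ inferInstance hμ t).unique ?_
  simp_rw [h]
  exact key ν inferInstance hν t

/-! ### Gamma, beta and beta prime integrals -/

lemma lintegral_rpow_mul_exp_neg {a r : ℝ} (ha : 0 < a) (hr : 0 < r) :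
    ∫⁻ x in Set.Ioi (0 : ℝ), ENNReal.ofReal (x ^ (a - 1) * Real.exp (-(r * x))) =
      ENNReal.ofReal (Real.Gamma a * r ^ (-a)) := by
  have h := Real.integral_rpow_mul_exp_neg_mul_Ioi ha hr
  have hne : (1 / r) ^ a * Real.Gamma a ≠ 0 := by
    have := Real.Gamma_pos_of_pos ha
    positivity
  rw [← ofReal_integral_eq_lintegral_ofReal, h]
  · rw [one_div, Real.inv_rpow hr.le, Real.rpow_neg hr.le, mul_comm]
  · exact Integrable.of_integral_ne_zero (h ▸ hne)
  · filter_upwards [ae_restrict_mem measurableSet_Ioi] with x hx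
    have : 0 < x := hx
    positivity

/-- Change of density in one form for all later uses: if a weight `w` carries the density `p` to `c`
times `q`, then `w` may be removed from an integral at the price of replacing the law. Moments
follow from `f = 1`, because the new law is again a probability measure. -/
lemma lintegral_mul_withDensity_eq {p q w f : ℝ → ℝ≥0∞} {c : ℝ≥0∞} (hp : Measurable p)
    (hq : Measurable q) (hw : Measurable w) (hf : Measurable f)
    (h : ∀ᵐ x, p x * w x = c * q x) :
    ∫⁻ x, w x * f x ∂(volume.withDensity p) = c * ∫⁻ x, f x ∂(volume.withDensity q) := by
  rw [show ∫⁻ x, w x * f x ∂(volume.withDensity p) = _ from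
      lintegral_withDensity_eq_lintegral_mul _ hp (hw.mul hf),
    lintegral_withDensity_eq_lintegral_mul _ hq hf, ← lintegral_const_mul _ (hq.mul hf)]
  apply lintegral_congr_ae
  filter_upwards [h] with x hx
  simp only [Pi.mul_apply]
  rw [← mul_assoc, hx, mul_assoc]

lemma measurable_gammaPDF (a r : ℝ) : Measurable (gammaPDF a r) :=
  (measurable_gammaPDFReal a r).ennreal_ofReal

lemma measurable_betaPDF (a b : ℝ) : Measurable (betaPDF a b) :=
  (measurable_betaPDFReal a b).ennreal_ofReal

lemma ae_pos_gammaMeasure (a r : ℝ) : ∀ᵐ x ∂(gammaMeasure a r), 0 < x := by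
  rw [gammaMeasure, ae_withDensity_iff (measurable_gammaPDF a r)]
  filter_upwards [Measure.ae_ne volume (0 : ℝ)] with x hx h
  by_contra! h2
  exact h (gammaPDF_of_neg (lt_of_le_of_ne h2 hx))

/-- A power of $x$ only shifts the shape parameter of a gamma law. The arbitrary `f` is kept for
tilting all coordinates of a product measure at once. -/
lemma lintegral_rpow_mul_gammaMeasure {a r s : ℝ} (ha : 0 < a) (hr : 0 < r) (has : 0 < a + s)
    {f : ℝ → ℝ≥0∞} (hf : Measurable f) :
    ∫⁻ x, ENNReal.ofReal x ^ s * f x ∂(gammaMeasure a r) =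
      ENNReal.ofReal (r ^ (-s) * Real.Gamma (a + s) / Real.Gamma a) *
        ∫⁻ x, f x ∂(gammaMeasure (a + s) r) := by
  have h1 := Real.Gamma_pos_of_pos ha
  have h2 := Real.Gamma_pos_of_pos has
  refine lintegral_mul_withDensity_eq (measurable_gammaPDF _ _) (measurable_gammaPDF _ _)
    (by fun_prop) hf ?_
  filter_upwards [Measure.ae_ne volume (0 : ℝ)] with x hx
  rcases hx.lt_or_gt with hx | hx
  · simp [gammaPDF_of_neg hx]
  · rw [gammaPDF_of_nonneg hx.le, gammaPDF_of_nonneg hx.le, ENNReal.ofReal_rpow_of_pos hx,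
      ← ENNReal.ofReal_mul (by positivity), ← ENNReal.ofReal_mul (by positivity)]
    congr 1
    rw [show a + s - 1 = (a - 1) + s by ring, Real.rpow_add hx, Real.rpow_add hr,
      Real.rpow_neg hr.le]
    field_simp

lemma lintegral_rpow_gammaMeasure {a r s : ℝ} (ha : 0 < a) (hr : 0 < r) (has : 0 < a + s) :
    ∫⁻ x, ENNReal.ofReal x ^ s ∂(gammaMeasure a r) =
      ENNReal.ofReal (r ^ (-s) * Real.Gamma (a + s) / Real.Gamma a) := by
  have := isProbabilityMeasure_gammaMeasure has hr
  simpa using lintegral_rpow_mul_gammaMeasure ha hr has (f := fun _ => 1) measurable_const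

lemma lintegral_rpow_betaMeasure {a b s t : ℝ} (ha : 0 < a) (hb : 0 < b) (has : 0 < a + s)
    (hbt : 0 < b + t) :
    ∫⁻ x, ENNReal.ofReal x ^ s * ENNReal.ofReal (1 - x) ^ t ∂(betaMeasure a b) =
      ENNReal.ofReal (beta (a + s) (b + t) / beta a b) := by
  have h1 := beta_pos ha hb
  have h2 := beta_pos has hbt
  have := isProbabilityMeasureBeta has hbt
  have h := lintegral_mul_withDensity_eq (measurable_betaPDF a b)
    (measurable_betaPDF (a + s) (b + t))
    (w := fun x => ENNReal.ofReal x ^ s * ENNReal.ofReal (1 - x) ^ t)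
    (c := ENNReal.ofReal (beta (a + s) (b + t) / beta a b))
    (by fun_prop) (f := fun _ => 1) measurable_const (Filter.Eventually.of_forall fun x => ?_)
  · simp only [mul_one] at h
    rw [betaMeasure, h, ← betaMeasure]
    simp
  · by_cases hx : 0 < x ∧ x < 1
    · obtain ⟨hx0, hx1⟩ := hx
      have hx2 : 0 < 1 - x := by linarith
      rw [betaPDF_of_pos_lt_one hx0 hx1, betaPDF_of_pos_lt_one hx0 hx1,
        ENNReal.ofReal_rpow_of_pos hx0, ENNReal.ofReal_rpow_of_pos hx2,
        ← ENNReal.ofReal_mul (by positivity), ← ENNReal.ofReal_mul (by positivity),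
        ← ENNReal.ofReal_mul (by positivity)]
      congr 1
      rw [show a + s - 1 = (a - 1) + s by ring, show b + t - 1 = (b - 1) + t by ring,
        Real.rpow_add hx0, Real.rpow_add hx2]
      field_simp
    · simp [betaPDF_eq, hx]

/-- The density of the beta prime distribution. -/
noncomputable def betaPrimePDF (a b t : ℝ) : ℝ≥0∞ :=
  ENNReal.ofReal
    (if 0 < t then
      Real.Gamma (a + b) / (Real.Gamma a * Real.Gamma b) * t ^ (a - 1) * (1 + t) ^ (-a - b)
    else 0)

lemma betaPrimeLaw_eq (a b : ℝ) : betaPrimeLaw a b = volume.withDensity (betaPrimePDF a b) := rfl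

lemma measurable_betaPrimePDF (a b : ℝ) : Measurable (betaPrimePDF a b) :=
  (Measurable.ite measurableSet_Ioi (by fun_prop) (by fun_prop)).ennreal_ofReal

lemma ae_pos_betaPrimeLaw (a b : ℝ) : ∀ᵐ x ∂(betaPrimeLaw a b), 0 < x := by
  rw [betaPrimeLaw_eq, ae_withDensity_iff (measurable_betaPrimePDF a b)]
  refine Filter.Eventually.of_forall fun x h => ?_
  by_contra h2
  simp [betaPrimePDF, h2] at h

/-- The factor $(1+t)^{-(a+b)}$ is written as a gamma integral in an auxiliary variable $y$. After
Tonelli, the $t$-integral and then the $y$-integral are again gamma integrals. -/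
lemma isProbabilityMeasure_betaPrimeLaw {a b : ℝ} (ha : 0 < a) (hb : 0 < b) :
    IsProbabilityMeasure (betaPrimeLaw a b) := by
  have hA := Real.Gamma_pos_of_pos ha
  have hB := Real.Gamma_pos_of_pos hb
  have hAB := Real.Gamma_pos_of_pos (add_pos ha hb)
  constructor
  have h1 : ∀ t ∈ Set.Ioi (0 : ℝ), betaPrimePDF a b t =
      ∫⁻ y in Set.Ioi (0 : ℝ), ENNReal.ofReal (1 / (Real.Gamma a * Real.Gamma b)) *
        (ENNReal.ofReal (y ^ (a + b - 1) * Real.exp (-y)) *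
          ENNReal.ofReal (t ^ (a - 1) * Real.exp (-(y * t)))) := by
    intro t ht
    have ht0 : (0 : ℝ) < t := ht
    have h := lintegral_rpow_mul_exp_neg (add_pos ha hb) (show 0 < 1 + t by linarith)
    calc betaPrimePDF a b t = ENNReal.ofReal (t ^ (a - 1) / (Real.Gamma a * Real.Gamma b)) *
        ENNReal.ofReal (Real.Gamma (a + b) * (1 + t) ^ (-(a + b))) := by
          rw [betaPrimePDF, if_pos ht0, ← ENNReal.ofReal_mul (by positivity),
            show -a - b = -(a + b) by ring]
          congr 1
          field_simp
      _ = _ := by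
          rw [← h, ← lintegral_const_mul _ (by fun_prop)]
          refine setLIntegral_congr_fun measurableSet_Ioi fun y hy => ?_
          have hy0 : (0 : ℝ) < y := hy
          rw [← ENNReal.ofReal_mul (by positivity), ← ENNReal.ofReal_mul (by positivity),
            ← ENNReal.ofReal_mul (by positivity)]
          congr 1
          rw [show -((1 + t) * y) = -y + -(y * t) by ring, Real.exp_add]
          field_simp
  rw [betaPrimeLaw_eq, withDensity_apply _ MeasurableSet.univ, Measure.restrict_univ,
    ← setLIntegral_eq_of_support_subset (s := Set.Ioi (0 : ℝ)) (by
      intro t ht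
      by_contra h2
      simp only [Set.mem_Ioi] at h2
      simp [betaPrimePDF, h2] at ht),
    setLIntegral_congr_fun measurableSet_Ioi h1, lintegral_lintegral_swap (by fun_prop)]
  have h2 : ∀ y ∈ Set.Ioi (0 : ℝ), ∫⁻ t in Set.Ioi (0 : ℝ),
      ENNReal.ofReal (1 / (Real.Gamma a * Real.Gamma b)) *
        (ENNReal.ofReal (y ^ (a + b - 1) * Real.exp (-y)) *
          ENNReal.ofReal (t ^ (a - 1) * Real.exp (-(y * t)))) =
      ENNReal.ofReal (1 / Real.Gamma b) * ENNReal.ofReal (y ^ (b - 1) * Real.exp (-(1 * y))) := by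
    intro y hy
    have hy0 : (0 : ℝ) < y := hy
    rw [lintegral_const_mul _ (by fun_prop), lintegral_const_mul _ (by fun_prop),
      lintegral_rpow_mul_exp_neg ha hy0, ← ENNReal.ofReal_mul (by positivity),
      ← ENNReal.ofReal_mul (by positivity), ← ENNReal.ofReal_mul (by positivity)]
    congr 1
    rw [show a + b - 1 = a + (b - 1) by ring, Real.rpow_add hy0, Real.rpow_neg hy0.le, one_mul]
    field_simp
  rw [setLIntegral_congr_fun measurableSet_Ioi h2, lintegral_const_mul _ (by fun_prop),
    lintegral_rpow_mul_exp_neg hb one_pos, ← ENNReal.ofReal_mul (by positivity)]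
  simp [hB.ne']

lemma lintegral_rpow_betaPrimeLaw {a b s t : ℝ} (ha : 0 < a) (hb : 0 < b) (has : 0 < a + s)
    (hbt : 0 < b - s - t) :
    ∫⁻ x, ENNReal.ofReal x ^ s * ENNReal.ofReal (1 + x) ^ t ∂(betaPrimeLaw a b) =
      ENNReal.ofReal (beta (a + s) (b - s - t) / beta a b) := by
  have h1 := Real.Gamma_pos_of_pos ha
  have h2 := Real.Gamma_pos_of_pos hb
  have h3 := Real.Gamma_pos_of_pos has
  have h4 := Real.Gamma_pos_of_pos hbt
  have h5 := Real.Gamma_pos_of_pos (add_pos ha hb)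
  have h6 := Real.Gamma_pos_of_pos (add_pos has hbt)
  have := isProbabilityMeasure_betaPrimeLaw has hbt
  have h := lintegral_mul_withDensity_eq (measurable_betaPrimePDF a b)
    (measurable_betaPrimePDF (a + s) (b - s - t))
    (w := fun x => ENNReal.ofReal x ^ s * ENNReal.ofReal (1 + x) ^ t)
    (c := ENNReal.ofReal (beta (a + s) (b - s - t) / beta a b))
    (by fun_prop) (f := fun _ => 1) measurable_const (Filter.Eventually.of_forall fun x => ?_)
  · simp only [mul_one] at h
    rw [betaPrimeLaw_eq, h, ← betaPrimeLaw_eq]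
    simp
  · by_cases hx : 0 < x
    · have hx2 : 0 < 1 + x := by linarith
      simp only [betaPrimePDF, if_pos hx, beta]
      rw [ENNReal.ofReal_rpow_of_pos hx, ENNReal.ofReal_rpow_of_pos hx2,
        ← ENNReal.ofReal_mul (by positivity), ← ENNReal.ofReal_mul (by positivity),
        ← ENNReal.ofReal_mul (by positivity)]
      congr 1
      rw [show a + s - 1 = (a - 1) + s by ring,
        show -(a + s) - (b - s - t) = (-a - b) + t by ring,
        Real.rpow_add hx, Real.rpow_add hx2]
      field_simp
    · simp [betaPrimePDF, hx]

/-- Exponential tilting replaces the rate $r$ by $r-t$; the generating function is the ratio of the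
normalising constants. -/
lemma integrable_exp_mul_gammaMeasure {a r t : ℝ} (ha : 0 < a) (hr : 0 < r) (ht : t < r) :
    Integrable (fun x => Real.exp (t * x)) (gammaMeasure a r) ∧
      mgf id (gammaMeasure a r) t = (r / (r - t)) ^ a := by
  have hG := Real.Gamma_pos_of_pos ha
  have hrt : 0 < r - t := sub_pos.2 ht
  have := isProbabilityMeasure_gammaMeasure ha hrt
  have key : ∫⁻ x, ENNReal.ofReal (Real.exp (t * x)) ∂(gammaMeasure a r) =
      ENNReal.ofReal ((r / (r - t)) ^ a) := by
    have h := lintegral_mul_withDensity_eq (measurable_gammaPDF a r)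
      (measurable_gammaPDF a (r - t)) (w := fun x => ENNReal.ofReal (Real.exp (t * x)))
      (c := ENNReal.ofReal ((r / (r - t)) ^ a))
      (by fun_prop) (f := fun _ => 1) measurable_const (Filter.Eventually.of_forall fun x => ?_)
    · simp only [mul_one] at h
      rw [gammaMeasure, h, ← gammaMeasure]
      simp
    · rcases lt_or_ge x 0 with hx | hx
      · simp [gammaPDF_of_neg hx]
      · rw [gammaPDF_of_nonneg hx, gammaPDF_of_nonneg hx, ← ENNReal.ofReal_mul (by positivity),
          ← ENNReal.ofReal_mul (by positivity)]
        congr 1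
        rw [show -((r - t) * x) = -(r * x) + t * x by ring, Real.exp_add,
          Real.div_rpow hr.le hrt.le]
        field_simp
  constructor
  · refine ⟨by fun_prop, ?_⟩
    rw [hasFiniteIntegral_iff_ofReal (Filter.Eventually.of_forall fun x => (Real.exp_pos _).le),
      key]
    exact ENNReal.ofReal_lt_top
  · simp only [mgf, id]
    rw [integral_eq_lintegral_of_nonneg_ae
      (Filter.Eventually.of_forall fun x => (Real.exp_pos _).le) (by fun_prop), key,
      ENNReal.toReal_ofReal (by positivity)]

/-- A real random variable whose moment generating function is that of a gamma law. -/
lemma eq_gammaMeasure_of_mgf {ρ : Measure ℝ} [IsProbabilityMeasure ρ] {a r : ℝ} (ha : 0 < a)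
    (hr : 0 < r) (h : ∀ t, t < r → Integrable (fun x => Real.exp (t * x)) ρ ∧
      mgf id ρ t = (r / (r - t)) ^ a) : ρ = gammaMeasure a r := by
  have := isProbabilityMeasure_gammaMeasure ha hr
  refine measure_ext_of_mgf_near_zero hr (fun t ht => (h t (abs_lt.1 ht).2).1)
    (fun t ht => (integrable_exp_mul_gammaMeasure ha hr (abs_lt.1 ht).2).1) fun t ht => ?_
  rw [(h t (abs_lt.1 ht).2).2, (integrable_exp_mul_gammaMeasure ha hr (abs_lt.1 ht).2).2]

/-- The sum of independent gamma variables. -/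
lemma map_sum_pi_gammaMeasure {ι : Type*} [Fintype ι] [Nonempty ι] {a r : ℝ} (ha : 0 < a)
    (hr : 0 < r) :
    (Measure.pi fun _ : ι => gammaMeasure a r).map (fun x => ∑ i, x i) =
      gammaMeasure (Fintype.card ι * a) r := by
  have := isProbabilityMeasure_gammaMeasure ha hr
  have hm : Measurable fun x : ι → ℝ => ∑ i, x i := by fun_prop
  have := Measure.isProbabilityMeasure_map (μ := Measure.pi fun _ : ι => gammaMeasure a r)
    hm.aemeasurable
  have hcard : (0 : ℝ) < Fintype.card ι := by exact_mod_cast Fintype.card_pos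
  refine eq_gammaMeasure_of_mgf (by positivity) hr fun t ht => ?_
  obtain ⟨h1, h2⟩ := integrable_exp_mul_gammaMeasure ha hr ht
  constructor
  · rw [integrable_map_measure (by fun_prop) hm.aemeasurable]
    simp only [Function.comp_def, Finset.mul_sum, Real.exp_sum]
    exact Integrable.fintype_prod fun _ => h1
  · rw [mgf_id_map hm.aemeasurable]
    simp only [mgf, id, Finset.mul_sum, Real.exp_sum] at h2 ⊢
    rw [integral_fintype_prod_eq_pow (fun x : ℝ => Real.exp (t * x)), h2, mul_comm,
      Real.rpow_mul_natCast (by have := sub_pos.2 ht; positivity)]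

/-! ### Standard Gaussian vectors -/

section Gaussian

variable {E : Type*} [NormedAddCommGroup E] [InnerProductSpace ℝ E] [FiniteDimensional ℝ E]
  [MeasurableSpace E] [BorelSpace E]

/-- The density of the standard Gaussian law. -/
noncomputable def gaussianPDFNorm (n : ℕ) (x : ℝ) : ℝ :=
  (2 * Real.pi) ^ (-(n : ℝ) / 2) * Real.exp (-(1 / 2) * x ^ 2)

/-- Proved by comparing characteristic functions, so no choice of coordinates is needed. -/
lemma stdGaussian_eq_withDensity :
    stdGaussian E = volume.withDensity fun x : E =>
      ENNReal.ofReal (gaussianPDFNorm (Module.finrank ℝ E) ‖x‖) := by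
  have hint : Integrable (fun x : E => gaussianPDFNorm (Module.finrank ℝ E) ‖x‖) := by
    refine Integrable.const_mul (Integrable.of_integral_ne_zero ?_) _
    rw [GaussianFourier.integral_rexp_neg_mul_sq_norm (by norm_num)]
    positivity
  have hnn : ∀ x : E, 0 ≤ gaussianPDFNorm (Module.finrank ℝ E) ‖x‖ := fun x => by
    unfold gaussianPDFNorm
    positivity
  have hmeas : Measurable fun x : E => gaussianPDFNorm (Module.finrank ℝ E) ‖x‖ := by
    unfold gaussianPDFNorm
    fun_prop
  have : IsFiniteMeasure (volume.withDensity fun x : E =>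
      ENNReal.ofReal (gaussianPDFNorm (Module.finrank ℝ E) ‖x‖)) := by
    constructor
    rw [withDensity_apply _ MeasurableSet.univ, Measure.restrict_univ,
      ← ofReal_integral_eq_lintegral_ofReal hint (Filter.Eventually.of_forall hnn)]
    exact ENNReal.ofReal_lt_top
  apply Measure.ext_of_charFun
  ext t
  rw [charFun_stdGaussian, charFun_apply, integral_withDensity_eq_integral_toReal_smul
    hmeas.ennreal_ofReal (Filter.Eventually.of_forall fun _ => ENNReal.ofReal_lt_top)]
  have h := GaussianFourier.integral_cexp_neg_mul_sq_norm_add (b := (1 / 2 : ℂ)) (by norm_num)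
    Complex.I t
  have h2 : ∀ x : E, (ENNReal.ofReal (gaussianPDFNorm (Module.finrank ℝ E) ‖x‖)).toReal •
      Complex.exp (inner ℝ x t * Complex.I) = ((2 * Real.pi : ℝ) : ℂ) ^ (-(Module.finrank ℝ E : ℂ) / 2) *
        Complex.exp (-(1 / 2 : ℂ) * ‖x‖ ^ 2 + Complex.I * inner ℝ t x) := by
    intro x
    rw [ENNReal.toReal_ofReal (hnn x), gaussianPDFNorm, Complex.exp_add, Complex.real_smul,
      real_inner_comm, mul_comm Complex.I]
    push_cast
    rw [Complex.ofReal_cpow (by positivity)]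
    push_cast
    ring
  simp_rw [h2]
  rw [integral_const_mul, h, ← mul_assoc]
  have h3 : ((2 * Real.pi : ℝ) : ℂ) ^ (-(Module.finrank ℝ E : ℂ) / 2) *
      (Real.pi / (1 / 2 : ℂ)) ^ (Module.finrank ℝ E / 2 : ℂ) = 1 := by
    rw [show (Real.pi / (1 / 2 : ℂ)) = ((2 * Real.pi : ℝ) : ℂ) by push_cast; ring,
      ← Complex.cpow_add _ _ (by
        have := Real.pi_pos
        exact_mod_cast (by positivity : (2 * Real.pi : ℝ) ≠ 0))]
    simp [neg_div]
  rw [h3, one_mul]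
  congr 1
  rw [Complex.I_sq]
  ring

lemma map_norm_sq_stdGaussian [Nontrivial E] :
    (stdGaussian E).map (fun x => ‖x‖ ^ 2) =
      gammaMeasure ((Module.finrank ℝ E : ℝ) / 2) (1 / 2) := by
  have hm : Measurable fun x : E => ‖x‖ ^ 2 := by fun_prop
  have := Measure.isProbabilityMeasure_map (μ := stdGaussian E) hm.aemeasurable
  have hn : (0 : ℝ) < Module.finrank ℝ E := by exact_mod_cast Module.finrank_pos
  refine eq_gammaMeasure_of_mgf (by positivity) (by norm_num) fun t ht => ?_
  have hnn : ∀ x : E, 0 ≤ gaussianPDFNorm (Module.finrank ℝ E) ‖x‖ := fun x => by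
    unfold gaussianPDFNorm
    positivity
  have hmeas : Measurable fun x : E => gaussianPDFNorm (Module.finrank ℝ E) ‖x‖ := by
    unfold gaussianPDFNorm
    fun_prop
  have hb : 0 < 1 / 2 - t := sub_pos.2 ht
  have hpi := Real.pi_pos
  have key : ∫ x, Real.exp (t * ‖x‖ ^ 2) ∂(stdGaussian E) =
      (1 / 2 / (1 / 2 - t)) ^ ((Module.finrank ℝ E : ℝ) / 2) := by
    rw [stdGaussian_eq_withDensity, integral_withDensity_eq_integral_toReal_smul
      hmeas.ennreal_ofReal (Filter.Eventually.of_forall fun _ => ENNReal.ofReal_lt_top)]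
    have h2 : ∀ x : E, (ENNReal.ofReal (gaussianPDFNorm (Module.finrank ℝ E) ‖x‖)).toReal •
        Real.exp (t * ‖x‖ ^ 2) = (2 * Real.pi) ^ (-(Module.finrank ℝ E : ℝ) / 2) *
          Real.exp (-(1 / 2 - t) * ‖x‖ ^ 2) := by
      intro x
      rw [ENNReal.toReal_ofReal (hnn x), gaussianPDFNorm, smul_eq_mul, mul_assoc, ← Real.exp_add]
      congr 2
      ring
    simp_rw [h2]
    rw [integral_const_mul, GaussianFourier.integral_rexp_neg_mul_sq_norm hb, neg_div,
      Real.rpow_neg (by positivity), ← Real.inv_rpow (by positivity),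
      ← Real.mul_rpow (by positivity) (by positivity)]
    congr 1
    field_simp
  constructor
  · rw [integrable_map_measure (by fun_prop) hm.aemeasurable]
    refine Integrable.of_integral_ne_zero ?_
    simp only [Function.comp_def]
    rw [key]
    positivity
  · rw [mgf_id_map hm.aemeasurable, mgf, key]

/-- Independence factorises the characteristic function over the $g_i$, and the squared norms in the
exponents add up to a quadratic form in which `M` enters only through `M * Mᵀ`. -/
lemma charFun_map_linearComb {ι κ : Type*} [Fintype ι] [Fintype κ] (M : Matrix κ ι ℝ)
    (t : PiLp 2 fun _ : κ => E) :
    charFun (((Measure.pi fun _ : ι => stdGaussian E).map fun g a => ∑ i, M a i • g i).map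
      (WithLp.toLp 2)) t =
      Complex.exp (-((∑ a, ∑ b, (M * Mᵀ) a b * inner ℝ (t a) (t b) : ℝ) : ℂ) / 2) := by
  have hm : Measurable fun (g : ι → E) (a : κ) => ∑ i, M a i • g i := by fun_prop
  have hL : Measurable (WithLp.toLp 2 : (κ → E) → PiLp 2 fun _ : κ => E) :=
    (MeasurableEquiv.toLp 2 (κ → E)).measurable
  rw [Measure.map_map hL hm, charFun_apply,
    integral_map (hL.comp hm).aemeasurable (by fun_prop)]
  have h1 : ∀ g : ι → E, Complex.exp (inner ℝ
      ((WithLp.toLp 2 ∘ fun (g : ι → E) (a : κ) => ∑ i, M a i • g i) g :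
        PiLp 2 fun _ : κ => E) t * Complex.I) =
      ∏ i, Complex.exp (inner ℝ (g i) (∑ a, M a i • t a) * Complex.I) := by
    intro g
    rw [← Complex.exp_sum, ← Finset.sum_mul, ← Complex.ofReal_sum, PiLp.inner_apply]
    congr 3
    simp only [Function.comp, sum_inner, inner_sum, real_inner_smul_left, real_inner_smul_right]
    exact Finset.sum_comm
  simp_rw [h1]
  rw [integral_fintype_prod_eq_prod fun i (x : E) =>
    Complex.exp (inner ℝ x (∑ a, M a i • t a) * Complex.I)]
  simp_rw [← charFun_apply, charFun_stdGaussian]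
  rw [← Complex.exp_sum, ← Finset.sum_div, Finset.sum_neg_distrib]
  congr 3
  norm_cast
  simp only [← real_inner_self_eq_norm_sq, sum_inner, inner_sum, real_inner_smul_left,
    real_inner_smul_right, Matrix.mul_apply, Matrix.transpose_apply, Finset.sum_mul]
  rw [Finset.sum_comm]
  refine Finset.sum_congr rfl fun a _ => ?_
  rw [Finset.sum_comm]
  refine Finset.sum_congr rfl fun b _ => Finset.sum_congr rfl fun i _ => ?_
  rw [real_inner_comm]
  ring

/-- The law of a family of linear combinations of independent Gaussian vectors depends only on the
Gram matrix of the coefficients. -/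
lemma map_linearComb_eq_of_mul_transpose_eq {ι ι' κ : Type*} [Fintype ι] [Fintype ι'] [Fintype κ]
    {M : Matrix κ ι ℝ} {M' : Matrix κ ι' ℝ} (h : M * Mᵀ = M' * M'ᵀ) :
    (Measure.pi fun _ : ι => stdGaussian E).map (fun g a => ∑ i, M a i • g i) =
      (Measure.pi fun _ : ι' => stdGaussian E).map (fun g a => ∑ i, M' a i • g i) := by
  have hm : Measurable fun (g : ι → E) (a : κ) => ∑ i, M a i • g i := by fun_prop
  have hm' : Measurable fun (g : ι' → E) (a : κ) => ∑ i, M' a i • g i := by fun_prop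
  have := Measure.isProbabilityMeasure_map (μ := Measure.pi fun _ : ι => stdGaussian E)
    hm.aemeasurable
  have := Measure.isProbabilityMeasure_map (μ := Measure.pi fun _ : ι' => stdGaussian E)
    hm'.aemeasurable
  refine (MeasurableEquiv.toLp 2 (κ → E)).map_measurableEquiv_injective
    (Measure.ext_of_charFun (funext fun t => ?_))
  rw [MeasurableEquiv.coe_toLp]
  exact (charFun_map_linearComb M t).trans (h ▸ (charFun_map_linearComb M' t).symm)

end Gaussian

/-- The projection of Euclidean space that forgets the first coordinate. -/
def tailProj {m : ℕ} (x : EuclideanSpace ℝ (Fin (m + 1))) : EuclideanSpace ℝ (Fin m) :=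
  WithLp.toLp 2 fun i => x i.succ

lemma measurable_tailProj {m : ℕ} : Measurable (tailProj (m := m)) := by
  unfold tailProj
  fun_prop

lemma map_tailProj_stdGaussian (m : ℕ) :
    (stdGaussian (EuclideanSpace ℝ (Fin (m + 1)))).map tailProj =
      stdGaussian (EuclideanSpace ℝ (Fin m)) := by
  have := Measure.isProbabilityMeasure_map
    (μ := stdGaussian (EuclideanSpace ℝ (Fin (m + 1)))) measurable_tailProj.aemeasurable
  apply Measure.ext_of_charFun
  ext t
  let t' : EuclideanSpace ℝ (Fin (m + 1)) := WithLp.toLp 2 (Fin.cons 0 t)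
  have h1 : ∀ x : EuclideanSpace ℝ (Fin (m + 1)), inner ℝ (tailProj x) t = inner ℝ x t' := by
    intro x
    simp [tailProj, t', PiLp.inner_apply, Fin.sum_univ_succ]
  have h2 : ‖t'‖ ^ 2 = ‖t‖ ^ 2 := by
    simp [EuclideanSpace.real_norm_sq_eq, t', Fin.sum_univ_succ]
  rw [charFun_stdGaussian, charFun_apply, integral_map measurable_tailProj.aemeasurable
    (by fun_prop)]
  simp_rw [h1]
  rw [← charFun_apply, charFun_stdGaussian]
  norm_cast
  rw [h2]

/-! ### Gram determinants of Gaussian vectors -/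

lemma continuous_det_gram {E ι : Type*} [NormedAddCommGroup E] [InnerProductSpace ℝ E] [Fintype ι]
    [DecidableEq ι] : Continuous fun g : ι → E => (Matrix.gram ℝ g).det := by
  refine Continuous.matrix_det (continuous_matrix fun i j => ?_)
  simp only [Matrix.gram_apply]
  fun_prop

/-- Schur complement of the $1\times1$ block $a^2$: the correction term is the product of the zeroth
coordinates, so what remains is the Gram matrix of the vectors projected orthogonally to the first
one. -/
lemma det_gram_cons_single {m s : ℕ} {a : ℝ} (ha : a ≠ 0)
    (h : Fin s → EuclideanSpace ℝ (Fin (m + 1))) :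
    (Matrix.gram ℝ (Fin.cons (EuclideanSpace.single 0 a) h :
      Fin (s + 1) → EuclideanSpace ℝ (Fin (m + 1)))).det =
      a ^ 2 * (Matrix.gram ℝ fun i => tailProj (h i)).det := by
  let e : Unit ⊕ Fin s ≃ Fin (s + 1) :=
    (Equiv.sumComm _ _).trans ((Equiv.optionEquivSumPUnit _).symm.trans (finSuccEquiv s).symm)
  let A : Matrix Unit Unit ℝ := Matrix.of fun _ _ => a ^ 2
  let B : Matrix Unit (Fin s) ℝ := Matrix.of fun _ j => a * h j 0
  let C : Matrix (Fin s) Unit ℝ := Matrix.of fun i _ => a * h i 0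
  have hA : A.det = a ^ 2 := by simp [A]
  have hinv : A⁻¹ = Matrix.of fun _ _ => (a ^ 2)⁻¹ := by
    apply Matrix.inv_eq_right_inv
    ext
    simp [A, Matrix.mul_apply, ha]
  have : Invertible A := Matrix.invertibleOfIsUnitDet _ (by rw [hA]; simpa using ha)
  have hblock : (Matrix.gram ℝ (Fin.cons (EuclideanSpace.single 0 a) h :
      Fin (s + 1) → EuclideanSpace ℝ (Fin (m + 1)))).submatrix e e =
      Matrix.fromBlocks A B C (Matrix.gram ℝ h) := by
    ext i j
    rcases i with i | i <;> rcases j with j | j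
    · simp [e, A, Matrix.gram_apply, sq]
    · simp [e, B, Matrix.gram_apply, EuclideanSpace.inner_single_left]
    · simp [e, C, Matrix.gram_apply, EuclideanSpace.inner_single_right]
    · simp [e, Matrix.gram_apply]
  rw [← Matrix.det_submatrix_equiv_self e, hblock, Matrix.det_fromBlocks₁₁, hA,
    Matrix.invOf_eq_nonsing_inv, hinv]
  congr 2
  ext i j
  simp only [Matrix.sub_apply, Matrix.gram_apply, Matrix.mul_apply, PiLp.inner_apply, tailProj,
    Fin.sum_univ_succ, B, C]
  simp
  field_simp
  ring

/-- A reflection carries $v$ to $\|v\|e_0$. It preserves Gram matrices and the Gaussian law, and the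
projected vectors are standard Gaussian one dimension lower. -/
lemma map_det_gram_cons {m s : ℕ} {v : EuclideanSpace ℝ (Fin (m + 1))} (hv : v ≠ 0) :
    (Measure.pi fun _ : Fin s => stdGaussian (EuclideanSpace ℝ (Fin (m + 1)))).map
      (fun h => (Matrix.gram ℝ (Fin.cons v h : Fin (s + 1) → _)).det) =
    (Measure.pi fun _ : Fin s => stdGaussian (EuclideanSpace ℝ (Fin m))).map
      (fun h => ‖v‖ ^ 2 * (Matrix.gram ℝ h).det) := by
  let w : EuclideanSpace ℝ (Fin (m + 1)) := EuclideanSpace.single 0 ‖v‖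
  have hw : ‖v‖ = ‖w‖ := by simp [w]
  let U := (Submodule.reflection (Submodule.span ℝ {v - w})ᗮ)
  have hU : U v = w := Submodule.reflection_sub hw
  have hmU : Measurable fun (h : Fin s → EuclideanSpace ℝ (Fin (m + 1))) i => U (h i) := by
    fun_prop
  have hmT : Measurable fun (h : Fin s → EuclideanSpace ℝ (Fin (m + 1))) i => tailProj (h i) :=
    measurable_pi_lambda _ fun i => measurable_tailProj.comp (measurable_pi_apply i)
  have h1 : (Measure.pi fun _ : Fin s => stdGaussian (EuclideanSpace ℝ (Fin (m + 1)))).map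
      (fun h i => tailProj (U (h i))) =
      Measure.pi fun _ : Fin s => stdGaussian (EuclideanSpace ℝ (Fin m)) := by
    have hm : Measurable fun x => tailProj (U x) := measurable_tailProj.comp (by fun_prop)
    rw [Measure.pi_map_pi fun _ => hm.aemeasurable]
    congr 1
    ext1 i
    rw [← map_tailProj_stdGaussian m]
    conv_rhs => rw [← stdGaussian_map U, Measure.map_map measurable_tailProj (by fun_prop)]
    rfl
  have hmd : Measurable fun h : Fin s → EuclideanSpace ℝ (Fin m) =>
      ‖v‖ ^ 2 * (Matrix.gram ℝ h).det := (continuous_det_gram.measurable).const_mul _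
  rw [← h1, Measure.map_map hmd (show Measurable fun (h : Fin s → EuclideanSpace ℝ (Fin (m + 1)))
    i => tailProj (U (h i)) from hmT.comp hmU)]
  congr 1
  ext1 h
  have h2 : (Matrix.gram ℝ (Fin.cons v h : Fin (s + 1) → _)) =
      Matrix.gram ℝ (Fin.cons w fun i => U (h i) : Fin (s + 1) → _) := by
    have : (Fin.cons w fun i => U (h i) : Fin (s + 1) → _) =
        fun i => U ((Fin.cons v h : Fin (s + 1) → _) i) := by
      ext1 i
      refine Fin.cases ?_ (fun j => ?_) i
      · simp [hU]
      · simp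
    rw [this]
    ext i j
    simp [Matrix.gram_apply]
  rw [h2, det_gram_cons_single (norm_ne_zero_iff.2 hv)]
  rfl

lemma isProbabilityMeasure_chiSquareLaw {d : ℕ} (hd : 0 < d) :
    IsProbabilityMeasure (chiSquareLaw d) :=
  isProbabilityMeasure_gammaMeasure (by positivity) (by norm_num)

lemma sigmaFinite_chiSquareLaw (d : ℕ) : SigmaFinite (chiSquareLaw d) := by
  unfold chiSquareLaw gammaMeasure gammaPDF
  infer_instance

lemma map_norm_sq_gaussian {n : ℕ} (hn : 0 < n) :
    (stdGaussian (EuclideanSpace ℝ (Fin n))).map (fun x => ‖x‖ ^ 2) = chiSquareLaw n := by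
  have : Nonempty (Fin n) := ⟨⟨0, hn⟩⟩
  rw [map_norm_sq_stdGaussian, finrank_euclideanSpace_fin, chiSquareLaw]

lemma ae_ne_zero_stdGaussian {n : ℕ} (hn : 0 < n) :
    ∀ᵐ x ∂(stdGaussian (EuclideanSpace ℝ (Fin n))), x ≠ 0 := by
  have h := ae_pos_gammaMeasure ((n : ℝ) / 2) (1 / 2)
  rw [← chiSquareLaw, ← map_norm_sq_gaussian hn] at h
  filter_upwards [ae_of_ae_map (by fun_prop) h] with x hx h0
  simp [h0] at hx

lemma lintegral_pi_insertNth {n : ℕ} {α : Type*} [MeasurableSpace α] (μ : Fin (n + 1) → Measure α)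
    [∀ i, SigmaFinite (μ i)] (i : Fin (n + 1)) {F : (Fin (n + 1) → α) → ℝ≥0∞}
    (hF : Measurable F) :
    ∫⁻ x, F x ∂(Measure.pi μ) =
      ∫⁻ a, ∫⁻ y, F (i.insertNth a y) ∂(Measure.pi fun j => μ (i.succAbove j)) ∂(μ i) := by
  have e := (measurePreserving_piFinSuccAbove μ i).symm
  rw [← e.lintegral_comp hF, lintegral_prod _ (by
    exact (hF.comp (MeasurableEquiv.measurable _)).aemeasurable)]
  rfl

/-- The law of the Gram determinant of independent Gaussian vectors. -/
theorem map_det_gram_gaussian {n r : ℕ} (hrn : r ≤ n) :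
    (Measure.pi fun _ : Fin r => stdGaussian (EuclideanSpace ℝ (Fin n))).map
      (fun g => (Matrix.gram ℝ g).det) =
    (Measure.pi fun j : Fin r => chiSquareLaw (n - r + (j + 1))).map (fun q => ∏ j, q j) := by
  induction r generalizing n with
  | zero =>
    have h1 : (fun g : Fin 0 → EuclideanSpace ℝ (Fin n) => (Matrix.gram ℝ g).det) = fun _ => 1 := by
      ext g
      simp
    rw [h1]
    simp [Measure.map_const]
  | succ r ih =>
    obtain ⟨m, rfl⟩ : ∃ m, n = m + 1 := ⟨n - 1, by omega⟩
    have hrm : r ≤ m := by omega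
    have hsf : ∀ k, SigmaFinite (chiSquareLaw k) := sigmaFinite_chiSquareLaw
    have hmd (s k : ℕ) : Measurable fun g : Fin s → EuclideanSpace ℝ (Fin k) =>
      (Matrix.gram ℝ g).det := continuous_det_gram.measurable
    have hmp (s : ℕ) : Measurable fun q : Fin s → ℝ => ∏ j, q j := by
      fun_prop
    refine Measure.ext_of_lintegral _ fun f hf => ?_
    rw [lintegral_map hf (hmd _ _), lintegral_map hf (hmp _)]
    have hsg : SigmaFinite (stdGaussian (EuclideanSpace ℝ (Fin (m + 1)))) := inferInstance
    -- The first Gaussian vector is paired with the last chi-square factor: $\|v\|^2$ has $n$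
    -- degrees of freedom, which is the value of $n-r+(j+1)$ at the last index. The remaining
    -- factors keep their degrees because $n-r$ is unchanged when both drop by one.
    rw [lintegral_pi_insertNth _ 0
        (F := fun g : Fin (r + 1) → EuclideanSpace ℝ (Fin (m + 1)) => f (Matrix.gram ℝ g).det)
        (hf.comp (hmd _ _)),
      lintegral_pi_insertNth _ (Fin.last r) (F := fun q => f (∏ j, q j)) (hf.comp (hmp _))]
    have h2 : ∀ x : ℝ, ∫⁻ q, f (∏ j, (Fin.last r).insertNth (α := fun _ => ℝ) x q j)
        ∂(Measure.pi fun j : Fin r => chiSquareLaw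
          (m + 1 - (r + 1) + (((Fin.last r).succAbove j : Fin (r + 1)) + 1))) =
        ∫⁻ y, f (x * y) ∂((Measure.pi fun _ : Fin r => stdGaussian
          (EuclideanSpace ℝ (Fin m))).map fun g => (Matrix.gram ℝ g).det) := by
      intro x
      rw [ih hrm, lintegral_map (by fun_prop) (hmp _)]
      have : (fun j : Fin r => chiSquareLaw
          (m + 1 - (r + 1) + (((Fin.last r).succAbove j : Fin (r + 1)) + 1))) =
          fun j : Fin r => chiSquareLaw (m - r + (j + 1)) := by
        ext1 j
        congr 1
        simp
      rw [this]
      refine lintegral_congr fun q => ?_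
      rw [Fin.prod_univ_castSucc, mul_comm]
      simp [Fin.insertNth_last']
    simp only [h2]
    have hlast : m + 1 - (r + 1) + ((Fin.last r : Fin (r + 1)) + 1) = m + 1 := by
      simp
      omega
    rw [hlast, ← map_norm_sq_gaussian (Nat.succ_pos m), lintegral_map (by fun_prop) (by fun_prop)]
    apply lintegral_congr_ae
    filter_upwards [ae_ne_zero_stdGaussian (Nat.succ_pos m)] with v hv
    rw [lintegral_map (by fun_prop) (hmd _ _)]
    have h3 := map_det_gram_cons (s := r) hv
    have hmc : Measurable fun h : Fin r → EuclideanSpace ℝ (Fin (m + 1)) =>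
        (Matrix.gram ℝ (Fin.cons v h : Fin (r + 1) → _)).det := by
      refine (hmd _ _).comp (measurable_pi_lambda _ fun i => ?_)
      refine Fin.cases ?_ (fun j => ?_) i
      · exact measurable_const
      · exact measurable_pi_apply j
    have h4 := congrArg (fun ρ : Measure ℝ => ∫⁻ x, f x ∂ρ) h3
    simp only at h4
    rw [lintegral_map hf hmc, lintegral_map hf ((hmd _ _).const_mul _)] at h4
    rw [← h4]
    refine lintegral_congr fun h => ?_
    congr 4
    exact Fin.insertNth_zero' v h

/-! ### Gaussian simplices with rescaled vertices -/

/-- The coefficients of the edges of a simplex with rescaled vertices. -/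
def edgeMatrix {r : ℕ} (c : Fin (r + 1) → ℝ) : Matrix (Fin r) (Fin (r + 1)) ℝ :=
  Matrix.of fun a => Fin.cons (-c 0) (Pi.single a (c a.succ))

lemma sum_edgeMatrix_smul {r n : ℕ} (c : Fin (r + 1) → ℝ)
    (g : Fin (r + 1) → EuclideanSpace ℝ (Fin n)) (a : Fin r) :
    ∑ i, edgeMatrix c a i • g i = c a.succ • g a.succ - c 0 • g 0 := by
  simp only [edgeMatrix, Matrix.of_apply, Fin.sum_univ_succ, Fin.cons_zero, Fin.cons_succ]
  rw [Finset.sum_eq_single a]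
  · simp [sub_eq_neg_add]
  · intro b _ hb
    simp [hb]
  · simp

lemma edgeMatrix_mul_transpose {r : ℕ} (c : Fin (r + 1) → ℝ) :
    edgeMatrix c * (edgeMatrix c)ᵀ =
      Matrix.diagonal (fun a : Fin r => c a.succ ^ 2) + Matrix.of fun _ _ => c 0 ^ 2 := by
  ext a b
  simp only [edgeMatrix, Matrix.mul_apply, Matrix.transpose_apply, Matrix.of_apply,
    Fin.sum_univ_succ, Fin.cons_zero, Fin.cons_succ, Matrix.add_apply]
  rw [Finset.sum_eq_single a]
  · by_cases h : a = b
    · subst h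
      simp
      ring
    · simp [h]
      ring
  · intro i _ hi
    simp [hi]
  · simp

/-- The matrix is a diagonal one plus a rank-one term coming from the common vertex, so the matrix
determinant lemma applies once the diagonal is factored out. -/
lemma det_edgeMatrix_mul_transpose {r : ℕ} {c : Fin (r + 1) → ℝ} (hc : ∀ i, c i ≠ 0) :
    (edgeMatrix c * (edgeMatrix c)ᵀ).det = (∏ i, c i ^ 2) * ∑ i, (c i ^ 2)⁻¹ := by
  have h1 : edgeMatrix c * (edgeMatrix c)ᵀ = Matrix.diagonal (fun a : Fin r => c a.succ ^ 2) *
      (1 + Matrix.replicateCol Unit (fun a : Fin r => c 0 ^ 2 * (c a.succ ^ 2)⁻¹) *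
        Matrix.replicateRow Unit (fun _ : Fin r => (1 : ℝ))) := by
    rw [edgeMatrix_mul_transpose, Matrix.mul_add, Matrix.mul_one]
    congr 1
    ext a b
    have := hc a.succ
    rw [Matrix.diagonal_mul]
    simp [Matrix.mul_apply]
    field_simp
  have h0 := hc 0
  rw [h1, Matrix.det_mul, Matrix.det_diagonal, Matrix.det_one_add_replicateCol_mul_replicateRow,
    Fin.prod_univ_succ, Fin.sum_univ_succ]
  simp only [dotProduct, one_mul, ← Finset.mul_sum]
  field_simp

lemma gram_linearComb {n : ℕ} {ι κ : Type*} [Fintype ι]  (L : Matrix κ ι ℝ)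
    (g : ι → EuclideanSpace ℝ (Fin n)) :
    Matrix.gram ℝ (fun a => ∑ i, L a i • g i) = L * Matrix.gram ℝ g * Lᵀ := by
  ext a b
  simp only [Matrix.gram_apply, Matrix.mul_apply, Matrix.transpose_apply, sum_inner, inner_sum,
    real_inner_smul_left, real_inner_smul_right, Finset.sum_mul]
  refine Finset.sum_congr rfl fun i _ => Finset.sum_congr rfl fun j _ => ?_
  rw [real_inner_comm]
  ring

lemma continuous_edgeGramDet {n r : ℕ} : Continuous (edgeGramDet (n := n) (r := r)) :=
  continuous_det_gram.comp (by fun_prop)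

open scoped MatrixOrder Matrix.Norms.L2Operator in
/-- The law of the squared volume of a simplex with rescaled Gaussian vertices. -/
theorem map_edgeGramDet_smul_gaussian {n r : ℕ} {c : Fin (r + 1) → ℝ} (hc : ∀ i, c i ≠ 0) :
    (Measure.pi fun _ : Fin (r + 1) => stdGaussian (EuclideanSpace ℝ (Fin n))).map
      (fun g => edgeGramDet fun i => c i • g i) =
    (Measure.pi fun _ : Fin r => stdGaussian (EuclideanSpace ℝ (Fin n))).map
      (fun g => ((∏ i, c i ^ 2) * ∑ i, (c i ^ 2)⁻¹) * (Matrix.gram ℝ g).det) := by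
  have hpsd : (edgeMatrix c * (edgeMatrix c)ᵀ).PosSemidef := by
    simpa using Matrix.posSemidef_self_mul_conjTranspose (edgeMatrix c)
  -- A square factor of the coefficient Gram matrix: the $r$ edges have the same joint law as $r$
  -- combinations of only $r$ Gaussian vectors, so multiplicativity of the determinant becomes
  -- available.
  obtain ⟨B, hB⟩ := CStarAlgebra.nonneg_iff_eq_star_mul_self.1 hpsd.nonneg
  have hB' : edgeMatrix c * (edgeMatrix c)ᵀ = Bᵀ * Bᵀᵀ := by
    rw [hB, Matrix.star_eq_conjTranspose]
    simp
  have h := map_linearComb_eq_of_mul_transpose_eq (E := EuclideanSpace ℝ (Fin n)) hB'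
  have hmd : Measurable fun g : Fin r → EuclideanSpace ℝ (Fin n) => (Matrix.gram ℝ g).det :=
    continuous_det_gram.measurable
  have hm1 : Measurable fun (g : Fin (r + 1) → EuclideanSpace ℝ (Fin n)) a =>
    ∑ i, edgeMatrix c a i • g i := by fun_prop
  have hm2 : Measurable fun (g : Fin r → EuclideanSpace ℝ (Fin n)) a => ∑ i, Bᵀ a i • g i := by
    fun_prop
  have h2 := congrArg (Measure.map fun g => (Matrix.gram ℝ g).det) h
  rw [Measure.map_map hmd hm1, Measure.map_map hmd hm2] at h2
  convert h2 using 2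
  · ext g
    simp only [Function.comp, sum_edgeMatrix_smul]
    rfl
  · ext g
    simp only [Function.comp]
    rw [gram_linearComb, ← det_edgeMatrix_mul_transpose hc, hB', Matrix.det_mul, Matrix.det_mul,
      Matrix.det_mul]
    ring

/-- The law of the squared volume of a simplex with rescaled Gaussian vertices in terms of
chi-square laws. -/
theorem map_edgeGramDet_smul_gaussian_eq_chiSquare {n r : ℕ} (hrn : r ≤ n) {c : Fin (r + 1) → ℝ}
    (hc : ∀ i, c i ≠ 0) :
    (Measure.pi fun _ : Fin (r + 1) => stdGaussian (EuclideanSpace ℝ (Fin n))).map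
      (fun g => edgeGramDet fun i => c i • g i) =
    (Measure.pi fun j : Fin r => chiSquareLaw (n - r + (j + 1))).map
      (fun q => ((∏ i, c i ^ 2) * ∑ i, (c i ^ 2)⁻¹) * ∏ j, q j) := by
  have hmd : Measurable fun g : Fin r → EuclideanSpace ℝ (Fin n) => (Matrix.gram ℝ g).det :=
    continuous_det_gram.measurable
  have h := congrArg (Measure.map fun x => ((∏ i, c i ^ 2) * ∑ i, (c i ^ 2)⁻¹) * x)
    (map_det_gram_gaussian hrn)
  rw [Measure.map_map (by fun_prop) hmd, Measure.map_map (by fun_prop) (by fun_prop)] at h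
  rw [map_edgeGramDet_smul_gaussian hc]
  exact h

/-- The squared volume of a Gaussian simplex. -/
theorem identDistrib_gaussian {Ω Ω' : Type*} [MeasurableSpace Ω] {μ : Measure Ω}
    [MeasurableSpace Ω'] {μ' : Measure Ω'} [IsProbabilityMeasure μ] [IsProbabilityMeasure μ']
    {n r : ℕ} (hrn : r ≤ n) {X : Fin (r + 1) → Ω → EuclideanSpace ℝ (Fin n)} (hX : iIndepFun X μ)
    (hlaw : ∀ i, HasLaw (X i) (gaussianModel n) μ) {Q : Fin r → Ω' → ℝ} (hQ : iIndepFun Q μ')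
    (hQlaw : ∀ j : Fin r, HasLaw (Q j) (chiSquareLaw (n - r + (j + 1))) μ') :
    IdentDistrib (fun ω => edgeGramDet fun i => X i ω)
      (fun ω' => ((r : ℝ) + 1) * ∏ j, Q j ω') μ μ' := by
  have hX' := hX.hasLaw_pi hlaw
  have hQ' := hQ.hasLaw_pi hQlaw
  have h := map_edgeGramDet_smul_gaussian_eq_chiSquare hrn (c := fun _ : Fin (r + 1) => (1 : ℝ))
    (fun _ => one_ne_zero)
  simp only [one_smul] at h
  have h1 : HasLaw (fun ω => edgeGramDet fun i => X i ω) _ μ :=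
    HasLaw.fun_comp (Y := edgeGramDet)
      ⟨continuous_edgeGramDet.aemeasurable, rfl⟩ hX'
  refine h1.identDistrib ?_
  refine HasLaw.fun_comp (Y := fun q : Fin r → ℝ => ((r : ℝ) + 1) * ∏ j, q j) ⟨by fun_prop, ?_⟩ hQ'
  rw [gaussianModel, show edgeGramDet = fun g : Fin (r + 1) → EuclideanSpace ℝ (Fin n) =>
    edgeGramDet fun i => g i from rfl, h]
  simp

/-! ### Integrals over product measures -/

lemma lintegral_pi_prod {m : ℕ} {α : Type*} [MeasurableSpace α] (μ : Fin m → Measure α)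
    [∀ i, SigmaFinite (μ i)] {f : Fin m → α → ℝ≥0∞} (hf : ∀ i, Measurable (f i)) :
    ∫⁻ x, ∏ i, f i (x i) ∂(Measure.pi μ) = ∏ i, ∫⁻ x, f i x ∂(μ i) := by
  induction m with
  | zero => simp
  | succ m ih =>
    rw [lintegral_pi_insertNth μ 0 (F := fun x => ∏ i, f i (x i)) (Finset.measurable_fun_prod _ fun i _ =>
      (hf i).comp (measurable_pi_apply i)), Fin.prod_univ_succ]
    simp only [Fin.prod_univ_succ, Fin.insertNth_zero', Fin.cons_zero, Fin.cons_succ,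
      Fin.succAbove_zero]
    have h : ∀ a, ∫⁻ y : Fin m → α, f 0 a * ∏ i : Fin m, f i.succ (y i)
        ∂(Measure.pi fun j : Fin m => μ j.succ) =
        f 0 a * ∏ i : Fin m, ∫⁻ x, f i.succ x ∂(μ i.succ) := by
      intro a
      have hm : Measurable fun y : Fin m → α => ∏ i : Fin m, f i.succ (y i) :=
        Finset.measurable_fun_prod _ fun i _ => (hf _).comp (measurable_pi_apply i)
      rw [lintegral_const_mul _ hm, ih (fun i => μ i.succ) fun i => hf i.succ]
    simp_rw [h]
    rw [lintegral_mul_const _ (hf 0)]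

/-- A change of density in one coordinate, applied to every coordinate of a product measure; `F` may
couple the coordinates. -/
lemma lintegral_pi_tilt {m : ℕ} {α : Type*} [MeasurableSpace α] {μ ν : Measure α}
    [SigmaFinite μ] [SigmaFinite ν] {w : α → ℝ≥0∞} (hw : Measurable w) {c : ℝ≥0∞}
    (h : ∀ f : α → ℝ≥0∞, Measurable f → ∫⁻ x, w x * f x ∂μ = c * ∫⁻ x, f x ∂ν)
    {F : (Fin m → α) → ℝ≥0∞} (hF : Measurable F) :
    ∫⁻ x, (∏ i, w (x i)) * F x ∂(Measure.pi fun _ : Fin m => μ) =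
      c ^ m * ∫⁻ x, F x ∂(Measure.pi fun _ : Fin m => ν) := by
  induction m with
  | zero =>
    have h0 : (fun _ : Fin 0 => μ) = fun _ => ν := funext fun i => i.elim0
    simp [h0]
  | succ m ih =>
    have hins : Measurable fun p : α × (Fin m → α) =>
        F ((0 : Fin (m + 1)).insertNth (α := fun _ => α) p.1 p.2) :=
      hF.comp (MeasurableEquiv.piFinSuccAbove (fun _ : Fin (m + 1) => α) 0).symm.measurable
    rw [lintegral_pi_insertNth _ 0 (F := fun x => (∏ i, w (x i)) * F x)
      (((Finset.measurable_fun_prod _ fun i _ => hw.comp (measurable_pi_apply i))).mul hF), lintegral_pi_insertNth _ 0 hF]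
    simp only [Fin.prod_univ_succ, Fin.insertNth_zero', Fin.cons_zero, Fin.cons_succ, mul_assoc]
      at hins ⊢
    have h2 : ∀ a, ∫⁻ y : Fin m → α, w a * ((∏ i : Fin m, w (y i)) *
        F (Fin.cons a y : Fin (m + 1) → α)) ∂(Measure.pi fun _ : Fin m => μ) =
        w a * (c ^ m * ∫⁻ y : Fin m → α, F (Fin.cons a y : Fin (m + 1) → α)
          ∂(Measure.pi fun _ : Fin m => ν)) := by
      intro a
      have hFa : Measurable fun y : Fin m → α => F (Fin.cons a y : Fin (m + 1) → α) :=
        hins.comp measurable_prodMk_left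
      have hm : Measurable fun y : Fin m → α =>
          (∏ i : Fin m, w (y i)) * F (Fin.cons a y : Fin (m + 1) → α) :=
        (Finset.measurable_fun_prod _ fun i _ => hw.comp (measurable_pi_apply i)).mul hFa
      rw [lintegral_const_mul _ hm, ih hFa]
    simp_rw [h2]
    have hI : Measurable fun a => ∫⁻ y : Fin m → α, F (Fin.cons a y : Fin (m + 1) → α)
        ∂(Measure.pi fun _ : Fin m => ν) := hins.lintegral_prod_right'
    rw [h _ (hI.const_mul _), lintegral_const_mul _ hI, ← mul_assoc, pow_succ']

/-! ### The beta prime model as a scale mixture of Gaussian laws -/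

lemma lintegral_stdGaussian_smul {n : ℕ} {c : ℝ} (hc : 0 < c)
    {f : EuclideanSpace ℝ (Fin n) → ℝ≥0∞} (hf : Measurable f) :
    ∫⁻ g, f (c⁻¹ • g) ∂(stdGaussian (EuclideanSpace ℝ (Fin n))) =
      ∫⁻ x, ENNReal.ofReal (c ^ n * gaussianPDFNorm n (c * ‖x‖)) * f x := by
  have hm : Measurable fun x : EuclideanSpace ℝ (Fin n) => ENNReal.ofReal (gaussianPDFNorm n ‖x‖) := by
    unfold gaussianPDFNorm
    fun_prop
  have hm2 : Measurable fun x : EuclideanSpace ℝ (Fin n) =>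
      ENNReal.ofReal (gaussianPDFNorm n (c * ‖x‖)) * f x := by
    unfold gaussianPDFNorm
    fun_prop
  rw [stdGaussian_eq_withDensity, finrank_euclideanSpace_fin,
    lintegral_withDensity_eq_lintegral_mul _ hm (by fun_prop)]
  have h := Measure.map_addHaar_smul (volume : Measure (EuclideanSpace ℝ (Fin n)))
    (inv_ne_zero hc.ne')
  have h2 := congrArg (fun ρ => ∫⁻ x, ENNReal.ofReal (gaussianPDFNorm n (c * ‖x‖)) * f x ∂ρ) h
  simp only [lintegral_smul_measure, finrank_euclideanSpace_fin] at h2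
  rw [lintegral_map hm2 (by fun_prop)] at h2
  have h3 : ∀ x : EuclideanSpace ℝ (Fin n), c * ‖c⁻¹ • x‖ = ‖x‖ := fun x => by
    rw [norm_smul, Real.norm_of_nonneg (by positivity)]
    field_simp
  simp only [h3] at h2
  simp only [Pi.mul_apply]
  rw [h2, smul_eq_mul, ← lintegral_const_mul _ hm2]
  refine lintegral_congr fun x => ?_
  rw [← mul_assoc, ← ENNReal.ofReal_mul (by positivity)]
  congr 3
  rw [inv_pow, inv_inv, abs_of_pos (by positivity)]

/-- The density of $g/\sqrt t$ at $x$, integrated against the gamma law of $t$, is a gamma integral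
with rate $(1+\|x\|^2)/2$ and shape $(n+\nu)/2$; this produces the power of $1+\|x\|^2$. -/
lemma lintegral_betaPrimeModel {n : ℕ} {ν : ℝ} (hν : 0 < ν)
    {f : EuclideanSpace ℝ (Fin n) → ℝ≥0∞} (hf : Measurable f) :
    ∫⁻ x, f x ∂(betaPrimeModel n ν) =
      ∫⁻ t, ∫⁻ g, f ((√t)⁻¹ • g) ∂(stdGaussian (EuclideanSpace ℝ (Fin n)))
        ∂(gammaMeasure (ν / 2) (1 / 2)) := by
  have hA := Real.Gamma_pos_of_pos (half_pos hν)
  have hAn := Real.Gamma_pos_of_pos (show 0 < ((n : ℝ) + ν) / 2 by positivity)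
  have hpi := Real.pi_pos
  have hmG : Measurable fun p : ℝ × EuclideanSpace ℝ (Fin n) =>
      ENNReal.ofReal (√p.1 ^ n * gaussianPDFNorm n (√p.1 * ‖p.2‖)) * f p.2 := by
    unfold gaussianPDFNorm
    fun_prop
  have h1 : ∫⁻ t, ∫⁻ g, f ((√t)⁻¹ • g) ∂(stdGaussian (EuclideanSpace ℝ (Fin n)))
        ∂(gammaMeasure (ν / 2) (1 / 2)) =
      ∫⁻ t, ∫⁻ x : EuclideanSpace ℝ (Fin n),
        ENNReal.ofReal (√t ^ n * gaussianPDFNorm n (√t * ‖x‖)) * f x ∂volume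
        ∂(gammaMeasure (ν / 2) (1 / 2)) := by
    apply lintegral_congr_ae
    filter_upwards [ae_pos_gammaMeasure (ν / 2) (1 / 2)] with t ht
    exact lintegral_stdGaussian_smul (Real.sqrt_pos.2 ht) hf
  have := isProbabilityMeasure_gammaMeasure (half_pos hν) (by norm_num : (0 : ℝ) < 1 / 2)
  rw [h1, lintegral_lintegral_swap hmG.aemeasurable, betaPrimeModel,
    lintegral_withDensity_eq_lintegral_mul _ (by fun_prop) hf]
  refine lintegral_congr fun x => ?_
  have hx : 0 < 1 + ‖x‖ ^ 2 := by positivity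
  have hm3 : Measurable fun t : ℝ => ENNReal.ofReal (√t ^ n * gaussianPDFNorm n (√t * ‖x‖)) := by
    unfold gaussianPDFNorm
    fun_prop
  rw [lintegral_mul_const _ hm3, Pi.mul_apply]
  congr 1
  rw [gammaMeasure, lintegral_withDensity_eq_lintegral_mul _ (measurable_gammaPDF _ _) hm3,
    ← setLIntegral_eq_of_support_subset (s := Set.Ici (0 : ℝ)) (by
      intro t ht
      by_contra h2
      simp only [Set.mem_Ici, not_le] at h2
      simp [gammaPDF_of_neg h2] at ht),
    ← setLIntegral_congr (Ioi_ae_eq_Ici (a := (0 : ℝ)) (μ := volume))]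
  have h4 : ∀ t ∈ Set.Ioi (0 : ℝ), (gammaPDF (ν / 2) (1 / 2) *
      fun t : ℝ => ENNReal.ofReal (√t ^ n * gaussianPDFNorm n (√t * ‖x‖))) t =
      ENNReal.ofReal ((1 / 2) ^ (ν / 2) / Real.Gamma (ν / 2) * (2 * Real.pi) ^ (-(n : ℝ) / 2)) *
        ENNReal.ofReal (t ^ (((n : ℝ) + ν) / 2 - 1) * Real.exp (-((1 + ‖x‖ ^ 2) / 2 * t))) := by
    intro t ht
    have ht0 : (0 : ℝ) < t := ht
    rw [Pi.mul_apply, gammaPDF_of_nonneg ht0.le, ← ENNReal.ofReal_mul (by positivity),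
      ← ENNReal.ofReal_mul (by positivity)]
    congr 1
    rw [gaussianPDFNorm, mul_pow, Real.sq_sqrt ht0.le,
      show -((1 + ‖x‖ ^ 2) / 2 * t) = -(1 / 2 * t) + -(1 / 2) * (t * ‖x‖ ^ 2) by ring,
      Real.exp_add, show ((n : ℝ) + ν) / 2 - 1 = (ν / 2 - 1) + n / 2 by ring, Real.rpow_add ht0,
      Real.sqrt_eq_rpow, ← Real.rpow_mul_natCast ht0.le, show (1 / 2 : ℝ) * n = n / 2 by ring]
    ring
  rw [setLIntegral_congr_fun measurableSet_Ioi h4, lintegral_const_mul _ (by fun_prop),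
    lintegral_rpow_mul_exp_neg (by positivity) (by positivity),
    ← ENNReal.ofReal_mul (by positivity)]
  congr 1
  rw [show -((n : ℝ) + ν) / 2 = -(((n : ℝ) + ν) / 2) by ring, Real.div_rpow hx.le (by norm_num),
    Real.mul_rpow (by norm_num) hpi.le, one_div (2 : ℝ), Real.inv_rpow (by norm_num),
    show -(n : ℝ) / 2 = -((n : ℝ) / 2) by ring, Real.rpow_neg (by norm_num : (0 : ℝ) ≤ 2),
    Real.rpow_neg (by norm_num : (0 : ℝ) ≤ 2), Real.rpow_neg hpi.le,
    show ((n : ℝ) + ν) / 2 = n / 2 + ν / 2 by ring, Real.rpow_add (by norm_num : (0 : ℝ) < 2)]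
  field_simp

/-! ### Beta prime simplices -/

lemma ae_pi_forall {m : ℕ} {α : Type*} [MeasurableSpace α] {μ : Fin m → Measure α}
    [∀ i, SigmaFinite (μ i)] {p : Fin m → α → Prop} (h : ∀ i, ∀ᵐ x ∂(μ i), p i x) :
    ∀ᵐ x ∂(Measure.pi μ), ∀ i, p i (x i) :=
  ae_all_iff.2 fun i => Measure.tendsto_eval_ae_ae.eventually (h i)

lemma betaPrimeModel_eq_map {n : ℕ} {ν : ℝ} (hν : 0 < ν) :
    betaPrimeModel n ν = ((gammaMeasure (ν / 2) (1 / 2)).prod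
      (stdGaussian (EuclideanSpace ℝ (Fin n)))).map fun p => (√p.1)⁻¹ • p.2 := by
  have := isProbabilityMeasure_gammaMeasure (half_pos hν) (by norm_num : (0 : ℝ) < 1 / 2)
  refine Measure.ext_of_lintegral _ fun f hf => ?_
  rw [lintegral_betaPrimeModel hν hf, lintegral_map hf (by fun_prop), lintegral_prod _ (by fun_prop)]

/-- The distribution of the squared volume of a beta prime simplex. -/
theorem lintegral_edgeGramDet_betaPrime {n r : ℕ} (hrn : r ≤ n) {ν : ℝ} (hν : 0 < ν)
    {f : ℝ → ℝ≥0∞} (hf : Measurable f) :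
    ∫⁻ x, f (edgeGramDet x) ∂(Measure.pi fun _ : Fin (r + 1) => betaPrimeModel n ν) =
      ∫⁻ t, ∫⁻ q, f (((∏ i, (t i)⁻¹) * ∑ i, t i) * ∏ j, q j)
        ∂(Measure.pi fun j : Fin r => chiSquareLaw (n - r + (j + 1)))
        ∂(Measure.pi fun _ : Fin (r + 1) => gammaMeasure (ν / 2) (1 / 2)) := by
  have := isProbabilityMeasure_gammaMeasure (half_pos hν) (by norm_num : (0 : ℝ) < 1 / 2)
  let T : ℝ × EuclideanSpace ℝ (Fin n) → EuclideanSpace ℝ (Fin n) := fun p => (√p.1)⁻¹ • p.2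
  have hT : Measurable T := by fun_prop
  have hTm : Measurable fun (p : Fin (r + 1) → ℝ × EuclideanSpace ℝ (Fin n)) i => T (p i) := by
    fun_prop
  have hm : Measurable (edgeGramDet (n := n) (r := r)) := continuous_edgeGramDet.measurable
  have h1 : Measure.pi (fun _ : Fin (r + 1) => betaPrimeModel n ν) =
      (Measure.pi fun _ : Fin (r + 1) => (gammaMeasure (ν / 2) (1 / 2)).prod
        (stdGaussian (EuclideanSpace ℝ (Fin n)))).map fun p i => T (p i) := by
    have : IsProbabilityMeasure (((gammaMeasure (ν / 2) (1 / 2)).prod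
        (stdGaussian (EuclideanSpace ℝ (Fin n)))).map T) :=
      Measure.isProbabilityMeasure_map hT.aemeasurable
    rw [Measure.pi_map_pi fun _ => hT.aemeasurable, betaPrimeModel_eq_map hν]
  have e := (measurePreserving_arrowProdEquivProdArrow ℝ (EuclideanSpace ℝ (Fin n)) (Fin (r + 1))
    (fun _ => gammaMeasure (ν / 2) (1 / 2))
    (fun _ => stdGaussian (EuclideanSpace ℝ (Fin n)))).symm
  rw [h1, lintegral_map (f := fun x => f (edgeGramDet x)) (hf.comp hm) hTm,
    ← e.lintegral_comp (f := fun p => f (edgeGramDet fun i => T (p i))) (hf.comp (hm.comp hTm)),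
    lintegral_prod _ (by
      exact ((hf.comp (hm.comp hTm)).comp (MeasurableEquiv.measurable _)).aemeasurable)]
  apply lintegral_congr_ae
  filter_upwards [ae_pi_forall fun _ : Fin (r + 1) => ae_pos_gammaMeasure (ν / 2) (1 / 2)]
    with t ht
  -- With the mixing variables frozen, the points are Gaussian with fixed scalings. This is why the
  -- Gaussian theorem was proved for unequal $c_i$.
  have h2 := map_edgeGramDet_smul_gaussian_eq_chiSquare hrn (c := fun i => (√(t i))⁻¹)
    fun i => inv_ne_zero (Real.sqrt_pos.2 (ht i)).ne'
  have h3 := congrArg (fun ρ => ∫⁻ x, f x ∂ρ) h2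
  simp only at h3
  have hmc : Measurable fun g : Fin (r + 1) → EuclideanSpace ℝ (Fin n) =>
      edgeGramDet fun i => (√(t i))⁻¹ • g i := hm.comp (by fun_prop)
  rw [lintegral_map hf hmc, lintegral_map hf (by fun_prop)] at h3
  refine h3.trans (lintegral_congr fun q => ?_)
  congr 3
  · refine Finset.prod_congr rfl fun i _ => ?_
    rw [inv_pow, Real.sq_sqrt (ht i).le]
  · refine Finset.sum_congr rfl fun i _ => ?_
    rw [inv_pow, inv_inv, Real.sq_sqrt (ht i).le]

lemma ae_pos_chiSquareLaw (d : ℕ) : ∀ᵐ x ∂(chiSquareLaw d), 0 < x := ae_pos_gammaMeasure _ _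

lemma lintegral_rpow_prod_chiSquare {r : ℕ} {d : Fin r → ℕ} (hd : ∀ j, 0 < d j) {s : ℝ}
    (hs : ∀ j, 0 < (d j : ℝ) / 2 + s) :
    ∫⁻ q, ENNReal.ofReal (∏ j, q j) ^ s ∂(Measure.pi fun j => chiSquareLaw (d j)) =
      ENNReal.ofReal (∏ j, (1 / 2) ^ (-s) * Real.Gamma ((d j : ℝ) / 2 + s) /
        Real.Gamma ((d j : ℝ) / 2)) := by
  have := fun j => isProbabilityMeasure_chiSquareLaw (hd j)
  have h1 : ∫⁻ q, ENNReal.ofReal (∏ j, q j) ^ s ∂(Measure.pi fun j => chiSquareLaw (d j)) =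
      ∫⁻ q, ∏ j, ENNReal.ofReal (q j) ^ s ∂(Measure.pi fun j => chiSquareLaw (d j)) := by
    apply lintegral_congr_ae
    filter_upwards [ae_pi_forall fun j => ae_pos_chiSquareLaw (d j)] with q hq
    rw [ENNReal.ofReal_prod_of_nonneg fun i _ => (hq i).le]
    exact (ENNReal.prod_rpow_of_ne_top (fun _ _ => ENNReal.ofReal_ne_top) s).symm
  rw [h1, lintegral_pi_prod _ (f := fun _ x => ENNReal.ofReal x ^ s) fun j => by fun_prop, ENNReal.ofReal_prod_of_nonneg]
  · refine Finset.prod_congr rfl fun j _ => ?_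
    have := hd j
    rw [chiSquareLaw, lintegral_rpow_gammaMeasure (by positivity) (by norm_num) (hs j)]
  · intro j _
    have := hd j
    have h2 := Real.Gamma_pos_of_pos (hs j)
    have h3 := Real.Gamma_pos_of_pos (show 0 < (d j : ℝ) / 2 by positivity)
    positivity

/-- The factor $\prod t_i^{-s}$ is absorbed by tilting each gamma law from shape $a$ to $a-s$. Under
the tilted law the sum is gamma with shape $(m+1)(a-s)$, and `hs` makes its moment of order $s$
finite. -/
lemma lintegral_rpow_sum_div_prod_gamma {m : ℕ} {a b s : ℝ} (ha : 0 < a) (hb : 0 < b)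
    (has : 0 < a - s) (hs : 0 < (m + 1) * (a - s) + s) :
    ∫⁻ t, ENNReal.ofReal ((∏ i, (t i)⁻¹) * ∑ i, t i) ^ s
        ∂(Measure.pi fun _ : Fin (m + 1) => gammaMeasure a b) =
      ENNReal.ofReal ((b ^ s * Real.Gamma (a - s) / Real.Gamma a) ^ (m + 1) *
        (b ^ (-s) * Real.Gamma ((m + 1) * (a - s) + s) / Real.Gamma ((m + 1) * (a - s)))) := by
  have := isProbabilityMeasure_gammaMeasure ha hb
  have := isProbabilityMeasure_gammaMeasure has hb
  have hG1 := Real.Gamma_pos_of_pos ha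
  have hG2 := Real.Gamma_pos_of_pos has
  have hm0 : 0 < ((m : ℝ) + 1) * (a - s) := by positivity
  have hm : Measurable fun t : Fin (m + 1) → ℝ => ∑ i, t i := by fun_prop
  have h1 : ∫⁻ t, ENNReal.ofReal ((∏ i, (t i)⁻¹) * ∑ i, t i) ^ s
        ∂(Measure.pi fun _ : Fin (m + 1) => gammaMeasure a b) =
      ∫⁻ t, (∏ i, ENNReal.ofReal (t i) ^ (-s)) * ENNReal.ofReal (∑ i, t i) ^ s
        ∂(Measure.pi fun _ : Fin (m + 1) => gammaMeasure a b) := by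
    apply lintegral_congr_ae
    filter_upwards [ae_pi_forall fun _ : Fin (m + 1) => ae_pos_gammaMeasure a b] with t ht
    have hpos : 0 ≤ ∏ i, (t i)⁻¹ := Finset.prod_nonneg fun i _ => (inv_pos.2 (ht i)).le
    rw [ENNReal.ofReal_mul hpos, ENNReal.mul_rpow_of_ne_top ENNReal.ofReal_ne_top
      ENNReal.ofReal_ne_top, ENNReal.ofReal_prod_of_nonneg fun i _ => (inv_pos.2 (ht i)).le,
      ← ENNReal.prod_rpow_of_ne_top (fun _ _ => ENNReal.ofReal_ne_top) s]
    congr 1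
    refine Finset.prod_congr rfl fun i _ => ?_
    rw [ENNReal.ofReal_inv_of_pos (ht i), ENNReal.inv_rpow, ENNReal.rpow_neg]
  rw [h1, lintegral_pi_tilt (by fun_prop) (fun f hf =>
    lintegral_rpow_mul_gammaMeasure ha hb (s := -s) (by linarith) hf)
    (by fun_prop : Measurable fun t : Fin (m + 1) → ℝ => ENNReal.ofReal (∑ i, t i) ^ s)]
  simp only [← sub_eq_add_neg, neg_neg]
  have h2 := map_sum_pi_gammaMeasure (ι := Fin (m + 1)) has hb
  rw [Fintype.card_fin, Nat.cast_add, Nat.cast_one] at h2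
  rw [← lintegral_map (f := fun x => ENNReal.ofReal x ^ s) (by fun_prop) hm, h2,
    lintegral_rpow_gammaMeasure hm0 hb hs, ← ENNReal.ofReal_pow (by positivity),
    ← ENNReal.ofReal_mul (by positivity)]

/-- The mixing factor and the chi-square product separate. The bound $s>-1/2$ serves the
chi-squares, which have at least one degree of freedom. -/
theorem lintegral_rpow_edgeGramDet_betaPrime {n r : ℕ} (hrn : r ≤ n) {ν : ℝ} (hν : 0 < ν) {s : ℝ}
    (hs1 : -(1 / 2) < s) (hs2 : s < ν / 2) (hs3 : 0 < ((r : ℝ) + 1) * (ν / 2 - s) + s) :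
    ∫⁻ x, ENNReal.ofReal (edgeGramDet x) ^ s
        ∂(Measure.pi fun _ : Fin (r + 1) => betaPrimeModel n ν) =
      ENNReal.ofReal ((((1 / 2) ^ s * Real.Gamma (ν / 2 - s) / Real.Gamma (ν / 2)) ^ (r + 1) *
        ((1 / 2) ^ (-s) * Real.Gamma ((r + 1) * (ν / 2 - s) + s) /
          Real.Gamma ((r + 1) * (ν / 2 - s)))) *
        ∏ j : Fin r, (1 / 2) ^ (-s) * Real.Gamma (((n - r + (j + 1) : ℕ) : ℝ) / 2 + s) /
          Real.Gamma (((n - r + (j + 1) : ℕ) : ℝ) / 2)) := by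
  have hν2 := half_pos hν
  have := isProbabilityMeasure_gammaMeasure hν2 (by norm_num : (0 : ℝ) < 1 / 2)
  have hd : ∀ j : Fin r, 0 < n - r + (j + 1) := fun j => by omega
  have hds : ∀ j : Fin r, 0 < ((n - r + (j + 1) : ℕ) : ℝ) / 2 + s := fun j => by
    have : (1 : ℝ) ≤ ((n - r + (j + 1) : ℕ) : ℝ) := by exact_mod_cast hd j
    linarith
  have := fun j : Fin r => isProbabilityMeasure_chiSquareLaw (hd j)
  have hG1 := Real.Gamma_pos_of_pos hν2
  have hG2 := Real.Gamma_pos_of_pos (sub_pos.2 hs2)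
  have hG3 := Real.Gamma_pos_of_pos hs3
  have hG4 := Real.Gamma_pos_of_pos
    (show 0 < ((r : ℝ) + 1) * (ν / 2 - s) from mul_pos (by positivity) (sub_pos.2 hs2))
  rw [lintegral_edgeGramDet_betaPrime hrn hν (f := fun x => ENNReal.ofReal x ^ s) (by fun_prop)]
  have h1 : ∫⁻ t, ∫⁻ q, ENNReal.ofReal (((∏ i, (t i)⁻¹) * ∑ i, t i) * ∏ j, q j) ^ s
        ∂(Measure.pi fun j : Fin r => chiSquareLaw (n - r + (j + 1)))
        ∂(Measure.pi fun _ : Fin (r + 1) => gammaMeasure (ν / 2) (1 / 2)) =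
      ∫⁻ t, ENNReal.ofReal ((∏ i, (t i)⁻¹) * ∑ i, t i) ^ s *
        ∫⁻ q, ENNReal.ofReal (∏ j, q j) ^ s
          ∂(Measure.pi fun j : Fin r => chiSquareLaw (n - r + (j + 1)))
        ∂(Measure.pi fun _ : Fin (r + 1) => gammaMeasure (ν / 2) (1 / 2)) := by
    apply lintegral_congr_ae
    filter_upwards [ae_pi_forall fun _ : Fin (r + 1) => ae_pos_gammaMeasure (ν / 2) (1 / 2)]
      with t ht
    have hpos : 0 ≤ (∏ i, (t i)⁻¹) * ∑ i, t i := mul_nonneg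
      (Finset.prod_nonneg fun i _ => (inv_pos.2 (ht i)).le)
      (Finset.sum_nonneg fun i _ => (ht i).le)
    rw [← lintegral_const_mul _ (by fun_prop)]
    refine lintegral_congr fun q => ?_
    rw [ENNReal.ofReal_mul hpos, ENNReal.mul_rpow_of_ne_top ENNReal.ofReal_ne_top
      ENNReal.ofReal_ne_top]
  rw [h1, lintegral_mul_const _ (by fun_prop), lintegral_rpow_prod_chiSquare hd hds,
    lintegral_rpow_sum_div_prod_gamma hν2 (by norm_num) (sub_pos.2 hs2) hs3,
    ← ENNReal.ofReal_mul (by positivity)]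

lemma lintegral_comp_mul_comp_of_indepFun {Ω α β : Type*} [MeasurableSpace Ω] [MeasurableSpace α]
    [MeasurableSpace β] {μ : Measure Ω} {A : Ω → α} {C : Ω → β} (h : IndepFun A C μ)
    (hA : AEMeasurable A μ) (hC : AEMeasurable C μ) {f : α → ℝ≥0∞} {g : β → ℝ≥0∞}
    (hf : Measurable f) (hg : Measurable g) :
    ∫⁻ ω, f (A ω) * g (C ω) ∂μ = (∫⁻ ω, f (A ω) ∂μ) * ∫⁻ ω, g (C ω) ∂μ :=
  lintegral_mul_eq_lintegral_mul_lintegral_of_indepFun'' (hf.comp_aemeasurable hA)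
    (hg.comp_aemeasurable hC) (h.comp hf hg)

/-- The exponents `s` for which the Mellin transforms of the beta prime model are evaluated. -/
lemma mellin_exponent_bounds {r : ℕ} {a s : ℝ} (ha : 0 < a) (hs : |s| < min (1 / 2) a) :
    -(1 / 2) < s ∧ s < a ∧ 0 < ((r : ℝ) + 1) * (a - s) + s := by
  have h1 := abs_lt.1 (hs.trans_le (min_le_left _ _))
  have h2 := abs_lt.1 (hs.trans_le (min_le_right _ _))
  refine ⟨h1.1, h2.2, ?_⟩
  have : 0 ≤ (r : ℝ) * (a - s) := mul_nonneg r.cast_nonneg (by linarith)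
  linarith

lemma lintegral_rpow_prod_betaPrime {r : ℕ} {a : Fin r → ℝ} {b s : ℝ} (ha : ∀ j, 0 < a j)
    (hb : 0 < b) (has : ∀ j, 0 < a j + s) (hbs : 0 < b - s) :
    ∫⁻ q, ENNReal.ofReal (∏ j, q j) ^ s ∂(Measure.pi fun j => betaPrimeLaw (a j) b) =
      ENNReal.ofReal (∏ j, beta (a j + s) (b - s) / beta (a j) b) := by
  have := fun j => isProbabilityMeasure_betaPrimeLaw (ha j) hb
  have h1 : ∫⁻ q, ENNReal.ofReal (∏ j, q j) ^ s ∂(Measure.pi fun j => betaPrimeLaw (a j) b) =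
      ∫⁻ q, ∏ j, ENNReal.ofReal (q j) ^ s ∂(Measure.pi fun j => betaPrimeLaw (a j) b) := by
    apply lintegral_congr_ae
    filter_upwards [ae_pi_forall fun j => ae_pos_betaPrimeLaw (a j) b] with q hq
    rw [ENNReal.ofReal_prod_of_nonneg fun i _ => (hq i).le]
    exact (ENNReal.prod_rpow_of_ne_top (fun _ _ => ENNReal.ofReal_ne_top) s).symm
  rw [h1, lintegral_pi_prod _ (f := fun _ x => ENNReal.ofReal x ^ s) fun j => by fun_prop,
    ENNReal.ofReal_prod_of_nonneg fun j _ =>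
      (div_pos (beta_pos (has j) hbs) (beta_pos (ha j) hb)).le]
  refine Finset.prod_congr rfl fun j _ => ?_
  simpa using lintegral_rpow_betaPrimeLaw (ha j) hb (s := s) (t := 0) (has j) (by simpa using hbs)

lemma lintegral_rpow_one_add_pow_betaPrime {a b s : ℝ} {m : ℕ} (ha : 0 < a) (hb : 0 < b)
    (hbs : 0 < b - m * s) :
    ∫⁻ x, ENNReal.ofReal ((1 + x) ^ m) ^ s ∂(betaPrimeLaw a b) =
      ENNReal.ofReal (beta a (b - m * s) / beta a b) := by
  have h := lintegral_rpow_betaPrimeLaw ha hb (s := 0) (t := m * s) (by simpa using ha)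
    (by simpa using hbs)
  simp only [add_zero, sub_zero] at h
  rw [← h]
  apply lintegral_congr_ae
  filter_upwards [ae_pos_betaPrimeLaw a b] with x hx
  rw [ENNReal.rpow_zero, one_mul, ENNReal.ofReal_pow (by linarith), ← ENNReal.rpow_natCast,
    ← ENNReal.rpow_mul]

lemma lintegral_rpow_inv_mul_one_add_pow_betaPrime {a b s : ℝ} {m : ℕ} (ha : 0 < a) (hb : 0 < b)
    (has : 0 < a - s) (hbs : 0 < b + s - m * s) :
    ∫⁻ x, ENNReal.ofReal (x⁻¹ * (1 + x) ^ m) ^ s ∂(betaPrimeLaw a b) =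
      ENNReal.ofReal (beta (a - s) (b + s - m * s) / beta a b) := by
  have h := lintegral_rpow_betaPrimeLaw ha hb (s := -s) (t := m * s)
    (by simpa [← sub_eq_add_neg] using has) (by simpa using hbs)
  simp only [← sub_eq_add_neg, sub_neg_eq_add] at h
  rw [← h]
  apply lintegral_congr_ae
  filter_upwards [ae_pos_betaPrimeLaw a b] with x hx
  rw [ENNReal.ofReal_mul (inv_pos.2 hx).le, ENNReal.mul_rpow_of_ne_top ENNReal.ofReal_ne_top
    ENNReal.ofReal_ne_top, ENNReal.ofReal_pow (by linarith), ← ENNReal.rpow_natCast,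
    ← ENNReal.rpow_mul, ENNReal.ofReal_inv_of_pos hx, ENNReal.inv_rpow, ENNReal.rpow_neg]

/-- The roles of $\eta$ and $\xi$ become visible here. Since $a+r(a-s)=(r+1)(a-s)+s$, the moment of
$(1+\eta)^r$ cancels the numerator contributed by the gamma sum. Since $(a-s)+r(a-s)=(r+1)(a-s)$,
the moment of $\xi^{-1}(1+\xi)^{r+1}$ reproduces its denominator. The powers of $1/2$ cancel. -/
lemma mellin_betaPrime_identity {r : ℕ} {a s : ℝ} (ha : 0 < a) (has : s < a)
    (hs : 0 < ((r : ℝ) + 1) * (a - s) + s) (hr : 0 < r) (α : Fin r → ℝ)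
    (hα : ∀ j, 0 < α j) :
    beta a (r * a - r * s) / beta a (r * a) *
      (((1 / 2) ^ s * Real.Gamma (a - s) / Real.Gamma a) ^ (r + 1) *
        ((1 / 2) ^ (-s) * Real.Gamma ((r + 1) * (a - s) + s) / Real.Gamma ((r + 1) * (a - s))) *
        ∏ j : Fin r, (1 / 2) ^ (-s) * Real.Gamma (α j + s) / Real.Gamma (α j)) =
    beta (a - s) (r * a + s - (r + 1 : ℕ) * s) / beta a (r * a) *
      ∏ j, beta (α j + s) (a - s) / beta (α j) a := by
  have hr' : (0 : ℝ) < r := by exact_mod_cast hr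
  have g1 := (Real.Gamma_pos_of_pos ha).ne'
  have g2 := (Real.Gamma_pos_of_pos (sub_pos.2 has)).ne'
  have g3 := (Real.Gamma_pos_of_pos hs).ne'
  have g4 := (Real.Gamma_pos_of_pos (mul_pos (by positivity : 0 < (r : ℝ) + 1) (sub_pos.2 has))).ne'
  have g5 := (Real.Gamma_pos_of_pos (mul_pos hr' (sub_pos.2 has))).ne'
  have g6 := (Real.Gamma_pos_of_pos (mul_pos hr' ha)).ne'
  have g7 := (Real.Gamma_pos_of_pos (add_pos ha (mul_pos hr' ha))).ne'
  have h2 : ((1 : ℝ) / 2) ^ s ≠ 0 := by positivity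
  have hP : ∏ j, beta (α j + s) (a - s) / beta (α j) a =
      (∏ j, Real.Gamma (α j + s) / Real.Gamma (α j)) * (Real.Gamma (a - s) / Real.Gamma a) ^ r := by
    rw [← Fin.prod_const, ← Finset.prod_mul_distrib]
    refine Finset.prod_congr rfl fun j _ => ?_
    have k1 := (Real.Gamma_pos_of_pos (hα j)).ne'
    have k3 := (Real.Gamma_pos_of_pos (add_pos (hα j) ha)).ne'
    rw [beta, beta, show α j + s + (a - s) = α j + a by ring]
    field_simp
  have hQ : ∏ j : Fin r, ((1 : ℝ) / 2) ^ (-s) * Real.Gamma (α j + s) / Real.Gamma (α j) =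
      (∏ j, Real.Gamma (α j + s) / Real.Gamma (α j)) * (((1 : ℝ) / 2) ^ (-s)) ^ r := by
    rw [← Fin.prod_const, ← Finset.prod_mul_distrib]
    refine Finset.prod_congr rfl fun j _ => ?_
    ring
  rw [hP, hQ]
  generalize ∏ j, Real.Gamma (α j + s) / Real.Gamma (α j) = P
  rw [Real.rpow_neg (by norm_num : (0 : ℝ) ≤ 1 / 2)]
  generalize ((1 : ℝ) / 2) ^ s = w at *
  rw [beta, beta, beta, show (r : ℝ) * a + s - (r + 1 : ℕ) * s = r * (a - s) by push_cast; ring,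
    show (r : ℝ) * a - r * s = r * (a - s) by ring,
    show a - s + r * (a - s) = (r + 1) * (a - s) by ring,
    show a + r * (a - s) = (r + 1) * (a - s) + s by ring]
  generalize Real.Gamma ((r + 1) * (a - s) + s) = G at *
  simp only [mul_pow, div_pow, inv_pow, pow_succ]
  field_simp

/-- The squared volume of a beta prime simplex. -/
theorem identDistrib_betaPrime {Ω Ω' : Type*} [MeasurableSpace Ω] {μ : Measure Ω}
    [MeasurableSpace Ω'] {μ' : Measure Ω'} [IsProbabilityMeasure μ] [IsProbabilityMeasure μ']
    {n r : ℕ} (hr : 1 ≤ r) (hrn : r ≤ n) {X : Fin (r + 1) → Ω → EuclideanSpace ℝ (Fin n)}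
    (hX : iIndepFun X μ) {ν : ℝ} (hν : 0 < ν) (hlaw : ∀ i, HasLaw (X i) (betaPrimeModel n ν) μ)
    {η : Ω → ℝ} {ξ : Ω' → ℝ} {B : Fin r → Ω' → ℝ}
    (hη : HasLaw η (betaPrimeLaw (ν / 2) (r * ν / 2)) μ)
    (hind : IndepFun η (fun ω => edgeGramDet fun i => X i ω) μ)
    (hξ : HasLaw ξ (betaPrimeLaw (ν / 2) (r * ν / 2)) μ')
    (hB : ∀ j : Fin r, HasLaw (B j) (betaPrimeLaw (((n : ℝ) - r + ((j : ℝ) + 1)) / 2) (ν / 2)) μ')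
    (hBi : iIndepFun B μ') (hind' : IndepFun ξ (fun ω' j => B j ω') μ') :
    IdentDistrib (fun ω => (1 + η ω) ^ r * edgeGramDet fun i => X i ω)
      (fun ω' => (ξ ω')⁻¹ * (1 + ξ ω') ^ (r + 1) * ∏ j, B j ω') μ μ' := by
  have hν2 := half_pos hν
  have hr0 : (0 : ℝ) < r := by exact_mod_cast hr
  have hrn' : (r : ℝ) ≤ n := by exact_mod_cast hrn
  have hb : 0 < r * ν / 2 := by positivity
  have hα1 : ∀ j : Fin r, (1 : ℝ) / 2 ≤ ((n : ℝ) - r + ((j : ℝ) + 1)) / 2 := fun j => by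
    have : (0 : ℝ) ≤ (j : ℝ) := Nat.cast_nonneg _
    linarith
  have hα : ∀ j : Fin r, 0 < ((n : ℝ) - r + ((j : ℝ) + 1)) / 2 := fun j =>
    lt_of_lt_of_le (by norm_num) (hα1 j)
  have hX' := hX.hasLaw_pi hlaw
  have hB' := hBi.hasLaw_pi hB
  have hm : Measurable (edgeGramDet (n := n) (r := r)) := continuous_edgeGramDet.measurable
  have hDm : AEMeasurable (fun ω => edgeGramDet fun i => X i ω) μ :=
    hm.comp_aemeasurable hX'.aemeasurable
  have hPm : AEMeasurable (fun ω' => ∏ j, B j ω') μ' :=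
    (by fun_prop : Measurable fun b : Fin r → ℝ => ∏ j, b j).comp_aemeasurable hB'.aemeasurable
  have hηm := hη.aemeasurable
  have hξm := hξ.aemeasurable
  have hLm : AEMeasurable (fun ω => (1 + η ω) ^ r * edgeGramDet fun i => X i ω) μ := by fun_prop
  have hRm : AEMeasurable (fun ω' => (ξ ω')⁻¹ * (1 + ξ ω') ^ (r + 1) * ∏ j, B j ω') μ' := by
    fun_prop
  -- Mellin transform of the left side; it is finite in this range of $s$, as the uniqueness theorem
  -- requires.
  have hM : ∀ s, |s| < min (1 / 2) (ν / 2) →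
      ∫⁻ x, ENNReal.ofReal x ^ s ∂(μ.map fun ω => (1 + η ω) ^ r * edgeGramDet fun i => X i ω) =
      ENNReal.ofReal (beta (ν / 2) (r * (ν / 2) - r * s) / beta (ν / 2) (r * (ν / 2)) *
      (((1 / 2) ^ s * Real.Gamma (ν / 2 - s) / Real.Gamma (ν / 2)) ^ (r + 1) *
        ((1 / 2) ^ (-s) * Real.Gamma ((r + 1) * (ν / 2 - s) + s) /
          Real.Gamma ((r + 1) * (ν / 2 - s))) *
        ∏ j : Fin r, (1 / 2) ^ (-s) * Real.Gamma (((n : ℝ) - r + ((j : ℝ) + 1)) / 2 + s) /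
          Real.Gamma (((n : ℝ) - r + ((j : ℝ) + 1)) / 2))) := by
    intro s hs
    obtain ⟨h1, h2, h3⟩ := mellin_exponent_bounds (r := r) hν2 hs
    have hrs : 0 < r * (ν / 2) - r * s := by
      rw [← mul_sub]; exact mul_pos hr0 (sub_pos.2 h2)
    rw [lintegral_map' (by fun_prop) hLm]
    have e1 : ∀ᵐ ω ∂μ, ENNReal.ofReal ((1 + η ω) ^ r * edgeGramDet fun i => X i ω) ^ s =
        ENNReal.ofReal ((1 + η ω) ^ r) ^ s *
          ENNReal.ofReal (edgeGramDet fun i => X i ω) ^ s := by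
      have hpos : ∀ᵐ ω ∂μ, 0 < η ω :=
        (hη.ae_iff (p := fun x => 0 < x) measurableSet_Ioi.mem).2 (ae_pos_betaPrimeLaw _ _)
      filter_upwards [hpos] with ω hω
      rw [ENNReal.ofReal_mul (by positivity), ENNReal.mul_rpow_of_ne_top ENNReal.ofReal_ne_top
        ENNReal.ofReal_ne_top]
    rw [lintegral_congr_ae e1, lintegral_comp_mul_comp_of_indepFun hind hηm hDm
      (f := fun x => ENNReal.ofReal ((1 + x) ^ r) ^ s) (g := fun x => ENNReal.ofReal x ^ s)
      (by fun_prop) (by fun_prop),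
      hη.lintegral_comp (f := fun x => ENNReal.ofReal ((1 + x) ^ r) ^ s) (by fun_prop),
      hX'.lintegral_comp (f := fun x => ENNReal.ofReal (edgeGramDet x) ^ s)
        (by fun_prop), mul_div_assoc,
      lintegral_rpow_one_add_pow_betaPrime hν2 (by positivity) hrs,
      lintegral_rpow_edgeGramDet_betaPrime hrn hν h1 h2 h3, ← ENNReal.ofReal_mul
        (div_pos (beta_pos hν2 hrs) (beta_pos hν2 (by positivity))).le]
    simp only [Nat.cast_add, Nat.cast_sub hrn, Nat.cast_one]
  have := Measure.isProbabilityMeasure_map hLm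
  have := Measure.isProbabilityMeasure_map hRm
  refine ⟨hLm, hRm, measure_ext_of_mellin (ε := min (1 / 2) (ν / 2)) (by positivity)
    (fun s hs => by rw [hM s hs]; exact ENNReal.ofReal_ne_top) fun s hs => ?_⟩
  obtain ⟨h1, h2, h3⟩ := mellin_exponent_bounds (r := r) hν2 hs
  have hrs : 0 < r * (ν / 2) + s - (r + 1 : ℕ) * s := by
    have := mul_pos hr0 (sub_pos.2 h2)
    push_cast
    linarith
  have hαs : ∀ j : Fin r, 0 < ((n : ℝ) - r + ((j : ℝ) + 1)) / 2 + s := fun j => by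
    linarith [hα1 j]
  rw [hM s hs, mellin_betaPrime_identity hν2 h2 h3 hr _ hα, lintegral_map' (by fun_prop) hRm]
  have e1 : ∀ᵐ ω ∂μ', ENNReal.ofReal ((ξ ω)⁻¹ * (1 + ξ ω) ^ (r + 1) * ∏ j, B j ω) ^ s =
      ENNReal.ofReal ((ξ ω)⁻¹ * (1 + ξ ω) ^ (r + 1)) ^ s *
        ENNReal.ofReal (∏ j, B j ω) ^ s := by
    have hpos : ∀ᵐ ω ∂μ', 0 < ξ ω :=
      (hξ.ae_iff (p := fun x => 0 < x) measurableSet_Ioi.mem).2 (ae_pos_betaPrimeLaw _ _)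
    filter_upwards [hpos] with ω hω
    rw [ENNReal.ofReal_mul (by positivity), ENNReal.mul_rpow_of_ne_top ENNReal.ofReal_ne_top
      ENNReal.ofReal_ne_top]
  rw [lintegral_congr_ae e1, lintegral_comp_mul_comp_of_indepFun hind' hξm hB'.aemeasurable
    (f := fun x => ENNReal.ofReal (x⁻¹ * (1 + x) ^ (r + 1)) ^ s)
    (g := fun b : Fin r → ℝ => ENNReal.ofReal (∏ j, b j) ^ s) (by fun_prop) (by fun_prop),
    hξ.lintegral_comp (f := fun x => ENNReal.ofReal (x⁻¹ * (1 + x) ^ (r + 1)) ^ s) (by fun_prop),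
    hB'.lintegral_comp (f := fun b : Fin r → ℝ => ENNReal.ofReal (∏ j, b j) ^ s) (by fun_prop),
    mul_div_assoc, lintegral_rpow_inv_mul_one_add_pow_betaPrime hν2 (by positivity)
      (sub_pos.2 h2) hrs, lintegral_rpow_prod_betaPrime hα hν2 hαs (sub_pos.2 h2),
    ← ENNReal.ofReal_mul
      (div_pos (beta_pos (sub_pos.2 h2) hrs) (beta_pos hν2 (by positivity))).le]

/-! ### Rotation invariant laws -/

lemma lintegral_polar {n : ℕ} [NeZero n] {h : ℝ → ℝ≥0∞} (hh : Measurable h)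
    {f : EuclideanSpace ℝ (Fin n) → ℝ≥0∞} (hf : Measurable f) :
    ∫⁻ x, h ‖x‖ * f x = ∫⁻ u : Metric.sphere (0 : EuclideanSpace ℝ (Fin n)) 1,
      ∫⁻ t : Set.Ioi (0 : ℝ), h t * f (t.1 • u.1) ∂(Measure.volumeIoiPow (n - 1))
        ∂(volume : Measure (EuclideanSpace ℝ (Fin n))).toSphere := by
  have hp := (volume : Measure (EuclideanSpace ℝ (Fin n))).measurePreserving_homeomorphUnitSphereProd
  rw [finrank_euclideanSpace, Fintype.card_fin] at hp
  have hG : Measurable fun p : Metric.sphere (0 : EuclideanSpace ℝ (Fin n)) 1 × Set.Ioi (0 : ℝ) =>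
      h p.2 * f (p.2.1 • p.1.1) := by fun_prop
  rw [← lintegral_prod _ hG.aemeasurable, ← hp.lintegral_comp hG]
  have h1 : ∫⁻ x : EuclideanSpace ℝ (Fin n), h ‖x‖ * f x =
      ∫⁻ x in {0}ᶜ, h ‖x‖ * f x := by
    rw [restrict_compl_singleton]
  rw [h1, ← lintegral_subtype_comap (measurableSet_singleton _).compl]
  refine lintegral_congr fun x => ?_
  have hx : ‖x.1‖ ≠ 0 := norm_ne_zero_iff.2 x.2
  simp [smul_smul, hx]

lemma lintegral_sphericalModel {n : ℕ} {f : EuclideanSpace ℝ (Fin n) → ℝ≥0∞} (hf : Measurable f) :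
    ∫⁻ x, f x ∂(sphericalModel n) =
      ((volume : Measure (EuclideanSpace ℝ (Fin n))).toSphere Set.univ)⁻¹ *
        ∫⁻ u, f u.1 ∂(volume : Measure (EuclideanSpace ℝ (Fin n))).toSphere := by
  unfold sphericalModel
  rw [lintegral_map hf measurable_subtype_coe, lintegral_smul_measure, smul_eq_mul]

instance isProbabilityMeasure_sphericalModel {n : ℕ} [NeZero n] :
    IsProbabilityMeasure (sphericalModel n) := by
  have h0 : (volume : Measure (EuclideanSpace ℝ (Fin n))).toSphere ≠ 0 := Measure.toSphere_ne_zero _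
  constructor
  rw [← lintegral_one, lintegral_sphericalModel measurable_const, lintegral_one]
  exact ENNReal.inv_mul_cancel (mt Measure.measure_univ_eq_zero.1 h0) (measure_ne_top _ _)

lemma ae_norm_eq_one_sphericalModel (n : ℕ) : ∀ᵐ x ∂(sphericalModel n), ‖x‖ = 1 := by
  unfold sphericalModel
  rw [ae_map_iff measurable_subtype_coe.aemeasurable
    (measurableSet_eq_fun (by fun_prop) (by fun_prop))]
  exact Filter.Eventually.of_forall fun u => by simp

/-- The law of a random vector whose direction is uniformly distributed and whose length is
independent of the direction with law `κ`. -/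
noncomputable def radialLaw (n : ℕ) (κ : Measure ℝ) : Measure (EuclideanSpace ℝ (Fin n)) :=
  ((sphericalModel n).prod κ).map fun p => p.2 • p.1

/-- Lets the spherical model share the theorem on radial laws with the beta model. -/
lemma sphericalModel_eq_radialLaw (n : ℕ) [NeZero n] :
    sphericalModel n = radialLaw n (Measure.dirac 1) := by
  rw [radialLaw, Measure.prod_dirac, Measure.map_map (by fun_prop) (by fun_prop)]
  exact Measure.map_id.symm.trans (congrArg (fun g => Measure.map g _) (by ext; simp))

/-- A law with a radial density is radial. -/
lemma withDensity_norm_eq_radialLaw {n : ℕ} [NeZero n] {h : ℝ → ℝ≥0∞} (hh : Measurable h)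
    {ρ : Measure (EuclideanSpace ℝ (Fin n))} [SFinite ρ]
    (hρ : ρ = volume.withDensity fun x => h ‖x‖) :
    ρ = radialLaw n (ρ.map norm) := by
  have hl : ∀ f : EuclideanSpace ℝ (Fin n) → ℝ≥0∞, Measurable f →
      ∫⁻ x, f x ∂ρ = ∫⁻ x, h ‖x‖ * f x := fun f hf => by
    rw [hρ]
    exact lintegral_withDensity_eq_lintegral_mul _ (by fun_prop) hf
  have h0 : (volume : Measure (EuclideanSpace ℝ (Fin n))).toSphere ≠ 0 := Measure.toSphere_ne_zero _
  refine Measure.ext_of_lintegral _ fun f hf => ?_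
  rw [radialLaw, lintegral_map hf (by fun_prop), lintegral_prod _ (by fun_prop),
    lintegral_sphericalModel (f := fun u => ∫⁻ t, f (t • u) ∂(ρ.map norm))
      (Measurable.lintegral_prod_right' (f := fun p : EuclideanSpace ℝ (Fin n) × ℝ =>
        f (p.2 • p.1)) (by fun_prop)), hl f hf, lintegral_polar hh hf]
  -- Polar coordinates a second time, for the radial function $x\mapsto f(\|x\|u)$ with $u$ fixed.
  -- The sphere then contributes only its total mass, which cancels the normalisation of the uniform
  -- law.
  have h1 : ∀ u : EuclideanSpace ℝ (Fin n), ∫⁻ t, f (t • u) ∂(ρ.map norm) =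
      (volume : Measure (EuclideanSpace ℝ (Fin n))).toSphere Set.univ *
      ∫⁻ t : Set.Ioi (0 : ℝ), h t * f (t.1 • u) ∂(Measure.volumeIoiPow (n - 1)) := fun u => by
    rw [lintegral_map (by fun_prop) (by fun_prop), hl _ (by fun_prop),
      lintegral_polar hh (f := fun x => f (‖x‖ • u)) (by fun_prop), mul_comm, ← lintegral_const]
    refine lintegral_congr fun v => lintegral_congr fun t => ?_
    have ht : 0 < t.1 := t.2
    simp [norm_smul, abs_of_pos ht]
  simp_rw [h1]
  rw [lintegral_const_mul _ (Measurable.lintegral_prod_right' (f := fun p : Metric.sphere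
    (0 : EuclideanSpace ℝ (Fin n)) 1 × Set.Ioi (0 : ℝ) => h p.2 * f (p.2.1 • p.1.1))
    (by fun_prop)), ← mul_assoc, ENNReal.inv_mul_cancel (mt Measure.measure_univ_eq_zero.1 h0) (measure_ne_top _ _),
    one_mul]

lemma isProbabilityMeasure_radialLaw {n : ℕ} [NeZero n] (κ : Measure ℝ) [IsProbabilityMeasure κ] :
    IsProbabilityMeasure (radialLaw n κ) :=
  Measure.isProbabilityMeasure_map (by fun_prop)

/-- Integration over independent points with a radial law. -/
lemma integral_pi_radialLaw {n m : ℕ} [NeZero n] (κ : Measure ℝ) [IsProbabilityMeasure κ]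
    {f : (Fin m → EuclideanSpace ℝ (Fin n)) → ℝ} (hf : Measurable f) :
    ∫ x, f x ∂(Measure.pi fun _ : Fin m => radialLaw n κ) =
      ∫ p, f (fun i => p.2 i • p.1 i) ∂((Measure.pi fun _ : Fin m => sphericalModel n).prod
        (Measure.pi fun _ : Fin m => κ)) := by
  have := isProbabilityMeasure_radialLaw (n := n) κ
  let T : EuclideanSpace ℝ (Fin n) × ℝ → EuclideanSpace ℝ (Fin n) := fun p => p.2 • p.1
  have hT : Measurable T := by fun_prop
  have hTm : Measurable fun (p : Fin m → EuclideanSpace ℝ (Fin n) × ℝ) i => T (p i) := by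
    fun_prop
  have h1 : Measure.pi (fun _ : Fin m => radialLaw n κ) =
      (Measure.pi fun _ : Fin m => (sphericalModel n).prod κ).map fun p i => T (p i) := by
    have : IsProbabilityMeasure (((sphericalModel n).prod κ).map T) :=
      Measure.isProbabilityMeasure_map hT.aemeasurable
    rw [Measure.pi_map_pi fun _ => hT.aemeasurable]
    rfl
  have e := (measurePreserving_arrowProdEquivProdArrow (EuclideanSpace ℝ (Fin n)) ℝ (Fin m)
    (fun _ => sphericalModel n) (fun _ => κ)).symm
  rw [h1, integral_map hTm.aemeasurable hf.aestronglyMeasurable,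
    ← e.integral_comp (MeasurableEquiv.measurableEmbedding _)]
  rfl

/-! ### Polynomial expansion of the moments -/

/-- Powers of the edge Gram determinant of rescaled points are polynomials in the scaling factors
with continuous coefficients. -/
lemma exists_edgeGramDet_smul_pow_eq_sum (n r k : ℕ) :
    ∃ (S : Finset (Fin (r + 1) →₀ ℕ))
      (a : (Fin (r + 1) →₀ ℕ) → C(Fin (r + 1) → EuclideanSpace ℝ (Fin n), ℝ)),
      ∀ (t : Fin (r + 1) → ℝ) (x : Fin (r + 1) → EuclideanSpace ℝ (Fin n)),
        edgeGramDet (fun i => t i • x i) ^ k = ∑ β ∈ S, a β x * ∏ i, t i ^ β i := by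
  let X := Fin (r + 1) → EuclideanSpace ℝ (Fin n)
  let g : Fin (r + 1) → Fin (r + 1) → C(X, ℝ) := fun i j => ⟨fun x => inner ℝ (x i) (x j), by fun_prop⟩
  let m : Fin (r + 1) → Fin (r + 1) → MvPolynomial (Fin (r + 1)) C(X, ℝ) := fun i j =>
    MvPolynomial.X i * MvPolynomial.X j * MvPolynomial.C (g i j)
  -- The edge Gram matrix with the scalings as indeterminates and continuous functions of the points
  -- as coefficients. The determinant is taken in this ring and commutes with evaluation.
  let M : Matrix (Fin r) (Fin r) (MvPolynomial (Fin (r + 1)) C(X, ℝ)) := Matrix.of fun i j =>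
    m i.succ j.succ - m i.succ 0 - m 0 j.succ + m 0 0
  refine ⟨(M.det ^ k).support, fun β => (M.det ^ k).coeff β, fun t x => ?_⟩
  let ev : C(X, ℝ) →+* ℝ := (Pi.evalRingHom (fun _ : X => ℝ) x).comp ContinuousMap.coeFnRingHom
  have h := MvPolynomial.eval₂_eq' ev t (M.det ^ k)
  refine Eq.trans ?_ h
  rw [MvPolynomial.eval₂_pow]
  congr 1
  change _ = MvPolynomial.eval₂Hom ev t M.det
  rw [RingHom.map_det, edgeGramDet]
  congr 1
  ext i j
  have hev : ∀ i j, MvPolynomial.eval₂ ev t (m i j) = t i * t j * inner ℝ (x i) (x j) := fun i j => by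
    simp only [m, MvPolynomial.eval₂_mul, MvPolynomial.eval₂_X, MvPolynomial.eval₂_C]
    rfl
  simp only [Matrix.gram_apply, RingHom.mapMatrix_apply, Matrix.map_apply, M, Matrix.of_apply,
    MvPolynomial.coe_eval₂Hom, MvPolynomial.eval₂_add, MvPolynomial.eval₂_sub, hev,
    inner_sub_left, inner_sub_right, real_inner_smul_left, real_inner_smul_right]
  ring

/-- The product law lives on a compact product of spheres. -/
lemma integrable_pi_sphericalModel {n m : ℕ} [NeZero n]
    (a : C(Fin m → EuclideanSpace ℝ (Fin n), ℝ)) :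
    Integrable a (Measure.pi fun _ : Fin m => sphericalModel n) := by
  have hK : IsCompact (Set.univ.pi fun _ : Fin m =>
      Metric.sphere (0 : EuclideanSpace ℝ (Fin n)) 1) :=
    isCompact_univ_pi fun _ => isCompact_sphere _ _
  have h := (a.continuous.continuousOn).integrableOn_compact
    (μ := Measure.pi fun _ : Fin m => sphericalModel n) hK
  rw [IntegrableOn, Measure.restrict_eq_self_of_ae_mem] at h
  · exact h
  · filter_upwards [ae_pi_forall fun _ : Fin m => ae_norm_eq_one_sphericalModel n] with x hx i _
    simpa using hx i

/-- The moments of the edge Gram determinant of independent points with a radial law are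
polynomials in the moments of the radial part. -/
lemma exists_integral_edgeGramDet_pow_eq_sum (n r k : ℕ) [NeZero n] :
    ∃ (S : Finset (Fin (r + 1) →₀ ℕ)) (q : (Fin (r + 1) →₀ ℕ) → ℝ),
      ∀ (κ : Measure ℝ) [IsProbabilityMeasure κ], (∀ d : ℕ, Integrable (fun t => t ^ d) κ) →
      ∀ c : Fin (r + 1) → ℝ,
        ∫ x, edgeGramDet (fun i => c i • x i) ^ k
            ∂(Measure.pi fun _ : Fin (r + 1) => radialLaw n κ) =
          ∑ β ∈ S, q β * ∏ i, (c i ^ β i * ∫ t, t ^ β i ∂κ) := by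
  obtain ⟨S, a, ha⟩ := exists_edgeGramDet_smul_pow_eq_sum n r k
  -- The coefficients are averages over directions only and are fixed before `κ` and `c`; the
  -- comparison of different radial laws rests on this.
  refine ⟨S, fun β => ∫ u, a β u ∂(Measure.pi fun _ : Fin (r + 1) => sphericalModel n),
    fun κ _ hκ c => ?_⟩
  have hm : Measurable (edgeGramDet (n := n) (r := r)) := continuous_edgeGramDet.measurable
  have hmc : Measurable fun x : Fin (r + 1) → EuclideanSpace ℝ (Fin n) =>
      edgeGramDet (fun i => c i • x i) ^ k := (hm.comp (by fun_prop)).pow_const k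
  have hint : ∀ (β : Fin (r + 1) →₀ ℕ), Integrable (fun t : Fin (r + 1) → ℝ =>
      ∏ i, c i ^ β i * t i ^ β i) (Measure.pi fun _ : Fin (r + 1) => κ) := fun β =>
    Integrable.fintype_prod (f := fun i (t : ℝ) => c i ^ β i * t ^ β i)
      fun i => (hκ (β i)).const_mul _
  rw [integral_pi_radialLaw κ hmc]
  simp only [smul_smul, ha, mul_pow]
  rw [integral_finsetSum _ fun β _ => (integrable_pi_sphericalModel (a β)).mul_prod (hint β)]
  refine Finset.sum_congr rfl fun β _ => ?_
  rw [integral_prod_mul (f := fun u => a β u) (fun t : Fin (r + 1) → ℝ => ∏ i, c i ^ β i * t i ^ β i),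
    integral_fintype_prod_eq_prod (f := fun i (t : ℝ) => c i ^ β i * t ^ β i)]
  simp only [integral_const_mul]

/-- Transfer of a moment identity from one radial law to another. -/
lemma sum_mul_prod_eq_of_eval_eq {ι τ : Type*} [Fintype ι] {S : Finset (ι →₀ ℕ)} {T : Finset τ}
    {q : (ι →₀ ℕ) → ℝ} {p : τ → ℝ} {e : τ → ι →₀ ℕ} {m w : ℕ → ℝ}
    (h : ∀ c : ι → ℝ, (∀ i, c i ≠ 0) → ∑ β ∈ S, q β * ∏ i, (c i ^ β i * m (β i)) =
      ∑ α ∈ T, p α * ∏ i, c i ^ e α i) :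
    ∑ β ∈ S, q β * ∏ i, (m (β i) * w (β i)) = ∑ α ∈ T, p α * ∏ i, w (e α i) := by
  have hp : ∑ β ∈ S, MvPolynomial.monomial β (q β * ∏ i, m (β i)) =
      ∑ α ∈ T, MvPolynomial.monomial (e α) (p α) := by
    -- Equality at all nonzero arguments already forces equality of polynomials.
    refine MvPolynomial.funext_set (fun _ => {0}ᶜ) (fun _ => (Set.finite_singleton _).infinite_compl)
      fun c hc => ?_
    have := h c fun i => hc i (Set.mem_univ i)
    simp only [map_sum, MvPolynomial.eval_monomial, Finsupp.prod_fintype _ _ fun i => pow_zero (c i)]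
    rw [← this]
    refine Finset.sum_congr rfl fun β _ => ?_
    rw [Finset.prod_mul_distrib]
    ring
  -- The linear functional sending the monomial $c^\beta$ to $\prod_i w(\beta_i)$; it need not be an
  -- evaluation.
  have hL := congrArg ((MvPolynomial.basisMonomials ι ℝ).constr ℝ fun β => ∏ i, w (β i)) hp
  have hmon : ∀ (β : ι →₀ ℕ) (y : ℝ), MvPolynomial.monomial β y =
      y • MvPolynomial.basisMonomials ι ℝ β := fun β y => by
    rw [MvPolynomial.coe_basisMonomials, MvPolynomial.smul_monomial, smul_eq_mul, mul_one]
  simp only [hmon, map_sum, map_smul, Module.Basis.constr_basis, smul_eq_mul] at hL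
  rw [← hL]
  refine Finset.sum_congr rfl fun β _ => ?_
  rw [Finset.prod_mul_distrib, mul_assoc]

lemma prod_mul_sum_inv_pow {ι : Type*} [Fintype ι] [DecidableEq ι] {c : ι → ℝ} (hc : ∀ i, c i ≠ 0)
    (k : ℕ) : ((∏ i, c i ^ 2) * ∑ i, (c i ^ 2)⁻¹) ^ k =
      ∑ α ∈ Finset.univ.piAntidiag k, (Nat.multinomial Finset.univ α : ℝ) *
        ∏ i, c i ^ (2 * (k - α i)) := by
  rw [mul_pow, Finset.sum_pow_eq_sum_piAntidiag, Finset.mul_sum]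
  refine Finset.sum_congr rfl fun α hα => ?_
  rw [mul_left_comm, ← Finset.prod_pow, ← Finset.prod_mul_distrib]
  congr 1
  refine Finset.prod_congr rfl fun i _ => ?_
  have hle : α i ≤ k := by
    rw [← (Finset.mem_piAntidiag.1 hα).1]
    exact Finset.single_le_sum (fun _ _ => Nat.zero_le _) (Finset.mem_univ i)
  rw [pow_mul, pow_sub₀ _ (pow_ne_zero _ (hc i)) hle, inv_pow]

/-! ### Moments of the radial parts -/

lemma integrable_and_integral_eq_of_lintegral {α : Type*} [MeasurableSpace α] {μ : Measure α}
    {f : α → ℝ} (hf : AEStronglyMeasurable f μ) (h0 : 0 ≤ᵐ[μ] f) {M : ℝ} (hM : 0 ≤ M)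
    (h : ∫⁻ x, ENNReal.ofReal (f x) ∂μ = ENNReal.ofReal M) :
    Integrable f μ ∧ ∫ x, f x ∂μ = M := by
  refine ⟨⟨hf, ?_⟩, ?_⟩
  · rw [hasFiniteIntegral_iff_ofReal h0, h]
    exact ENNReal.ofReal_lt_top
  · rw [integral_eq_lintegral_of_nonneg_ae h0 hf, h, ENNReal.toReal_ofReal hM]

lemma norm_moment_of_lintegral {E : Type*} [NormedAddCommGroup E] [MeasurableSpace E]
    [OpensMeasurableSpace E] {ρ : Measure E} {τ : Measure ℝ} (h : ρ.map (fun x => ‖x‖ ^ 2) = τ)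
    {d : ℕ} {M : ℝ} (hM : 0 ≤ M)
    (hτ : ∫⁻ x, ENNReal.ofReal x ^ ((d : ℝ) / 2) ∂τ = ENNReal.ofReal M) :
    Integrable (fun t => t ^ d) (ρ.map norm) ∧ ∫ t, t ^ d ∂(ρ.map norm) = M := by
  refine integrable_and_integral_eq_of_lintegral (by fun_prop) ?_ hM ?_
  · refine (ae_map_iff (by fun_prop) (measurableSet_le (by fun_prop) (by fun_prop))).2
      (Filter.Eventually.of_forall fun x => ?_)
    simp
  · rw [← hτ, ← h, lintegral_map (by fun_prop) (by fun_prop),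
      lintegral_map (by fun_prop) (by fun_prop)]
    refine lintegral_congr fun x => ?_
    rw [ENNReal.ofReal_pow (norm_nonneg _), ENNReal.ofReal_pow (norm_nonneg _),
      ← ENNReal.rpow_natCast, ← ENNReal.rpow_natCast, ← ENNReal.rpow_mul]
    congr 1
    push_cast
    ring

lemma norm_moment_stdGaussian {n : ℕ} (hn : 0 < n) (d : ℕ) :
    Integrable (fun t => t ^ d) ((stdGaussian (EuclideanSpace ℝ (Fin n))).map norm) ∧
      ∫ t, t ^ d ∂((stdGaussian (EuclideanSpace ℝ (Fin n))).map norm) =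
        (1 / 2) ^ (-((d : ℝ) / 2)) * Real.Gamma ((n : ℝ) / 2 + d / 2) / Real.Gamma ((n : ℝ) / 2) := by
  have h1 := Real.Gamma_pos_of_pos (show 0 < (n : ℝ) / 2 by positivity)
  have h2 := Real.Gamma_pos_of_pos (show 0 < (n : ℝ) / 2 + d / 2 by positivity)
  refine norm_moment_of_lintegral (map_norm_sq_gaussian hn) (by positivity) ?_
  rw [chiSquareLaw, lintegral_rpow_gammaMeasure (by positivity) (by norm_num) (by positivity)]

lemma stdGaussian_eq_radialLaw (n : ℕ) [NeZero n] :
    stdGaussian (EuclideanSpace ℝ (Fin n)) =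
      radialLaw n ((stdGaussian (EuclideanSpace ℝ (Fin n))).map norm) := by
  refine withDensity_norm_eq_radialLaw
    (h := fun x => ENNReal.ofReal (gaussianPDFNorm n x)) ?_ ?_
  · unfold gaussianPDFNorm
    fun_prop
  · simpa using stdGaussian_eq_withDensity (E := EuclideanSpace ℝ (Fin n))

lemma betaModel_eq_radialLaw (n : ℕ) [NeZero n] (ν : ℝ) [SFinite (betaModel n ν)] :
    betaModel n ν = radialLaw n ((betaModel n ν).map norm) := by
  refine withDensity_norm_eq_radialLaw (h := fun x => ENNReal.ofReal
    (if x < 1 then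
        1 / Real.pi ^ ((n : ℝ) / 2) * (Real.Gamma ((n + ν) / 2) / Real.Gamma (ν / 2)) *
          (1 - x ^ 2) ^ ((ν - 2) / 2)
      else 0)) ?_ rfl
  exact (Measurable.ite measurableSet_Iio (by fun_prop) (by fun_prop)).ennreal_ofReal

lemma map_norm_sq_betaModel {n : ℕ} (hn : 0 < n) {ν : ℝ} (hν : 0 < ν)
    [IsProbabilityMeasure (betaModel n ν)] :
    (betaModel n ν).map (fun x => ‖x‖ ^ 2) = betaMeasure ((n : ℝ) / 2) (ν / 2) := by
  have hn2 : 0 < (n : ℝ) / 2 := by positivity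
  have hν2 := half_pos hν
  have hb := beta_pos hn2 hν2
  have hG := Real.Gamma_pos_of_pos hn2
  have hGn := Real.Gamma_pos_of_pos hν2
  have hGb := Real.Gamma_pos_of_pos (show 0 < (n + ν) / 2 by positivity)
  have hpi := Real.pi_pos
  have := isProbabilityMeasureBeta hn2 hν2
  set C : ℝ := 1 / Real.pi ^ ((n : ℝ) / 2) * (Real.Gamma ((n + ν) / 2) / Real.Gamma (ν / 2)) with hC
  have hC0 : 0 < C := by positivity
  -- Ratio of the beta density to the Gaussian density as a function of $y=\|x\|^2$. It reduces the
  -- law of $\|x\|^2$ to the known chi-square law, without a separate polar integration.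
  let w : ℝ → ℝ := fun y => if y < 1 then C * (1 - y) ^ ((ν - 2) / 2) *
    ((2 * Real.pi) ^ ((n : ℝ) / 2) * Real.exp (1 / 2 * y)) else 0
  have hw : Measurable fun y => ENNReal.ofReal (w y) :=
    (Measurable.ite measurableSet_Iio (by fun_prop) (by fun_prop)).ennreal_ofReal
  set c : ℝ := (1 / 2) ^ ((n : ℝ) / 2) / Real.Gamma ((n : ℝ) / 2) * C *
    (2 * Real.pi) ^ ((n : ℝ) / 2) * beta ((n : ℝ) / 2) (ν / 2) with hc
  have hpdf : Measurable fun x : EuclideanSpace ℝ (Fin n) => ENNReal.ofReal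
      (if ‖x‖ < 1 then C * (1 - ‖x‖ ^ 2) ^ ((ν - 2) / 2) else 0) :=
    (Measurable.ite (measurableSet_lt (by fun_prop) (by fun_prop)) (by fun_prop)
      (by fun_prop)).ennreal_ofReal
  have hgm : Measurable fun x : EuclideanSpace ℝ (Fin n) =>
      ENNReal.ofReal (gaussianPDFNorm n ‖x‖) := by
    unfold gaussianPDFNorm
    fun_prop
  have key : ∀ f : ℝ → ℝ≥0∞, Measurable f → ∫⁻ y, f y ∂((betaModel n ν).map fun x => ‖x‖ ^ 2) =
      ENNReal.ofReal c * ∫⁻ y, f y ∂(betaMeasure ((n : ℝ) / 2) (ν / 2)) := by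
    intro f hf
    have e1 : ∫⁻ y, ENNReal.ofReal (w y) * f y ∂(chiSquareLaw n) =
        ENNReal.ofReal c * ∫⁻ y, f y ∂(betaMeasure ((n : ℝ) / 2) (ν / 2)) := by
      refine lintegral_mul_withDensity_eq (measurable_gammaPDF _ _) (measurable_betaPDF _ _) hw hf ?_
      filter_upwards [Measure.ae_ne volume (0 : ℝ)] with y hy
      rcases lt_or_gt_of_ne hy with hy | hy
      · rw [gammaPDF_of_neg hy, betaPDF_eq_zero_of_nonpos hy.le]
        simp
      · by_cases hy1 : y < 1
        · rw [gammaPDF_of_nonneg hy.le, betaPDF_of_pos_lt_one hy hy1,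
            ← ENNReal.ofReal_mul (by positivity), ← ENNReal.ofReal_mul (by positivity)]
          simp only [w, if_pos hy1, hc]
          rw [show (ν - 2) / 2 = ν / 2 - 1 by ring, Real.exp_neg]
          field_simp
        · rw [betaPDF_eq_zero_of_one_le (not_lt.1 hy1)]
          simp [w, hy1]
    have hwf : Measurable fun y => ENNReal.ofReal (w y) * f y := hw.mul hf
    have hwf2 : Measurable fun x : EuclideanSpace ℝ (Fin n) =>
        ENNReal.ofReal (w (‖x‖ ^ 2)) * f (‖x‖ ^ 2) := hwf.comp (by fun_prop)
    rw [← e1, ← map_norm_sq_gaussian hn, lintegral_map hf (by fun_prop),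
      lintegral_map hwf (by fun_prop),
      stdGaussian_eq_withDensity (E := EuclideanSpace ℝ (Fin n)), finrank_euclideanSpace,
      Fintype.card_fin, lintegral_withDensity_eq_lintegral_mul _ hgm hwf2]
    refine (lintegral_withDensity_eq_lintegral_mul _ hpdf (by fun_prop)).trans
      (lintegral_congr fun x => ?_)
    simp only [Pi.mul_apply, ← mul_assoc]
    congr 1
    have hg0 : 0 ≤ gaussianPDFNorm n ‖x‖ := by
      unfold gaussianPDFNorm
      positivity
    rw [← ENNReal.ofReal_mul hg0]
    congr 1
    have hiff : ‖x‖ ^ 2 < 1 ↔ ‖x‖ < 1 := by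
      rw [sq_lt_one_iff_abs_lt_one, abs_norm]
    simp only [w, hiff]
    split_ifs with hx
    · rw [gaussianPDFNorm, neg_div, Real.rpow_neg (by positivity), neg_mul, Real.exp_neg]
      field_simp
    · simp
  have hm : Measurable fun x : EuclideanSpace ℝ (Fin n) => ‖x‖ ^ 2 := by fun_prop
  have := Measure.isProbabilityMeasure_map (μ := betaModel n ν) hm.aemeasurable
  -- Two probability measures differ by the factor `c`, so its value need not be computed.
  have hc1 : ENNReal.ofReal c = 1 := by
    have := key (fun _ => 1) measurable_const
    simpa using this.symm
  refine Measure.ext_of_lintegral _ fun f hf => ?_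
  rw [key f hf, hc1, one_mul]

lemma norm_moment_betaModel {n : ℕ} (hn : 0 < n) {ν : ℝ} (hν : 0 < ν)
    [IsProbabilityMeasure (betaModel n ν)] (d : ℕ) :
    Integrable (fun t => t ^ d) ((betaModel n ν).map norm) ∧
      ∫ t, t ^ d ∂((betaModel n ν).map norm) =
        Real.Gamma ((n : ℝ) / 2 + d / 2) * Real.Gamma ((n + ν) / 2) /
          (Real.Gamma ((n + ν) / 2 + d / 2) * Real.Gamma ((n : ℝ) / 2)) := by
  have hn2 : 0 < (n : ℝ) / 2 := by positivity
  have hν2 := half_pos hν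
  have h1 := Real.Gamma_pos_of_pos hn2
  have h2 := Real.Gamma_pos_of_pos (show 0 < (n : ℝ) / 2 + d / 2 by positivity)
  have h3 := Real.Gamma_pos_of_pos (show 0 < (n + ν) / 2 by positivity)
  have h4 := Real.Gamma_pos_of_pos (show 0 < (n + ν) / 2 + d / 2 by positivity)
  have h5 := Real.Gamma_pos_of_pos hν2
  refine norm_moment_of_lintegral (map_norm_sq_betaModel hn hν) (by positivity) ?_
  have h := lintegral_rpow_betaMeasure hn2 hν2 (s := (d : ℝ) / 2) (t := 0) (by positivity)
    (by simpa using hν2)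
  simp only [ENNReal.rpow_zero, mul_one, add_zero] at h
  rw [h, beta, beta, show (n : ℝ) / 2 + d / 2 + ν / 2 = (n + ν) / 2 + d / 2 by ring,
    show (n : ℝ) / 2 + ν / 2 = (n + ν) / 2 by ring]
  congr 1
  field_simp

lemma integral_pow_chiSquareLaw {d : ℕ} (hd : 0 < d) (k : ℕ) :
    ∫ x, x ^ k ∂(chiSquareLaw d) =
      2 ^ k * (Real.Gamma ((d : ℝ) / 2 + k) / Real.Gamma ((d : ℝ) / 2)) := by
  have h1 := Real.Gamma_pos_of_pos (show 0 < (d : ℝ) / 2 by positivity)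
  have h2 := Real.Gamma_pos_of_pos (show 0 < (d : ℝ) / 2 + k by positivity)
  have hpos := ae_pos_chiSquareLaw d
  refine (integrable_and_integral_eq_of_lintegral (by fun_prop)
    (hpos.mono fun x hx => (pow_pos hx k).le) (by positivity) ?_).2
  have h := lintegral_rpow_gammaMeasure (a := (d : ℝ) / 2) (r := 1 / 2) (s := k) (by positivity)
    (by norm_num) (by positivity)
  rw [Real.rpow_neg (by norm_num), Real.rpow_natCast,
    show ((1 / 2 : ℝ) ^ k)⁻¹ = 2 ^ k by rw [one_div, inv_pow, inv_inv], mul_div_assoc] at h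
  rw [← h, chiSquareLaw]
  refine lintegral_congr_ae (hpos.mono fun x hx => ?_)
  simp only
  rw [ENNReal.ofReal_pow hx.le, ENNReal.rpow_natCast]

/-! ### A multinomial Chu–Vandermonde identity -/

lemma choose_eq_Gamma {x : ℝ} {j : ℕ} (h : 0 < x + 1 - j) :
    Ring.choose x j = Real.Gamma (x + 1) / (j.factorial * Real.Gamma (x + 1 - j)) := by
  have hg := Real.Gamma_pos_of_pos h
  have hd : (descPochhammer ℤ j).smeval x = Real.Gamma (x + 1) / Real.Gamma (x + 1 - j) := by
    clear hg
    induction j with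
    | zero =>
      have := Real.Gamma_pos_of_pos h
      simp only [Nat.cast_zero, sub_zero] at this ⊢
      simp [div_self this.ne']
    | succ j ih =>
      push_cast at h ⊢
      have h' : 0 < x - j := by linarith
      have hg := Real.Gamma_pos_of_pos h'
      rw [descPochhammer_succ_right, Polynomial.smeval_mul, ih (by linarith),
        show x + 1 - (j : ℝ) = x - j + 1 by ring, Real.Gamma_add_one h'.ne',
        show x + 1 - (j + 1 : ℝ) = x - j by ring]
      simp only [Polynomial.smeval_sub, Polynomial.smeval_X, Polynomial.smeval_natCast, pow_one,
        pow_zero, nsmul_eq_mul, mul_one]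
      field_simp
  rw [Ring.choose_eq_smul, hd, smul_eq_mul, inv_mul_eq_div, div_div, mul_comm (Real.Gamma _)]

lemma binomialSeries_natCast_mul (m : ℕ) (x : ℝ) :
    PowerSeries.binomialSeries ℝ (m * x) = PowerSeries.binomialSeries ℝ x ^ m := by
  induction m with
  | zero => simp
  | succ m ih =>
    rw [pow_succ, ← ih, ← PowerSeries.binomialSeries_add]
    push_cast
    ring_nf

/-- Chu–Vandermonde for $m$ summands: compare the coefficients of $X^k$ in $(1+X)^{mx}=((1+X)^x)^m$.
-/
lemma choose_natCast_mul (m k : ℕ) (x : ℝ) :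
    Ring.choose (m * x) k =
      ∑ α ∈ (Finset.univ : Finset (Fin m)).piAntidiag k, ∏ i, Ring.choose x (α i) := by
  have h := PowerSeries.coeff_prod (fun _ : Fin m => PowerSeries.binomialSeries ℝ x) k Finset.univ
  rw [Fin.prod_const, ← binomialSeries_natCast_mul] at h
  simp only [PowerSeries.binomialSeries_coeff, smul_eq_mul, mul_one] at h
  rw [h]
  refine Finset.sum_bij (fun l _ => ⇑l) (fun l hl => ?_) (fun l _ l' _ hll => DFunLike.coe_injective hll)
    (fun α hα => ⟨Finsupp.equivFunOnFinite.symm α, ?_, rfl⟩) fun _ _ => rfl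
  · simpa [Finset.mem_finsuppAntidiag, Finset.mem_piAntidiag] using hl
  · simpa [Finset.mem_finsuppAntidiag, Finset.mem_piAntidiag] using hα

/-- Chu–Vandermonde at $x=b+k-1$, where
$\binom{x}{\alpha_i}=\Gamma(b+k)/(\alpha_i!\,\Gamma(b+k-\alpha_i))$; the factorials combine with
$k!$ into the multinomial coefficient. -/
lemma sum_multinomial_mul_prod_inv_Gamma {m k : ℕ} {b : ℝ} (hb : 0 < b)
    (hmk : 0 < m * (b + k - 1) + 1 - k) :
    ∑ α ∈ (Finset.univ : Finset (Fin m)).piAntidiag k, (Nat.multinomial Finset.univ α : ℝ) *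
        ∏ i, (Real.Gamma (b + (k - α i : ℕ)))⁻¹ =
      Real.Gamma (m * (b + k - 1) + 1) /
        (Real.Gamma (m * (b + k - 1) + 1 - k) * Real.Gamma (b + k) ^ m) := by
  have hbk := (Real.Gamma_pos_of_pos (show 0 < b + k by positivity)).ne'
  have hfac : (k.factorial : ℝ) ≠ 0 := by positivity
  have h := choose_natCast_mul m k (b + k - 1)
  rw [choose_eq_Gamma hmk] at h
  have hterm : ∀ α ∈ (Finset.univ : Finset (Fin m)).piAntidiag k,
      (Nat.multinomial Finset.univ α : ℝ) * ∏ i, (Real.Gamma (b + (k - α i : ℕ)))⁻¹ =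
      k.factorial / Real.Gamma (b + k) ^ m * ∏ i, Ring.choose (b + k - 1 : ℝ) (α i) := by
    intro α hα
    have hsum := (Finset.mem_piAntidiag.1 hα).1
    have hle : ∀ i, α i ≤ k := fun i => by
      rw [← hsum]
      exact Finset.single_le_sum (fun _ _ => Nat.zero_le _) (Finset.mem_univ i)
    have hspec := Nat.multinomial_spec Finset.univ α
    rw [hsum] at hspec
    rw [← hspec]
    push_cast
    have hp : ∏ i, Ring.choose (b + k - 1 : ℝ) (α i) =
        Real.Gamma (b + k) ^ m * ((∏ i, ((α i).factorial : ℝ))⁻¹ *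
          ∏ i, (Real.Gamma (b + (k - α i : ℕ)))⁻¹) := by
      rw [← Fin.prod_const, ← Finset.prod_inv_distrib, ← Finset.prod_mul_distrib,
        ← Finset.prod_mul_distrib]
      refine Finset.prod_congr rfl fun i _ => ?_
      have e : (b + k - 1 : ℝ) + 1 - α i = b + (k - α i : ℕ) := by
        rw [Nat.cast_sub (hle i)]
        ring
      rw [choose_eq_Gamma (by rw [e]; positivity), e, sub_add_cancel, div_eq_mul_inv, mul_inv]
    have hfacs : ∏ i, ((α i).factorial : ℝ) ≠ 0 :=
      Finset.prod_ne_zero_iff.2 fun i _ => by positivity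
    rw [hp]
    field_simp
  rw [Finset.sum_congr rfl hterm, ← Finset.mul_sum, ← h]
  field_simp

/-! ### Moments of the edge Gram determinant -/

lemma integral_edgeGramDet_smul_gaussian {n r : ℕ} (hrn : r ≤ n) (k : ℕ) {c : Fin (r + 1) → ℝ}
    (hc : ∀ i, c i ≠ 0) :
    ∫ g, edgeGramDet (fun i => c i • g i) ^ k
        ∂(Measure.pi fun _ : Fin (r + 1) => stdGaussian (EuclideanSpace ℝ (Fin n))) =
      ((∏ i, c i ^ 2) * ∑ i, (c i ^ 2)⁻¹) ^ k *
        ∏ j : Fin r, 2 ^ k * (Real.Gamma (((n - r + (j + 1) : ℕ) : ℝ) / 2 + k) /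
          Real.Gamma (((n - r + (j + 1) : ℕ) : ℝ) / 2)) := by
  have hd : ∀ j : Fin r, 0 < n - r + (j + 1) := fun j => by omega
  have := fun j : Fin r => isProbabilityMeasure_chiSquareLaw (hd j)
  have hm : Measurable (edgeGramDet (n := n) (r := r)) := continuous_edgeGramDet.measurable
  have hmc : Measurable fun x : Fin (r + 1) → EuclideanSpace ℝ (Fin n) =>
      edgeGramDet (fun i => c i • x i) := hm.comp (by fun_prop)
  have h := congrArg (fun ρ => ∫ x, x ^ k ∂ρ) (map_edgeGramDet_smul_gaussian_eq_chiSquare hrn hc)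
  simp only at h
  rw [integral_map hmc.aemeasurable (by fun_prop), integral_map (by fun_prop) (by fun_prop)] at h
  rw [h]
  simp only [mul_pow _ (∏ _, _), ← Finset.prod_pow]
  rw [integral_const_mul, integral_fintype_prod_eq_prod (f := fun _ (x : ℝ) => x ^ k)]
  simp only [integral_pow_chiSquareLaw (hd _)]

/-- Moments of the squared volume of a simplex whose vertices have a radial law with the radial
moments of a beta law. -/
theorem integral_edgeGramDet_pow_radialLaw {n r : ℕ} (hr : 1 ≤ r) (hrn : r ≤ n) (k : ℕ)
    (κ : Measure ℝ) [IsProbabilityMeasure κ] {b : ℝ} (hb : 1 ≤ b)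
    (hκ : ∀ d : ℕ, Integrable (fun t => t ^ d) κ ∧ ∫ t, t ^ d ∂κ =
      Real.Gamma ((n : ℝ) / 2 + d / 2) * Real.Gamma b /
          (Real.Gamma (b + d / 2) * Real.Gamma ((n : ℝ) / 2))) :
    ∫ x, edgeGramDet x ^ k ∂(Measure.pi fun _ : Fin (r + 1) => radialLaw n κ) =
      (∏ j : Fin r, Real.Gamma (((n - r + (j + 1) : ℕ) : ℝ) / 2 + k) /
          Real.Gamma (((n - r + (j + 1) : ℕ) : ℝ) / 2)) *
        ((Real.Gamma b / Real.Gamma (b + k)) ^ (r + 1) *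
          (Real.Gamma ((r + 1 : ℕ) * (b + k - 1) + 1) /
            Real.Gamma ((r + 1 : ℕ) * (b + k - 1) + 1 - k))) := by
  have hn : 0 < n := by omega
  have : NeZero n := ⟨hn.ne'⟩
  have hb0 : 0 < b := by linarith
  obtain ⟨S, q, hq⟩ := exists_integral_edgeGramDet_pow_eq_sum n r k
  have hnorm : Measurable fun x : EuclideanSpace ℝ (Fin n) => ‖x‖ := by fun_prop
  have := Measure.isProbabilityMeasure_map
    (μ := stdGaussian (EuclideanSpace ℝ (Fin n))) hnorm.aemeasurable
  have hG := fun d => norm_moment_stdGaussian hn d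
  set A : ℝ := ∏ j : Fin r, Real.Gamma (((n - r + (j + 1) : ℕ) : ℝ) / 2 + k) /
    Real.Gamma (((n - r + (j + 1) : ℕ) : ℝ) / 2) with hA
  let m : ℕ → ℝ := fun d =>
    (1 / 2) ^ (-((d : ℝ) / 2)) * Real.Gamma ((n : ℝ) / 2 + d / 2) / Real.Gamma ((n : ℝ) / 2)
  -- Quotient of the radial moments of `κ` by the Gaussian ones `m`; the factor depending on $n$
  -- cancels.
  let w : ℕ → ℝ := fun d => (1 / 2) ^ ((d : ℝ) / 2) * (Real.Gamma b / Real.Gamma (b + d / 2))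
  have hmw : ∀ d, ∫ t, t ^ d ∂κ = m d * w d := fun d => by
    have h2 := (Real.Gamma_pos_of_pos (show 0 < b + (d : ℝ) / 2 by positivity)).ne'
    have h3 := (Real.Gamma_pos_of_pos (show 0 < (n : ℝ) / 2 by positivity)).ne'
    have h4 : ((1 : ℝ) / 2) ^ ((d : ℝ) / 2) ≠ 0 := by positivity
    rw [(hκ d).2]
    simp only [m, w]
    rw [Real.rpow_neg (by norm_num)]
    field_simp
  have hgauss : ∀ c : Fin (r + 1) → ℝ, (∀ i, c i ≠ 0) →
      ∑ β ∈ S, q β * ∏ i, (c i ^ β i * m (β i)) =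
      ∑ α ∈ Finset.univ.piAntidiag k, (2 ^ (k * r) * A * (Nat.multinomial Finset.univ α : ℝ)) *
        ∏ i, c i ^ (Finsupp.equivFunOnFinite.symm fun i => 2 * (k - α i)) i := by
    intro c hc
    have h1 := hq _ (fun d => (hG d).1) c
    rw [← stdGaussian_eq_radialLaw, integral_edgeGramDet_smul_gaussian hrn k hc,
      prod_mul_sum_inv_pow hc] at h1
    simp only [(hG _).2] at h1
    rw [← h1, Finset.sum_mul]
    refine Finset.sum_congr rfl fun α _ => ?_
    rw [Finset.prod_mul_distrib, Fin.prod_const, ← hA, ← pow_mul]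
    simp only [Finsupp.equivFunOnFinite_symm_apply_apply]
    ring
  have h1 := hq κ (fun d => (hκ d).1) fun _ => 1
  simp only [one_smul, one_pow, one_mul, hmw] at h1
  rw [h1, sum_mul_prod_eq_of_eval_eq hgauss]
  have hw : ∀ e : ℕ, w (2 * e) = (1 / 2) ^ e * (Real.Gamma b * (Real.Gamma (b + e))⁻¹) := fun e => by
    simp only [w]
    rw [show ((2 * e : ℕ) : ℝ) / 2 = e by push_cast; ring, Real.rpow_natCast, div_eq_mul_inv (Real.Gamma b)]
  have hterm : ∀ α ∈ (Finset.univ : Finset (Fin (r + 1))).piAntidiag k,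
      2 ^ (k * r) * A * (Nat.multinomial Finset.univ α : ℝ) *
        ∏ i, w ((Finsupp.equivFunOnFinite.symm fun i => 2 * (k - α i)) i) =
      A * Real.Gamma b ^ (r + 1) * ((Nat.multinomial Finset.univ α : ℝ) *
        ∏ i, (Real.Gamma (b + (k - α i : ℕ)))⁻¹) := by
    intro α hα
    have hsum := (Finset.mem_piAntidiag.1 hα).1
    have hle : ∀ i, α i ≤ k := fun i => by
      rw [← hsum]
      exact Finset.single_le_sum (fun _ _ => Nat.zero_le _) (Finset.mem_univ i)
    have hs : ∑ i, (k - α i) = k * r := by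
      have : ∑ i, (k - α i) + ∑ i, α i = (r + 1) * k := by
        rw [← Finset.sum_add_distrib, Finset.sum_congr rfl fun i _ => Nat.sub_add_cancel (hle i)]
        simp
      rw [hsum] at this
      linarith
    simp only [Finsupp.equivFunOnFinite_symm_apply_apply, hw]
    rw [Finset.prod_mul_distrib, Finset.prod_mul_distrib, Fin.prod_const, Finset.prod_pow_eq_pow_sum,
      hs]
    -- The powers of $2$ from the chi-square moments cancel those from `w`, since
    -- $\sum_i(k-\alpha_i)=kr$ for every $\alpha$.
    have h2 : (2 : ℝ) ^ (k * r) * (1 / 2) ^ (k * r) = 1 := by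
      rw [← mul_pow]; norm_num
    linear_combination (A * (Nat.multinomial Finset.univ α : ℝ) * (Real.Gamma b ^ (r + 1) *
      ∏ i, (Real.Gamma (b + (k - α i : ℕ)))⁻¹)) * h2
  have hpos : 0 < ((r + 1 : ℕ) : ℝ) * (b + k - 1) + 1 - k := by
    push_cast
    have : 0 ≤ (r : ℝ) * (b + k - 1) :=
      mul_nonneg r.cast_nonneg (by linarith [(Nat.cast_nonneg k : (0 : ℝ) ≤ k)])
    linarith
  rw [Finset.sum_congr rfl hterm, ← Finset.mul_sum, sum_multinomial_mul_prod_inv_Gamma hb0 hpos,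
    div_pow]
  field_simp

/-! ### Beta laws -/

lemma isProbabilityMeasure_betaLaw {a b : ℝ} (ha : 0 < a) (hb : 0 ≤ b) :
    IsProbabilityMeasure (betaLaw a b) := by
  unfold betaLaw
  split_ifs with h
  · infer_instance
  · exact isProbabilityMeasureBeta ha (lt_of_le_of_ne hb (Ne.symm h))

lemma ae_mem_Icc_betaMeasure (a b : ℝ) : ∀ᵐ x ∂(betaMeasure a b), x ∈ Set.Icc (0 : ℝ) 1 := by
  rw [betaMeasure, ae_withDensity_iff (measurable_betaPDF a b)]
  refine Filter.Eventually.of_forall fun x h => ⟨?_, ?_⟩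
  · by_contra! h2
    exact h (betaPDF_eq_zero_of_nonpos h2.le)
  · by_contra! h2
    exact h (betaPDF_eq_zero_of_one_le h2.le)

lemma ae_mem_Icc_betaLaw (a b : ℝ) : ∀ᵐ x ∂(betaLaw a b), x ∈ Set.Icc (0 : ℝ) 1 := by
  unfold betaLaw
  split_ifs with h
  · rw [ae_dirac_eq]
    exact ⟨zero_le_one, le_rfl⟩
  · exact ae_mem_Icc_betaMeasure a b

lemma integral_pow_mul_one_sub_pow_betaMeasure {a b : ℝ} (ha : 0 < a) (hb : 0 < b) (i j : ℕ) :
    ∫ x, x ^ i * (1 - x) ^ j ∂(betaMeasure a b) = beta (a + i) (b + j) / beta a b := by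
  have hmem := ae_mem_Icc_betaMeasure a b
  refine (integrable_and_integral_eq_of_lintegral (by fun_prop) ?_
    (div_pos (beta_pos (by positivity) (by positivity)) (beta_pos ha hb)).le ?_).2
  · filter_upwards [hmem] with x hx
    exact mul_nonneg (pow_nonneg hx.1 _) (pow_nonneg (sub_nonneg.2 hx.2) _)
  · rw [← lintegral_rpow_betaMeasure ha hb (s := i) (t := j) (by positivity) (by positivity)]
    refine lintegral_congr_ae (hmem.mono fun x hx => ?_)
    simp only
    rw [ENNReal.ofReal_mul (pow_nonneg hx.1 _), ENNReal.ofReal_pow hx.1,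
      ENNReal.ofReal_pow (sub_nonneg.2 hx.2), ENNReal.rpow_natCast, ENNReal.rpow_natCast]

lemma integral_pow_betaLaw {a b : ℝ} (ha : 0 < a) (hb : 0 ≤ b) (k : ℕ) :
    ∫ x, x ^ k ∂(betaLaw a b) = Real.Gamma (a + k) / Real.Gamma a *
      (Real.Gamma (a + b) / Real.Gamma (a + b + k)) := by
  have h1 := Real.Gamma_pos_of_pos ha
  have h2 := Real.Gamma_pos_of_pos (show 0 < a + k by positivity)
  have h3 := Real.Gamma_pos_of_pos (show 0 < a + b by positivity)
  have h4 := Real.Gamma_pos_of_pos (show 0 < a + b + k by positivity)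
  unfold betaLaw
  split_ifs with h
  · rw [integral_dirac, one_pow, h, add_zero]
    field_simp
  · have hb' : 0 < b := lt_of_le_of_ne hb (Ne.symm h)
    have h5 := Real.Gamma_pos_of_pos hb'
    have := integral_pow_mul_one_sub_pow_betaMeasure ha hb' k 0
    simp only [pow_zero, mul_one, Nat.cast_zero, add_zero] at this
    rw [this, beta, beta, show a + k + b = a + b + k by ring]
    field_simp

/-- The parameters of $\xi$ and $\eta$ fit because $(r+1)(b+k-1)+1=(b+k)+r(b-1)+rk$. The moment of
$\xi(1-\xi)^r$ cancels the Chu–Vandermonde numerator, and that of $(1-\eta)^r$ matches its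
denominator. -/
lemma beta_moment_identity {r : ℕ} {b : ℝ} (hb : 0 < b) (hβ : 0 < r * (b - 1)) (k : ℕ)
    (p q : Fin r → ℝ) :
    beta (b + k) (r * (b - 1) + (r * k : ℕ)) / beta b (r * (b - 1)) *
      ((∏ j, p j / q j) * ((Real.Gamma b / Real.Gamma (b + k)) ^ (r + 1) *
        (Real.Gamma ((r + 1 : ℕ) * (b + k - 1) + 1) /
          Real.Gamma ((r + 1 : ℕ) * (b + k - 1) + 1 - k)))) =
    beta b (r * (b - 1) + (r * k : ℕ)) / beta b (r * (b - 1)) *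
      ∏ j, p j / q j * (Real.Gamma b / Real.Gamma (b + k)) := by
  rw [Finset.prod_mul_distrib, Fin.prod_const]
  generalize ∏ j, p j / q j = P
  have h0 := beta_pos hb hβ
  have h1 := (Real.Gamma_pos_of_pos hb).ne'
  have h2 := (Real.Gamma_pos_of_pos (show 0 < b + k by positivity)).ne'
  have h3 := (Real.Gamma_pos_of_pos
    (show 0 < r * (b - 1) + (r * k : ℕ) by positivity)).ne'
  have h4 := (Real.Gamma_pos_of_pos
    (show 0 < b + (r * (b - 1) + (r * k : ℕ)) by positivity)).ne'
  have h5 := (Real.Gamma_pos_of_pos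
    (show 0 < b + k + (r * (b - 1) + (r * k : ℕ)) by positivity)).ne'
  have e1 : ((r + 1 : ℕ) : ℝ) * (b + k - 1) + 1 = b + k + (r * (b - 1) + (r * k : ℕ)) := by
    push_cast
    ring
  have e2 : b + k + (r * (b - 1) + (r * k : ℕ)) - k = b + (r * (b - 1) + (r * k : ℕ)) := by ring
  rw [e1, e2, beta.eq_def (b + k), beta.eq_def b (r * (b - 1) + (r * k : ℕ))]
  generalize Real.Gamma (b + k + (r * (b - 1) + (r * k : ℕ))) = G1 at *
  generalize Real.Gamma (b + (r * (b - 1) + (r * k : ℕ))) = G2 at *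
  generalize Real.Gamma (r * (b - 1) + (r * k : ℕ)) = G3 at *
  generalize Real.Gamma (b + k) = G4 at *
  simp only [div_pow, pow_succ]
  field_simp

/-- The squared volume of a simplex whose vertices have a radial law with the radial moments of
a beta law. -/
theorem identDistrib_radialLaw {Ω Ω' : Type*} [MeasurableSpace Ω] {μ : Measure Ω}
    [MeasurableSpace Ω'] {μ' : Measure Ω'} [IsProbabilityMeasure μ] [IsProbabilityMeasure μ']
    {n r : ℕ} (hr : 1 ≤ r) (hrn : r ≤ n) {X : Fin (r + 1) → Ω → EuclideanSpace ℝ (Fin n)}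
    (hX : iIndepFun X μ) {κ : Measure ℝ} [IsProbabilityMeasure κ] {b : ℝ} (hb : 1 ≤ b)
    (hκ : ∀ d : ℕ, Integrable (fun t => t ^ d) κ ∧ ∫ t, t ^ d ∂κ =
      Real.Gamma ((n : ℝ) / 2 + d / 2) * Real.Gamma b /
          (Real.Gamma (b + d / 2) * Real.Gamma ((n : ℝ) / 2)))
    (hlaw : ∀ i, HasLaw (X i) (radialLaw n κ) μ) (hball : ∀ᵐ x ∂(radialLaw n κ), ‖x‖ ≤ 1)
    {ξ : Ω → ℝ} {η : Ω' → ℝ} {B : Fin r → Ω' → ℝ}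
    (hξ : HasLaw ξ (betaLaw b (r * (b - 1))) μ)
    (hind : IndepFun ξ (fun ω => edgeGramDet fun i => X i ω) μ)
    (hη : HasLaw η (betaLaw b (r * (b - 1))) μ')
    (hba : ∀ j : Fin r, ((n : ℝ) - r + ((j : ℝ) + 1)) / 2 ≤ b)
    (hB : ∀ j : Fin r, HasLaw (B j) (betaLaw (((n : ℝ) - r + ((j : ℝ) + 1)) / 2)
      (b - ((n : ℝ) - r + ((j : ℝ) + 1)) / 2)) μ')
    (hBi : iIndepFun B μ') (hind' : IndepFun η (fun ω' j => B j ω') μ') :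
    IdentDistrib (fun ω => ξ ω * (1 - ξ ω) ^ r * edgeGramDet fun i => X i ω)
      (fun ω' => (1 - η ω') ^ r * ∏ j, B j ω') μ μ' := by
  have hn : 0 < n := by omega
  have : NeZero n := ⟨hn.ne'⟩
  have hb0 : 0 < b := by linarith
  have hrn' : (r : ℝ) ≤ n := by exact_mod_cast hrn
  have ha : ∀ j : Fin r, 0 < ((n : ℝ) - r + ((j : ℝ) + 1)) / 2 := fun j => by
    have : (0 : ℝ) ≤ (j : ℝ) := Nat.cast_nonneg _
    linarith
  have := isProbabilityMeasure_radialLaw (n := n) κ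
  have := fun j : Fin r => isProbabilityMeasure_betaLaw (ha j) (sub_nonneg.2 (hba j))
  have hX' := hX.hasLaw_pi hlaw
  have hB' := hBi.hasLaw_pi hB
  have hm : Measurable (edgeGramDet (n := n) (r := r)) := continuous_edgeGramDet.measurable
  have hDm : AEMeasurable (fun ω => edgeGramDet fun i => X i ω) μ :=
    hm.comp_aemeasurable hX'.aemeasurable
  have hPm : AEMeasurable (fun ω' => ∏ j, B j ω') μ' :=
    (by fun_prop : Measurable fun b : Fin r → ℝ => ∏ j, b j).comp_aemeasurable hB'.aemeasurable
  have hξm := hξ.aemeasurable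
  have hηm := hη.aemeasurable
  have hLm : AEMeasurable (fun ω => ξ ω * (1 - ξ ω) ^ r * edgeGramDet fun i => X i ω) μ := by
    fun_prop
  have hRm : AEMeasurable (fun ω' => (1 - η ω') ^ r * ∏ j, B j ω') μ' := by fun_prop
  have hξI : ∀ᵐ ω ∂μ, ξ ω ∈ Set.Icc (0 : ℝ) 1 :=
    (hξ.ae_iff (p := fun x => x ∈ Set.Icc (0 : ℝ) 1) measurableSet_Icc.mem).2 (ae_mem_Icc_betaLaw _ _)
  have hηI : ∀ᵐ ω ∂μ', η ω ∈ Set.Icc (0 : ℝ) 1 :=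
    (hη.ae_iff (p := fun x => x ∈ Set.Icc (0 : ℝ) 1) measurableSet_Icc.mem).2 (ae_mem_Icc_betaLaw _ _)
  have hBI : ∀ᵐ ω ∂μ', ∀ j, B j ω ∈ Set.Icc (0 : ℝ) 1 := ae_all_iff.2 fun j =>
    ((hB j).ae_iff (p := fun x => x ∈ Set.Icc (0 : ℝ) 1) measurableSet_Icc.mem).2
      (ae_mem_Icc_betaLaw _ _)
  have hXI : ∀ᵐ ω ∂μ, ∀ i, ‖X i ω‖ ≤ 1 := ae_all_iff.2 fun i =>
    ((hlaw i).ae_iff (p := fun x => ‖x‖ ≤ 1) (measurableSet_le (by fun_prop)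
      (by fun_prop) : MeasurableSet {x : EuclideanSpace ℝ (Fin n) | ‖x‖ ≤ 1}).mem).2 hball
  -- The determinant is continuous, hence bounded on the product of closed unit balls that contains
  -- the points almost surely.
  obtain ⟨C, hC⟩ := (isCompact_univ_pi fun _ : Fin (r + 1) =>
    isCompact_closedBall (0 : EuclideanSpace ℝ (Fin n)) 1).exists_bound_of_continuousOn
    (continuous_edgeGramDet (n := n) (r := r)).continuousOn
  have := Measure.isProbabilityMeasure_map hLm
  have := Measure.isProbabilityMeasure_map hRm
  refine ⟨hLm, hRm, measure_ext_of_moments (C := max C 1) ?_ ?_ fun k => ?_⟩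
  · refine (ae_map_iff hLm (measurableSet_le (by fun_prop) (by fun_prop))).2 ?_
    filter_upwards [hξI, hXI] with ω h1 h2
    rw [abs_mul]
    refine le_trans (mul_le_of_le_one_left (abs_nonneg _) ?_) ((hC _ fun i _ => by
      simpa using h2 i).trans (le_max_left _ _))
    rw [abs_of_nonneg (mul_nonneg h1.1 (pow_nonneg (sub_nonneg.2 h1.2) _))]
    exact mul_le_one₀ h1.2 (pow_nonneg (sub_nonneg.2 h1.2) _)
      (pow_le_one₀ (sub_nonneg.2 h1.2) (by linarith [h1.1]))
  · refine (ae_map_iff hRm (measurableSet_le (by fun_prop) (by fun_prop))).2 ?_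
    filter_upwards [hηI, hBI] with ω h1 h2
    have h3 : 0 ≤ ∏ j, B j ω := Finset.prod_nonneg fun j _ => (h2 j).1
    rw [abs_of_nonneg (mul_nonneg (pow_nonneg (sub_nonneg.2 h1.2) _) h3)]
    exact (mul_le_one₀ (pow_le_one₀ (sub_nonneg.2 h1.2) (by linarith [h1.1])) h3
      (Finset.prod_le_one (fun j _ => (h2 j).1) fun j _ => (h2 j).2)).trans (le_max_right _ _)
  rw [integral_map hLm (by fun_prop), integral_map hRm (by fun_prop)]
  have hL : ∫ ω, (ξ ω * (1 - ξ ω) ^ r * edgeGramDet fun i => X i ω) ^ k ∂μ =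
      (∫ x, x ^ k * (1 - x) ^ (r * k) ∂(betaLaw b (r * (b - 1)))) *
        ∫ x, edgeGramDet x ^ k ∂(Measure.pi fun _ : Fin (r + 1) => radialLaw n κ) := by
    have h1 := hind.integral_fun_comp_mul_comp hξm hDm
      (f := fun x => x ^ k * (1 - x) ^ (r * k)) (g := fun x => x ^ k) (by fun_prop) (by fun_prop)
    rw [← hξ.integral_comp (f := fun x => x ^ k * (1 - x) ^ (r * k)) (by fun_prop),
      ← hX'.integral_comp (f := fun x => edgeGramDet x ^ k) (hm.pow_const k).aestronglyMeasurable]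
    refine Eq.trans (integral_congr_ae (Filter.Eventually.of_forall fun ω => ?_)) h1
    simp only [mul_pow, pow_mul]
  have hR : ∫ ω, ((1 - η ω) ^ r * ∏ j, B j ω) ^ k ∂μ' =
      (∫ x, (1 - x) ^ (r * k) ∂(betaLaw b (r * (b - 1)))) *
        ∏ j : Fin r, ∫ x, x ^ k ∂(betaLaw (((n : ℝ) - r + ((j : ℝ) + 1)) / 2)
          (b - ((n : ℝ) - r + ((j : ℝ) + 1)) / 2)) := by
    have hpm : Measurable fun b : Fin r → ℝ => ∏ j, b j ^ k := by fun_prop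
    have h1 := hind'.integral_fun_comp_mul_comp hηm hB'.aemeasurable
      (f := fun x => (1 - x) ^ (r * k)) (g := fun b : Fin r → ℝ => ∏ j, b j ^ k)
      (by fun_prop) hpm.aestronglyMeasurable
    rw [← integral_fintype_prod_eq_prod (f := fun _ (x : ℝ) => x ^ k),
      ← hη.integral_comp (f := fun x => (1 - x) ^ (r * k)) (by fun_prop),
      ← hB'.integral_comp (f := fun b : Fin r → ℝ => ∏ j, b j ^ k) hpm.aestronglyMeasurable]
    refine Eq.trans (integral_congr_ae (Filter.Eventually.of_forall fun ω => ?_)) h1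
    simp only [mul_pow, pow_mul, Finset.prod_pow]
  rcases Nat.eq_zero_or_pos k with rfl | hk
  · simp
  rw [hL, hR]
  -- For $b=1$ the laws of $\xi$ and $\eta$ are unit masses at $1$, and both moments vanish because
  -- $rk>0$; this is why $k=0$ was treated apart.
  rcases hb.eq_or_lt with rfl | hb1
  · have : r * k ≠ 0 := (Nat.mul_pos hr hk).ne'
    simp [betaLaw, this]
  · have hβ : 0 < r * (b - 1) := mul_pos (by exact_mod_cast hr) (sub_pos.2 hb1)
    have h2 := integral_pow_mul_one_sub_pow_betaMeasure hb0 hβ 0 (r * k)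
    simp only [pow_zero, one_mul, CharP.cast_eq_zero, add_zero] at h2
    simp only [integral_pow_betaLaw (ha _) (sub_nonneg.2 (hba _)), add_sub_cancel]
    rw [betaLaw, if_neg hβ.ne', integral_pow_mul_one_sub_pow_betaMeasure hb0 hβ, h2,
      integral_edgeGramDet_pow_radialLaw hr hrn k κ hb hκ, beta_moment_identity hb0 hβ]
    simp only [Nat.cast_add, Nat.cast_sub hrn, Nat.cast_one]

lemma ae_norm_le_one_betaModel (n : ℕ) (ν : ℝ) : ∀ᵐ x ∂(betaModel n ν), ‖x‖ ≤ 1 := by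
  rw [betaModel, ae_withDensity_iff
    (Measurable.ite (measurableSet_lt (by fun_prop) (by fun_prop)) (by fun_prop)
      (by fun_prop)).ennreal_ofReal]
  refine Filter.Eventually.of_forall fun x h => ?_
  by_contra! h2
  simp [h2.not_gt] at h

end RandomSimplex

/-! ### Assembly of the four models -/

theorem mainTheorem7 {Ω : Type*} [MeasurableSpace Ω] (μ : Measure Ω) [IsProbabilityMeasure μ]
    {Ω' : Type*} [MeasurableSpace Ω'] (μ' : Measure Ω') [IsProbabilityMeasure μ']
    (n r : ℕ) (hr : 1 ≤ r) (hrn : r ≤ n)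
    (X : Fin (r + 1) → Ω → EuclideanSpace ℝ (Fin n)) (hX : iIndepFun X μ)
    (V : Ω → ℝ) (hV : V = fun ω => RandomSimplex.simplexVolume fun i => X i ω) :
    -- Gaussian model
    ((∀ i, HasLaw (X i) (RandomSimplex.gaussianModel n) μ) →
      ∀ Q : Fin r → Ω' → ℝ, iIndepFun Q μ' →
      (∀ j : Fin r, HasLaw (Q j) (RandomSimplex.chiSquareLaw (n - r + (j + 1))) μ') →
      IdentDistrib (fun ω => (r.factorial * V ω) ^ 2)
        (fun ω' => ((r : ℝ) + 1) * ∏ j, Q j ω') μ μ') ∧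
    -- Beta model
    (∀ ν : ℝ, 0 < ν → 2 ≤ n + ν →
      (∀ i, HasLaw (X i) (RandomSimplex.betaModel n ν) μ) →
      ∀ (ξ : Ω → ℝ) (η : Ω' → ℝ) (B : Fin r → Ω' → ℝ),
      HasLaw ξ (RandomSimplex.betaLaw ((n + ν) / 2) (r * (n + ν - 2) / 2)) μ →
      IndepFun ξ V μ →
      HasLaw η (RandomSimplex.betaLaw ((n + ν) / 2) (r * (n + ν - 2) / 2)) μ' →
      (∀ j : Fin r, HasLaw (B j)
        (RandomSimplex.betaLaw (((n : ℝ) - r + ((j : ℝ) + 1)) / 2)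
          ((ν + r - ((j : ℝ) + 1)) / 2)) μ') →
      iIndepFun B μ' → IndepFun η (fun ω' j => B j ω') μ' →
      IdentDistrib (fun ω => ξ ω * (1 - ξ ω) ^ r * (r.factorial * V ω) ^ 2)
        (fun ω' => (1 - η ω') ^ r * ∏ j, B j ω') μ μ') ∧
    -- Beta prime model
    (∀ ν : ℝ, 0 < ν →
      (∀ i, HasLaw (X i) (RandomSimplex.betaPrimeModel n ν) μ) →
      ∀ (η : Ω → ℝ) (ξ : Ω' → ℝ) (B : Fin r → Ω' → ℝ),
      HasLaw η (RandomSimplex.betaPrimeLaw (ν / 2) (r * ν / 2)) μ →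
      IndepFun η V μ →
      HasLaw ξ (RandomSimplex.betaPrimeLaw (ν / 2) (r * ν / 2)) μ' →
      (∀ j : Fin r, HasLaw (B j)
        (RandomSimplex.betaPrimeLaw (((n : ℝ) - r + ((j : ℝ) + 1)) / 2) (ν / 2)) μ') →
      iIndepFun B μ' → IndepFun ξ (fun ω' j => B j ω') μ' →
      IdentDistrib (fun ω => (1 + η ω) ^ r * (r.factorial * V ω) ^ 2)
        (fun ω' => (ξ ω')⁻¹ * (1 + ξ ω') ^ (r + 1) * ∏ j, B j ω') μ μ') ∧
    -- Spherical model
    (2 ≤ n →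
      (∀ i, HasLaw (X i) (RandomSimplex.sphericalModel n) μ) →
      ∀ (ξ : Ω → ℝ) (η : Ω' → ℝ) (B : Fin r → Ω' → ℝ),
      HasLaw ξ (RandomSimplex.betaLaw ((n : ℝ) / 2) (r * ((n : ℝ) - 2) / 2)) μ →
      IndepFun ξ V μ →
      HasLaw η (RandomSimplex.betaLaw ((n : ℝ) / 2) (r * ((n : ℝ) - 2) / 2)) μ' →
      (∀ j : Fin r, HasLaw (B j)
        (RandomSimplex.betaLaw (((n : ℝ) - r + ((j : ℝ) + 1)) / 2)
          (((r : ℝ) - ((j : ℝ) + 1)) / 2)) μ') →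
      iIndepFun B μ' → IndepFun η (fun ω' j => B j ω') μ' →
      IdentDistrib (fun ω => ξ ω * (1 - ξ ω) ^ r * (r.factorial * V ω) ^ 2)
        (fun ω' => (1 - η ω') ^ r * ∏ j, B j ω') μ μ') := by
  subst hV
  have hn : 0 < n := by omega
  have : NeZero n := ⟨hn.ne'⟩
  have hD : ∀ ω, ((r.factorial : ℝ) * RandomSimplex.simplexVolume fun i => X i ω) ^ 2 =
      RandomSimplex.edgeGramDet fun i => X i ω := fun ω =>
    RandomSimplex.factorial_mul_simplexVolume_sq _
  have hind : ∀ ζ : Ω → ℝ, IndepFun ζ (fun ω => RandomSimplex.simplexVolume fun i => X i ω) μ →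
      IndepFun ζ (fun ω => RandomSimplex.edgeGramDet fun i => X i ω) μ := fun ζ h => by
    simp only [← hD]
    exact h.comp measurable_id (by fun_prop : Measurable fun v : ℝ => ((r.factorial : ℝ) * v) ^ 2)
  simp only [hD]
  refine ⟨fun hlaw Q hQ hQlaw => RandomSimplex.identDistrib_gaussian hrn hX hlaw hQ hQlaw,
    fun ν hν h2 hlaw ξ η B hξ hi hη hB hBi hi' => ?_,
    fun ν hν hlaw η ξ B hη hi hξ hB hBi hi' => RandomSimplex.identDistrib_betaPrime hr hrn hX hν hlaw
      hη (hind _ hi) hξ hB hBi hi',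
    fun h2 hlaw ξ η B hξ hi hη hB hBi hi' => ?_⟩
  -- The normalisation of the beta density is read off from its being the law of a random point.
  · have : IsProbabilityMeasure (RandomSimplex.betaModel n ν) :=
      (hlaw 0).isProbabilityMeasure_iff.1 inferInstance
    have hball := RandomSimplex.ae_norm_le_one_betaModel n ν
    have hnorm : Measurable fun x : EuclideanSpace ℝ (Fin n) => ‖x‖ := by fun_prop
    have := Measure.isProbabilityMeasure_map (μ := RandomSimplex.betaModel n ν) hnorm.aemeasurable
    have hmom := RandomSimplex.norm_moment_betaModel hn hν
    rw [RandomSimplex.betaModel_eq_radialLaw] at hlaw hball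
    rw [show (r : ℝ) * (n + ν - 2) / 2 = r * ((n + ν) / 2 - 1) by ring] at hξ hη
    refine RandomSimplex.identDistrib_radialLaw hr hrn hX (b := (n + ν) / 2) (by linarith) hmom
      hlaw hball hξ (hind _ hi) hη (fun j => ?_) (fun j => ?_) hBi hi'
    · have : ((j : ℕ) : ℝ) + 1 ≤ r := by exact_mod_cast j.2
      linarith
    · convert hB j using 2
      ring
  · have hball : ∀ᵐ x ∂(RandomSimplex.sphericalModel n), ‖x‖ ≤ 1 :=
      (RandomSimplex.ae_norm_eq_one_sphericalModel n).mono fun x hx => hx.le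
    rw [RandomSimplex.sphericalModel_eq_radialLaw] at hlaw hball
    rw [show (r : ℝ) * ((n : ℝ) - 2) / 2 = r * ((n : ℝ) / 2 - 1) by ring] at hξ hη
    have h2' : (2 : ℝ) ≤ n := by exact_mod_cast h2
    -- With $b=n/2$ the prescribed radial moments all equal $1$, as they must for radius $1$.
    refine RandomSimplex.identDistrib_radialLaw hr hrn hX (b := (n : ℝ) / 2) (by linarith)
      (fun d => ⟨integrable_dirac (by simp), ?_⟩) hlaw hball hξ (hind _ hi) hη (fun j => ?_)
      (fun j => ?_) hBi hi'
    · have h3 := Real.Gamma_pos_of_pos (show 0 < (n : ℝ) / 2 by positivity)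
      have h4 := Real.Gamma_pos_of_pos (show 0 < (n : ℝ) / 2 + (d : ℝ) / 2 by positivity)
      rw [integral_dirac, one_pow, div_self (by positivity)]
    · have : ((j : ℕ) : ℝ) + 1 ≤ r := by exact_mod_cast j.2
      linarith
    · convert hB j using 2
      ring
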